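/- A space $Y$ is a condensation of a space $X$ (and $X$ condenses onto $Y$) if there is a continuous bijection $X \to Y$; two spaces are similar if each is a condensation of the other. A PCU space is a topological space of cardinality $\mathfrak{c} = 2^{\aleph_0}$ without isolated points whose topology is induced by a complete ultrametric. The similarity types of PCU spaces are the equivalence classes of PCU spaces under similarity, ordered by the relation induced by condensation. Theorem. Let $n < \omega$ and assume $\mathfrak{c} = \omega_n$. The following are equivalent: 1. There are exactly $n+3$ similarity types of PCU spaces, and these are totally ordered by condensation. 2. There are exactly $n+3$ similarity types of PCU spaces. 3. The similarity types of PCU spaces are totally ordered by condensation. 4. $2^\omega$ is a condensation of every PCU space. 5. For every cardinal $\kappa$ with $1 \leq \kappa \leq \mathfrak{c}$, there is a partition of $2^\omega$ into $\kappa$ nonempty closed sets. -/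

import Mathlib

open Cardinal

universe u v

/-- `CondensesOnto X Y`: there is a continuous bijection `X → Y`, that is, `Y` is a condensation
of `X`. -/
def CondensesOnto (X : Type u) (Y : Type v) [TopologicalSpace X] [TopologicalSpace Y] : Prop :=
  ∃ f : X → Y, Continuous f ∧ Function.Bijective f

/-- A topological space is completely ultrametrizable if its topology is induced by a complete
ultrametric. -/
def IsCompletelyUltrametrizable (X : Type u) [t : TopologicalSpace X] : Prop :=
  ∃ m : MetricSpace X, m.toUniformSpace.toTopologicalSpace = t ∧
    @CompleteSpace X m.toUniformSpace ∧ @IsUltrametricDist X m.toDist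

/-- A PCU space: a perfect (no isolated points) completely ultrametrizable space of
cardinality `𝔠`. -/
structure PCUSpace : Type (u + 1) where
  carrier : Type u
  [top : TopologicalSpace carrier]
  perfect : PerfectSpace carrier
  completelyUltrametrizable : IsCompletelyUltrametrizable carrier
  card_eq : #carrier = 𝔠

attribute [instance] PCUSpace.top

/-- PCU spaces are preordered by the condensation relation: `X ≤ Y` means that `X` is a
condensation of `Y`. -/
instance PCUSpace.instPreorder : Preorder PCUSpace.{u} where
  le X Y := CondensesOnto Y.carrier X.carrier
  le_refl _ := ⟨id, continuous_id, Function.bijective_id⟩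
  le_trans _ _ _ := fun ⟨f, hf, hf'⟩ ⟨g, hg, hg'⟩ => ⟨f ∘ g, hf.comp hg, hf'.comp hg'⟩

/-- The similarity types of PCU spaces: classes of the relation "each of the two spaces condenses
onto the other". The induced order on them is the condensation relation. -/
abbrev PCUSimilarityType : Type (u + 1) :=
  Antisymmetrization PCUSpace.{u} (· ≤ ·)

/-- The space `X` can be partitioned into exactly `κ` (nonempty) closed sets. -/
def HasClosedPartition (X : Type u) [TopologicalSpace X] (κ : Cardinal.{u}) : Prop :=
  ∃ P : Set (Set X), Setoid.IsPartition P ∧ (∀ C ∈ P, IsClosed C) ∧ #P = κ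

section

open Set Filter Topology Metric

/-! ### Condensations built from matching partitions -/

/-! All condensations between complete ultrametric spaces come from one scheme,
`condensesOnto_of_split`. Domain and target are cut repeatedly into matching small pieces with the
same index set, and a point is sent to the point whose pieces match its own. Continuity only needs
the domain pieces to be relatively clopen; the target pieces may be merely closed. Hence a target
that is compact, or has few balls of each radius, can still match a domain with κ pieces, provided
that a Cantor set splits into κ closed sets. This is where condition 5 enters.

Assume condition 5. A PCU space of countable cellularity is similar to `2 ^ ω`, `ω × 2 ^ ω` or `ω ^
ω`, according to whether it is compact, σ-compact but not compact, or not σ-compact; the last case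
rests on `condensesOnto_of_nowhereCompact`. If the least `ℵ_k` bounding the cellularity of `X` has
`k > 0`, then `X` splits into `ℵ_k` clopen pieces, each condensing onto `2 ^ ω`, so `X` condenses
onto `ω_k × 2 ^ ω`. Conversely `ω_k × 2 ^ ω` condenses onto `ω_k ^ ω` and this onto `X`
(`sequences_condensesOnto`). The first of these arrows needs a partition of `ω_k ^ ω` into `ℵ_k`
compact sets. A partition of the Cantor space into `ℵ₁` closed sets gives one of `ω ^ ω` into `ℵ₁`
compact sets (`hasCompactFibers_baire`), and `HasCompactFibers.succ` climbs from each aleph to the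
next. Compactness, σ-compactness and cellularity separate the resulting `n + 3` models, and the same
arrows put them in a chain.

For the converses, the models are pairwise non-similar without any partition hypothesis. If there
are only `n + 3` types, each `ω_{k+1} ^ ω` with `k < n` must therefore be similar to `ω_{k+1} × 2 ^
ω`, and these similarities produce the closed partitions (`exists_not_similar`). If the types are
totally ordered, then `2 ^ ω` lies below every type, because a compact space condenses onto a
Hausdorff space only by a homeomorphism. Finally, a condensation of `κ × 2 ^ ω` onto `2 ^ ω` carries
the slices to κ disjoint closed sets. -/

/-- Any two points of `A` are at distance at most `ε`. -/
def IsSmall {X : Type*} [MetricSpace X] (ε : ℝ) (A : Set X) : Prop :=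
  ∀ x ∈ A, ∀ y ∈ A, dist x y ≤ ε

theorem IsSmall.mono {X : Type*} [MetricSpace X] {ε : ℝ} {A B : Set X} (h : IsSmall ε B)
    (hAB : A ⊆ B) : IsSmall ε A :=
  fun x hx y hy => h x (hAB hx) y (hAB hy)

theorem IsSmall.of_le {X : Type*} [MetricSpace X] {ε δ : ℝ} {A : Set X} (h : IsSmall δ A)
    (hδ : δ ≤ ε) : IsSmall ε A :=
  fun x hx y hy => (h x hx y hy).trans hδ

/-- Cantor's intersection theorem. The bound starts at `s (n + 1)`, since the initial set of a
splitting scheme may be arbitrarily large. -/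
theorem exists_mem_of_antitone_of_isSmall {X : Type*} [MetricSpace X] [CompleteSpace X]
    (s : ℕ → Set X) (hc : ∀ n, IsClosed (s n)) (hne : ∀ n, (s n).Nonempty) (ha : Antitone s)
    (hs : ∀ n : ℕ, IsSmall (1 / ((n : ℝ) + 1)) (s (n + 1))) : ∃ x, ∀ n, x ∈ s n := by
  choose u hu using hne
  have hcau : CauchySeq (fun n => u (n + 1)) := by
    refine cauchySeq_of_le_tendsto_0' (fun n : ℕ => 1 / ((n : ℝ) + 1)) (fun n m hnm => ?_)
      tendsto_one_div_add_atTop_nhds_zero_nat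
    exact hs n _ (hu _) _ (ha (by omega) (hu (m + 1)))
  obtain ⟨x, hx⟩ := cauchySeq_tendsto_of_complete hcau
  refine ⟨x, fun n => (hc n).mem_of_tendsto hx ?_⟩
  filter_upwards [eventually_ge_atTop n] with m hm
  exact ha (by omega) (hu (m + 1))

theorem eq_of_forall_dist_le_one_div {X : Type*} [MetricSpace X] {x y : X}
    (h : ∀ n : ℕ, dist x y ≤ 1 / ((n : ℝ) + 1)) : x = y :=
  dist_le_zero.1 (ge_of_tendsto' tendsto_one_div_add_atTop_nhds_zero_nat h)

/-- If every pair of closed sets related by `R` can be split into arbitrarily small pairs related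
by `R`, the first side being split into relatively clopen sets, then `R A B` implies that `A`
condenses onto `B`. -/
theorem condensesOnto_of_split {X Y : Type*} [MetricSpace X] [CompleteSpace X] [MetricSpace Y]
    [CompleteSpace Y] (R : Set X → Set Y → Prop)
    (hR : ∀ A B, R A B → (IsClosed A ∧ A.Nonempty) ∧ IsClosed B ∧ B.Nonempty)
    (hs : ∀ A B, R A B → ∀ ε > (0 : ℝ), ∃ (ι : Type) (p : X → ι) (q : Y → ι),
      IsLocallyConstant p ∧ ∀ i, R (A ∩ p ⁻¹' {i}) (B ∩ q ⁻¹' {i}) ∧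
        IsSmall ε (A ∩ p ⁻¹' {i}) ∧ IsSmall ε (B ∩ q ⁻¹' {i}))
    {A : Set X} {B : Set Y} (h : R A B) : CondensesOnto A B := by
  let Pr := {s : Set X × Set Y // R s.1 s.2}
  have hs' : ∀ (s : Pr) (n : ℕ), ∃ (ι : Type) (p : X → ι) (q : Y → ι),
      IsLocallyConstant p ∧ ∀ i, R (s.1.1 ∩ p ⁻¹' {i}) (s.1.2 ∩ q ⁻¹' {i}) ∧
        IsSmall (1 / ((n : ℝ) + 1)) (s.1.1 ∩ p ⁻¹' {i}) ∧
        IsSmall (1 / ((n : ℝ) + 1)) (s.1.2 ∩ q ⁻¹' {i}) :=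
    fun s n => hs _ _ s.2 _ (by positivity)
  choose ι p q hp hpq using hs'
  let child : (s : Pr) → (n : ℕ) → ι s n → Pr := fun s n i =>
    ⟨(s.1.1 ∩ p s n ⁻¹' {i}, s.1.2 ∩ q s n ⁻¹' {i}), (hpq s n i).1⟩
  let s₀ : Pr := ⟨(A, B), h⟩
  -- `sx x` is the branch of pairs obtained by always following the domain label of `x`, and `sy y`
  -- the branch following the target label of `y`.
  let sx : X → ℕ → Pr := fun x n => Nat.rec s₀ (fun n s => child s n (p s n x)) n
  let sy : Y → ℕ → Pr := fun y n => Nat.rec s₀ (fun n s => child s n (q s n y)) n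
  have hsx : ∀ x n, sx x (n + 1) = child (sx x n) n (p (sx x n) n x) := fun _ _ => rfl
  have hsy : ∀ y n, sy y (n + 1) = child (sy y n) n (q (sy y n) n y) := fun _ _ => rfl
  have memx : ∀ x ∈ A, ∀ n, x ∈ (sx x n).1.1 := by
    intro x hx n
    induction n with
    | zero => exact hx
    | succ n ih => exact ⟨ih, rfl⟩
  have memy : ∀ y ∈ B, ∀ n, y ∈ (sy y n).1.2 := by
    intro x hx n
    induction n with
    | zero => exact hx
    | succ n ih => exact ⟨ih, rfl⟩
  have hf : ∀ x, ∃ y, ∀ n, y ∈ (sx x n).1.2 := fun x =>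
    exists_mem_of_antitone_of_isSmall _ (fun n => (hR _ _ (sx x n).2).2.1)
      (fun n => (hR _ _ (sx x n).2).2.2) (antitone_nat_of_succ_le fun n => inter_subset_left)
      (fun n => (hpq (sx x n) n _).2.2)
  have hg : ∀ y, ∃ x, ∀ n, x ∈ (sy y n).1.1 := fun y =>
    exists_mem_of_antitone_of_isSmall _ (fun n => (hR _ _ (sy y n).2).1.1)
      (fun n => (hR _ _ (sy y n).2).1.2) (antitone_nat_of_succ_le fun n => inter_subset_left)
      (fun n => (hpq (sy y n) n _).2.1)
  choose f hf using hf
  choose g hg using hg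
  -- A point lying in all target pieces along the branch of `x` has that same branch. So `g (f x)`
  -- and `x` share arbitrarily small pieces, which makes `f` and `g` mutually inverse.
  have e₁ : ∀ x y, (∀ n, y ∈ (sx x n).1.2) → ∀ n, sy y n = sx x n := by
    intro x y hxy n
    induction n with
    | zero => rfl
    | succ n ih =>
      have : q (sx x n) n y = p (sx x n) n x := (hxy (n + 1)).2
      rw [hsx, hsy, ih, this]
  have e₂ : ∀ x y, (∀ n, x ∈ (sy y n).1.1) → ∀ n, sx x n = sy y n := by
    intro x y hxy n
    induction n with
    | zero => rfl
    | succ n ih =>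
      have : p (sy y n) n x = q (sy y n) n y := (hxy (n + 1)).2
      rw [hsx, hsy, ih, this]
  have gf : ∀ x ∈ A, g (f x) = x := fun x hx => eq_of_forall_dist_le_one_div fun n =>
    (hpq (sx x n) n _).2.1 _ (by simpa only [e₁ x _ (hf x)] using hg (f x) (n + 1)) _
      (memx x hx (n + 1))
  have fg : ∀ y ∈ B, f (g y) = y := fun y hy => eq_of_forall_dist_le_one_div fun n =>
    (hpq (sy y n) n _).2.2 _ (by simpa only [e₂ _ y (hg y)] using hf (g y) (n + 1)) _
      (memy y hy (n + 1))
  -- Only the maps `p` are known to be locally constant. This gives continuity of `f`, and nothing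
  -- for `g`.
  have hloc : ∀ x n, ∀ᶠ x' in 𝓝 x, sx x' n = sx x n := by
    intro x n
    induction n with
    | zero => exact Eventually.of_forall fun _ => rfl
    | succ n ih =>
      filter_upwards [ih, (hp (sx x n) n).eventually_eq x] with x' h₁ h₂
      rw [hsx, hsx, h₁, h₂]
  refine ⟨fun x => ⟨f x, hf x 0⟩, ?_, ?_, ?_⟩
  · refine Continuous.subtype_mk (continuous_iff_continuousAt.2 fun x => ?_) _
    rw [ContinuousAt, Metric.tendsto_nhds]
    intro ε hε
    obtain ⟨n, hn⟩ := exists_nat_one_div_lt hε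
    filter_upwards [continuous_subtype_val.continuousAt.eventually (hloc x.1 (n + 1))] with x' hx'
    refine lt_of_le_of_lt ((hpq (sx x n) n _).2.2 _ ?_ _ (hf x (n + 1))) hn
    have := hf x' (n + 1)
    rwa [hx'] at this
  · intro x x' hxx'
    have := congrArg g (congrArg Subtype.val hxx')
    simp only at this
    rw [gf _ x.2, gf _ x'.2] at this
    exact Subtype.ext this
  · intro y
    exact ⟨⟨g y, hg y 0⟩, Subtype.ext (fg _ y.2)⟩

/-! ### Partitions of perfect sets -/

theorem Perfect.inter_isClopen {X : Type*} [TopologicalSpace X] {A U : Set X} (hA : Perfect A)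
    (hU : IsClopen U) : Perfect (A ∩ U) :=
  ⟨hA.closed.inter hU.isClosed, by rw [inter_comm]; exact hA.acc.open_inter hU.isOpen⟩

theorem Preperfect.image_of_injective {X Y : Type*} [TopologicalSpace X] [TopologicalSpace Y]
    {C : Set X} (hC : Preperfect C) {f : X → Y} (hf : Continuous f) (hi : Function.Injective f) :
    Preperfect (f '' C) := by
  rw [preperfect_iff_nhds] at hC ⊢
  rintro _ ⟨x, hx, rfl⟩ U hU
  obtain ⟨y, ⟨hyU, hyC⟩, hyx⟩ := hC x hx _ (hf.continuousAt hU)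
  exact ⟨f y, ⟨hyU, mem_image_of_mem f hyC⟩, hi.ne hyx⟩

theorem preperfect_prod_univ {X Y : Type*} [TopologicalSpace X] [TopologicalSpace Y]
    [PerfectSpace Y] (C : Set X) : Preperfect (C ×ˢ (univ : Set Y)) := by
  rw [preperfect_iff_nhds]
  rintro ⟨x, y⟩ ⟨hx, -⟩ U hU
  have hU' : (fun z => (x, z)) ⁻¹' U ∈ 𝓝 y :=
    (Continuous.prodMk_right x).continuousAt.preimage_mem_nhds hU
  obtain ⟨z, ⟨hzU, -⟩, hzy⟩ :=
    preperfect_iff_nhds.1 (PerfectSpace.univ_preperfect (α := Y)) y (mem_univ _) _ hU'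
  exact ⟨(x, z), ⟨hzU, hx, mem_univ _⟩, fun h => hzy (Prod.ext_iff.1 h).2⟩

/-- Labels not attained on `A` go to the label of some point of `A`, so that the relabelling is a
total map after `p` and local constancy of `p` survives composition. -/
theorem exists_reindex {X ι κ : Type*} (p : X → ι) {A : Set X} (hA : A.Nonempty)
    (e : p '' A ≃ κ) :
    ∃ F : ι → κ, ∀ j, ∃ x ∈ A, A ∩ (F ∘ p) ⁻¹' {j} = A ∩ p ⁻¹' {p x} := by
  classical
  obtain ⟨a, ha⟩ := hA
  refine ⟨fun i => if h : i ∈ p '' A then e ⟨i, h⟩ else e ⟨p a, a, ha, rfl⟩, fun j => ?_⟩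
  obtain ⟨⟨i, x, hx, rfl⟩, rfl⟩ := e.surjective j
  refine ⟨x, hx, ?_⟩
  ext y
  simp only [mem_inter_iff, mem_preimage, mem_singleton_iff, Function.comp_apply]
  refine and_congr_right fun hy => ?_
  have h : p y ∈ p '' A := mem_image_of_mem p hy
  rw [dif_pos h]
  exact e.injective.eq_iff.trans Subtype.mk_eq_mk

/-! ### Balls of a fixed radius as a clopen partition -/

section Ultrametric

variable {X : Type*} [MetricSpace X] [IsUltrametricDist X]

theorem ball_eq_ball_iff_mem {x y : X} {ε : ℝ} (hε : 0 < ε) :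
    ball x ε = ball y ε ↔ x ∈ ball y ε :=
  ⟨fun h => h ▸ mem_ball_self hε, fun h => (IsUltrametricDist.ball_eq_of_mem h).symm⟩

theorem isLocallyConstant_ball {ε : ℝ} (hε : 0 < ε) :
    IsLocallyConstant (fun x : X => ball x ε) := by
  rw [IsLocallyConstant.iff_eventually_eq]
  intro x
  filter_upwards [ball_mem_nhds x hε] with y hy
  exact (ball_eq_ball_iff_mem hε).2 hy

theorem isSmall_ball_fiber {ε : ℝ} (hε : 0 < ε) (U : Set X) :
    IsSmall ε ((fun x : X => ball x ε) ⁻¹' {U}) := by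
  intro x hx y hy
  exact le_of_lt ((ball_eq_ball_iff_mem hε).1 (hx.trans hy.symm))

end Ultrametric

theorem IsCompact.finite_image_of_isLocallyConstant {X ι : Type*} [TopologicalSpace X] {A : Set X}
    (hA : IsCompact A) {p : X → ι} (hp : IsLocallyConstant p) : (p '' A).Finite := by
  let _ : TopologicalSpace ι := ⊥
  have : DiscreteTopology ι := ⟨rfl⟩
  exact isCompact_iff_finite.1 (hA.image hp.continuous)

/-- `A` is partitioned by relatively clopen sets, indexed by `κ`, that are nonempty, perfect and
of diameter at most `ε`. -/
def HasClopenSplit {X : Type*} [MetricSpace X] (ε : ℝ) (A : Set X) (κ : Type*) : Prop :=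
  ∃ p : X → κ, IsLocallyConstant p ∧
    ∀ i, Perfect (A ∩ p ⁻¹' {i}) ∧ (A ∩ p ⁻¹' {i}).Nonempty ∧ IsSmall ε (A ∩ p ⁻¹' {i})

/-- `B` is partitioned by nonempty perfect sets, indexed by `κ`, of diameter at most `ε`. -/
def HasPerfectSplit {Y : Type*} [MetricSpace Y] (ε : ℝ) (B : Set Y) (κ : Type*) : Prop :=
  ∃ q : Y → κ,
    ∀ i, Perfect (B ∩ q ⁻¹' {i}) ∧ (B ∩ q ⁻¹' {i}).Nonempty ∧ IsSmall ε (B ∩ q ⁻¹' {i})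

/-- The space `Z` is the disjoint union of nonempty closed sets indexed by `κ`. -/
def HasClosedFibers (Z κ : Type*) [TopologicalSpace Z] : Prop :=
  ∃ g : Z → κ, Function.Surjective g ∧ ∀ i, IsClosed (g ⁻¹' {i})

theorem HasClopenSplit.hasPerfectSplit {X κ : Type*} [MetricSpace X] {ε : ℝ} {A : Set X}
    (h : HasClopenSplit ε A κ) : HasPerfectSplit ε A κ :=
  let ⟨p, _, h⟩ := h
  ⟨p, h⟩

theorem HasClosedFibers.congr {Z κ κ' : Type*} [TopologicalSpace Z] (h : HasClosedFibers Z κ)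
    (e : κ ≃ κ') : HasClosedFibers Z κ' := by
  obtain ⟨g, hg, hc⟩ := h
  refine ⟨e ∘ g, e.surjective.comp hg, fun i => ?_⟩
  have : e ∘ g ⁻¹' {i} = g ⁻¹' {e.symm i} := by
    ext x; simp [Equiv.eq_symm_apply]
  rw [this]
  exact hc _

theorem hasPerfectSplit_of_image {Y ι κ : Type*} [MetricSpace Y] {ε : ℝ} {B : Set Y}
    (hB : B.Nonempty) (q : Y → ι) (e : q '' B ≃ κ)
    (h : ∀ y ∈ B, Perfect (B ∩ q ⁻¹' {q y}) ∧ IsSmall ε (B ∩ q ⁻¹' {q y})) :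
    HasPerfectSplit ε B κ := by
  obtain ⟨F, hF⟩ := exists_reindex q hB e
  refine ⟨F ∘ q, fun i => ?_⟩
  obtain ⟨x, hx, hxi⟩ := hF i
  rw [hxi]
  exact ⟨(h x hx).1, ⟨x, hx, rfl⟩, (h x hx).2⟩

theorem hasClopenSplit_of_image {X ι κ : Type*} [MetricSpace X] {ε : ℝ} {A : Set X}
    (hA : Perfect A) (hne : A.Nonempty) (p : X → ι) (hp : IsLocallyConstant p) (e : p '' A ≃ κ)
    (h : ∀ x ∈ A, IsSmall ε (A ∩ p ⁻¹' {p x})) : HasClopenSplit ε A κ := by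
  obtain ⟨F, hF⟩ := exists_reindex p hne e
  refine ⟨F ∘ p, hp.comp F, fun i => ?_⟩
  obtain ⟨x, hx, hxi⟩ := hF i
  rw [hxi]
  exact ⟨hA.inter_isClopen (hp.isClopen_fiber _), ⟨x, hx, rfl⟩, h x hx⟩

theorem HasClopenSplit.congr {X κ κ' : Type*} [MetricSpace X] {ε : ℝ} {A : Set X}
    (h : HasClopenSplit ε A κ) (e : κ ≃ κ') : HasClopenSplit ε A κ' := by
  obtain ⟨p, hp, h⟩ := h
  refine ⟨e ∘ p, hp.comp e, fun i => ?_⟩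
  have : e ∘ p ⁻¹' {i} = p ⁻¹' {e.symm i} := by
    ext x; simp [Equiv.eq_symm_apply]
  rw [this]
  exact h _

/-! ### Clopen splittings into a prescribed number of pieces -/

section Ultrametric

variable {X : Type*} [MetricSpace X] [IsUltrametricDist X]

theorem hasClopenSplit_ball {A : Set X} (hA : Perfect A) (hne : A.Nonempty) {ε : ℝ} (hε : 0 < ε) :
    HasClopenSplit ε A ((fun x : X => ball x ε) '' A) :=
  hasClopenSplit_of_image hA hne _ (isLocallyConstant_ball hε) (Equiv.refl _) fun _ _ =>
    (isSmall_ball_fiber hε _).mono inter_subset_right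

/-- A perfect piece contains two distinct points `a` and `b`. The ball around `a` of radius `dist b
a` is clopen and omits `b`, so it cuts that piece in two. -/
theorem HasClopenSplit.option {A : Set X} (hA : Perfect A) {ε : ℝ} {κ : Type*} [Nonempty κ]
    (h : HasClopenSplit ε A κ) : HasClopenSplit ε A (Option κ) := by
  classical
  obtain ⟨p, hp, h⟩ := h
  obtain ⟨i₀⟩ := ‹Nonempty κ›
  obtain ⟨hP, ⟨a, haA, ha⟩, -⟩ := h i₀
  obtain ⟨b, ⟨-, hbA, hb⟩, hba⟩ := preperfect_iff_nhds.1 hP.acc a ⟨haA, ha⟩ univ univ_mem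
  have hr : 0 < dist b a := dist_pos.2 hba
  have hball : ball b (dist b a) ≠ ball a (dist b a) := by
    rw [Ne, ball_eq_ball_iff_mem hr, mem_ball]
    exact lt_irrefl _
  let F : κ × Set X → Option κ :=
    fun z => if z.1 = i₀ ∧ z.2 = ball a (dist b a) then none else some z.1
  have hloc : IsLocallyConstant (fun x => F (p x, ball x (dist b a))) :=
    (hp.prodMk (isLocallyConstant_ball hr)).comp F
  have hFsome : ∀ z i, F z = some i → z.1 = i := by
    intro z i hz
    by_cases hc : z.1 = i₀ ∧ z.2 = ball a (dist b a)
    · simp [F, hc] at hz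
    · simpa [F, hc] using hz
  have hFnone : ∀ z, F z = none → z.1 = i₀ := by
    intro z hz
    by_cases hc : z.1 = i₀ ∧ z.2 = ball a (dist b a)
    · exact hc.1
    · simp [F, hc] at hz
  refine ⟨_, hloc, fun i => ⟨hA.inter_isClopen (hloc.isClopen_fiber i), ?_, ?_⟩⟩
  · rcases i with _ | i
    · refine ⟨a, haA, ?_⟩
      have ha' : p a = i₀ := ha
      simp [F, ha']
    · by_cases hi : i = i₀
      · refine ⟨b, hbA, ?_⟩
        have hb' : p b = i₀ := hb
        simp [F, hb', hball, hi]
      · obtain ⟨c, hcA, hc⟩ := (h i).2.1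
        refine ⟨c, hcA, ?_⟩
        have hc' : p c = i := hc
        simp [F, hc', hi]
  · rcases i with _ | i
    · exact (h i₀).2.2.mono fun x hx => ⟨hx.1, hFnone _ hx.2⟩
    · exact (h i).2.2.mono fun x hx => ⟨hx.1, hFsome _ _ hx.2⟩

theorem HasClopenSplit.of_le {A : Set X} (hA : Perfect A) {ε : ℝ} {m n : ℕ} (hm : m ≠ 0)
    (h : HasClopenSplit ε A (Fin m)) (hmn : m ≤ n) : HasClopenSplit ε A (Fin n) := by
  induction n, hmn using Nat.le_induction with
  | base => exact h
  | succ n hn ih =>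
    have : Nonempty (Fin n) := ⟨⟨0, by omega⟩⟩
    exact (ih.option hA).congr (finSuccEquiv n).symm

/-- Every sufficiently large number of pieces is available, so two sets with finitely many balls of
the given radius can be cut into equally many pieces. -/
theorem exists_hasClopenSplit_fin {A : Set X} (hA : Perfect A) (hne : A.Nonempty) {ε : ℝ}
    (hε : 0 < ε) (hfin : ((fun x : X => ball x ε) '' A).Finite) :
    ∃ m : ℕ, ∀ n, m ≤ n → HasClopenSplit ε A (Fin n) := by
  let _ := hfin.fintype
  have : Nonempty ((fun x : X => ball x ε) '' A) := (hne.image _).to_subtype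
  have e := Fintype.equivFin ((fun x : X => ball x ε) '' A)
  exact ⟨_, fun n hn => ((hasClopenSplit_ball hA hne hε).congr e).of_le hA Fintype.card_ne_zero hn⟩

end Ultrametric

/-- Two nonempty compact perfect sets in complete ultrametric spaces are homeomorphic. -/
theorem nonempty_homeomorph_of_isCompact_of_perfect {X Y : Type*} [MetricSpace X]
    [CompleteSpace X] [IsUltrametricDist X] [MetricSpace Y] [CompleteSpace Y] [IsUltrametricDist Y]
    {A : Set X} {B : Set Y} (hA : Perfect A) (hAc : IsCompact A) (hAn : A.Nonempty)
    (hB : Perfect B) (hBc : IsCompact B) (hBn : B.Nonempty) : Nonempty (A ≃ₜ B) := by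
  have key : CondensesOnto A B := by
    refine condensesOnto_of_split (fun A B => (Perfect A ∧ IsCompact A ∧ A.Nonempty) ∧
      Perfect B ∧ IsCompact B ∧ B.Nonempty) (fun A B h => ⟨⟨h.1.1.closed, h.1.2.2⟩,
      h.2.1.closed, h.2.2.2⟩) ?_ ⟨⟨hA, hAc, hAn⟩, hB, hBc, hBn⟩
    rintro A B ⟨⟨hA, hAc, hAn⟩, hB, hBc, hBn⟩ ε hε
    obtain ⟨m, hm⟩ := exists_hasClopenSplit_fin hA hAn hε
      (hAc.finite_image_of_isLocallyConstant (isLocallyConstant_ball hε))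
    obtain ⟨n, hn⟩ := exists_hasClopenSplit_fin hB hBn hε
      (hBc.finite_image_of_isLocallyConstant (isLocallyConstant_ball hε))
    obtain ⟨p, hp, h₁⟩ := hm (max m n) (le_max_left _ _)
    obtain ⟨q, hq, h₂⟩ := hn (max m n) (le_max_right _ _)
    exact ⟨_, p, q, hp, fun i => ⟨⟨⟨(h₁ i).1, hAc.inter_right (hp.isClosed_fiber i), (h₁ i).2.1⟩,
      (h₂ i).1, hBc.inter_right (hq.isClosed_fiber i), (h₂ i).2.1⟩, (h₁ i).2.2, (h₂ i).2.2⟩⟩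
  obtain ⟨f, hf, hb⟩ := key
  have := isCompact_iff_compactSpace.1 hAc
  exact ⟨Continuous.homeoOfEquivCompactToT2 (f := Equiv.ofBijective f hb) hf⟩

/-! ### Completely ultrametrizable spaces -/

theorem IsCompletelyUltrametrizable.of_homeomorph {X Y : Type*} [TopologicalSpace X]
    [TopologicalSpace Y] (h : IsCompletelyUltrametrizable X) (e : Y ≃ₜ X) :
    IsCompletelyUltrametrizable Y := by
  obtain ⟨m, rfl, hc, hu⟩ := h
  let mY : MetricSpace Y := m.induced e e.injective
  have hi : Isometry e := Isometry.of_dist_eq fun _ _ => rfl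
  refine ⟨mY, e.isInducing.eq_induced.symm, ?_, ⟨fun x y z => hu.dist_triangle_max _ _ _⟩⟩
  exact (IsometryEquiv.mk e.toEquiv hi).completeSpace

theorem isCompletelyUltrametrizable_of_metric (X : Type*) [MetricSpace X] [CompleteSpace X]
    [IsUltrametricDist X] : IsCompletelyUltrametrizable X :=
  ⟨inferInstance, rfl, inferInstance, inferInstance⟩

theorem IsCompletelyUltrametrizable.of_isClosed {X : Type*} [TopologicalSpace X] {A : Set X}
    (h : IsCompletelyUltrametrizable X) (hA : IsClosed A) : IsCompletelyUltrametrizable A := by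
  obtain ⟨m, rfl, hc, hu⟩ := h
  exact ⟨inferInstance, rfl, hA.completeSpace_coe, inferInstance⟩

theorem IsCompletelyUltrametrizable.prod {X Y : Type*} [TopologicalSpace X] [TopologicalSpace Y]
    (hX : IsCompletelyUltrametrizable X) (hY : IsCompletelyUltrametrizable Y) :
    IsCompletelyUltrametrizable (X × Y) := by
  obtain ⟨m, rfl, hc, hu⟩ := hX
  obtain ⟨m', rfl, hc', hu'⟩ := hY
  refine ⟨inferInstance, rfl, inferInstance, ⟨fun x y z => ?_⟩⟩
  simp only [Prod.dist_eq]
  exact max_le ((hu.dist_triangle_max _ y.1 _).trans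
      (max_le_max (le_max_left _ _) (le_max_left _ _)))
    ((hu'.dist_triangle_max _ y.2 _).trans (max_le_max (le_max_right _ _) (le_max_right _ _)))

section Sequences

attribute [local instance] PiNat.metricSpace

theorem PiNat.isUltrametricDist (ι : Type*) [TopologicalSpace ι] [DiscreteTopology ι] :
    IsUltrametricDist (ℕ → ι) :=
  ⟨PiNat.dist_triangle_nonarch⟩

theorem isCompletelyUltrametrizable_sequences (ι : Type*) [TopologicalSpace ι]
    [DiscreteTopology ι] : IsCompletelyUltrametrizable (ℕ → ι) :=
  ⟨inferInstance, rfl, PiNat.completeSpace, PiNat.isUltrametricDist ι⟩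

theorem perfectSpace_sequences (ι : Type*) [TopologicalSpace ι] [DiscreteTopology ι]
    [Nontrivial ι] : PerfectSpace (ℕ → ι) := by
  refine ⟨preperfect_iff_nhds.2 fun x _ U hU => ?_⟩
  obtain ⟨_, ⟨z, n, rfl⟩, hxz, hz⟩ :=
    (PiNat.isTopologicalBasis_cylinders fun _ : ℕ => ι).mem_nhds_iff.1 hU
  obtain ⟨b, hb⟩ := exists_ne (x n)
  refine ⟨Function.update x n b, ⟨hz ?_, mem_univ _⟩, fun h => hb ?_⟩
  · rw [← PiNat.mem_cylinder_iff_eq.1 hxz]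
    exact PiNat.update_mem_cylinder x n b
  · simpa using congrFun h n

end Sequences

/-- A discrete space is homeomorphic to the closed set of constant sequences over it. -/
theorem isCompletelyUltrametrizable_of_discrete (ι : Type*) [TopologicalSpace ι]
    [DiscreteTopology ι] : IsCompletelyUltrametrizable ι := by
  have hc : IsClosed (range (fun (i : ι) (_ : ℕ) => i)) := by
    have : range (fun (i : ι) (_ : ℕ) => i) = ⋂ n : ℕ, {x : ℕ → ι | x n = x 0} := by
      ext x
      simp only [mem_range, mem_iInter, mem_ofPred_eq]
      exact ⟨by rintro ⟨i, rfl⟩ n; rfl, fun h => ⟨x 0, funext fun n => (h n).symm⟩⟩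
    rw [this]
    exact isClosed_iInter fun n => isClosed_eq (continuous_apply n) (continuous_apply 0)
  have he : IsEmbedding (fun (i : ι) (_ : ℕ) => i) :=
    Function.LeftInverse.isEmbedding (f := fun x : ℕ → ι => x 0) (fun _ => rfl)
      (continuous_apply 0) continuous_of_discreteTopology
  exact ((isCompletelyUltrametrizable_sequences ι).of_isClosed hc).of_homeomorph he.toHomeomorph

theorem perfectSpace_coe_of_perfect {X : Type*} [TopologicalSpace X] {A : Set X}
    (hA : Perfect A) : PerfectSpace A := by
  refine ⟨preperfect_iff_nhds.2 fun x _ U hU => ?_⟩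
  obtain ⟨V, hV, hVU⟩ := mem_nhds_subtype A x U |>.1 hU
  obtain ⟨y, ⟨hyV, hyA⟩, hyx⟩ := preperfect_iff_nhds.1 hA.acc x x.2 V hV
  exact ⟨⟨y, hyA⟩, ⟨hVU hyV, mem_univ _⟩, fun h => hyx (congrArg Subtype.val h)⟩

theorem perfectSpace_of_homeomorph {X Y : Type*} [TopologicalSpace X] [TopologicalSpace Y]
    (h : PerfectSpace X) (e : X ≃ₜ Y) : PerfectSpace Y := by
  have := h.univ_preperfect.image_of_injective e.continuous e.injective
  rw [image_univ, e.surjective.range_eq] at this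
  exact ⟨this⟩

theorem perfectSpace_prod (X Y : Type*) [TopologicalSpace X] [TopologicalSpace Y]
    [PerfectSpace Y] : PerfectSpace (X × Y) :=
  ⟨by simpa using preperfect_prod_univ (Y := Y) (univ : Set X)⟩

theorem nonempty_homeomorph_of_compactSpace {X Y : Type*} [TopologicalSpace X]
    [TopologicalSpace Y] (hX : IsCompletelyUltrametrizable X) (hY : IsCompletelyUltrametrizable Y)
    [PerfectSpace X] [CompactSpace X] [Nonempty X] [PerfectSpace Y] [CompactSpace Y] [Nonempty Y] :
    Nonempty (X ≃ₜ Y) := by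
  obtain ⟨m, rfl, hc, hu⟩ := hX
  obtain ⟨m', rfl, hc', hu'⟩ := hY
  obtain ⟨e⟩ := nonempty_homeomorph_of_isCompact_of_perfect
    (PerfectSpace.univ_perfect X) isCompact_univ univ_nonempty
    (PerfectSpace.univ_perfect Y) isCompact_univ univ_nonempty
  exact ⟨(Homeomorph.Set.univ X).symm.trans (e.trans (Homeomorph.Set.univ _))⟩

/-- Brouwer's characterization of the Cantor space. -/
theorem nonempty_homeomorph_cantor (X : Type*) [TopologicalSpace X]
    (hX : IsCompletelyUltrametrizable X) [PerfectSpace X] [CompactSpace X] [Nonempty X] :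
    Nonempty (X ≃ₜ (ℕ → Bool)) :=
  have := perfectSpace_sequences Bool
  nonempty_homeomorph_of_compactSpace hX (isCompletelyUltrametrizable_sequences Bool)

theorem nonempty_homeomorph_cantor_of_isCompact {X : Type*} [MetricSpace X] [CompleteSpace X]
    [IsUltrametricDist X] {A : Set X} (hA : Perfect A) (hAc : IsCompact A) (hAn : A.Nonempty) :
    Nonempty (A ≃ₜ (ℕ → Bool)) := by
  have := perfectSpace_coe_of_perfect hA
  have := isCompact_iff_compactSpace.1 hAc
  have := hAn.to_subtype
  exact nonempty_homeomorph_cantor A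
    ((isCompletelyUltrametrizable_of_metric X).of_isClosed hA.closed)

theorem nonempty_homeomorph_cantor_prod :
    Nonempty ((ℕ → Bool) ≃ₜ (ℕ → Bool) × (ℕ → Bool)) := by
  have := perfectSpace_sequences Bool
  have := perfectSpace_prod (ℕ → Bool) (ℕ → Bool)
  obtain ⟨e⟩ := nonempty_homeomorph_cantor ((ℕ → Bool) × (ℕ → Bool))
    ((isCompletelyUltrametrizable_sequences Bool).prod (isCompletelyUltrametrizable_sequences Bool))
  exact ⟨e.symm⟩

/-! ### Closed partitions of Cantor sets and condensations onto Cantor sets -/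

/-- Identify `B` with `2 ^ ω × 2 ^ ω` and partition the first factor only. Each piece is then a
closed set times a Cantor set, hence perfect even where the given closed set has isolated points. -/
theorem exists_perfect_fibers {Y κ : Type*} [MetricSpace Y] [CompleteSpace Y]
    [IsUltrametricDist Y] {B : Set Y} (hB : Perfect B) (hBc : IsCompact B) (hBn : B.Nonempty)
    (hκ : HasClosedFibers (ℕ → Bool) κ) :
    ∃ q : Y → κ, ∀ i, Perfect (B ∩ q ⁻¹' {i}) ∧ (B ∩ q ⁻¹' {i}).Nonempty := by
  classical
  obtain ⟨e₁⟩ := nonempty_homeomorph_cantor_of_isCompact hB hBc hBn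
  obtain ⟨e₂⟩ := nonempty_homeomorph_cantor_prod
  let e := e₁.trans e₂
  obtain ⟨g, hg, hgc⟩ := hκ
  obtain ⟨b, hb⟩ := hBn
  let q : Y → κ := fun y => if hy : y ∈ B then g (e ⟨y, hy⟩).1 else g (e ⟨b, hb⟩).1
  have hq : ∀ y : B, q y = g (e y).1 := fun y => dif_pos y.2
  have himg : ∀ i, B ∩ q ⁻¹' {i} =
      (fun z => ((e.symm z : B) : Y)) '' ((g ⁻¹' {i}) ×ˢ Set.univ) := by
    intro i
    ext y
    constructor
    · rintro ⟨hy, hi⟩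
      refine ⟨e ⟨y, hy⟩, ⟨?_, mem_univ _⟩, by simp⟩
      exact (hq ⟨y, hy⟩).symm.trans hi
    · rintro ⟨z, ⟨hz, -⟩, rfl⟩
      refine ⟨(e.symm z).2, ?_⟩
      change q _ = i
      rw [hq, e.apply_symm_apply]
      exact hz
  have hcont : Continuous (fun z => ((e.symm z : B) : Y)) :=
    continuous_subtype_val.comp e.symm.continuous
  have := perfectSpace_sequences Bool
  refine ⟨q, fun i => ⟨⟨?_, ?_⟩, ?_⟩⟩
  · rw [himg]
    exact (((hgc i).prod isClosed_univ).isCompact.image hcont).isClosed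
  · rw [himg]
    exact (preperfect_prod_univ _).image_of_injective hcont
      (Subtype.val_injective.comp e.symm.injective)
  · rw [himg]
    obtain ⟨z, hz⟩ := hg i
    exact ⟨_, mem_image_of_mem _ (show (z, z) ∈ _ from ⟨hz, mem_univ _⟩)⟩

/-- Cut first into finitely many small clopen pieces, then each of them into κ perfect sets; a
nonzero finite multiple of an infinite κ is κ. -/
theorem hasPerfectSplit_of_isCompact {Y : Type*} {κ : Type} [Infinite κ] [MetricSpace Y]
    [CompleteSpace Y] [IsUltrametricDist Y] {B : Set Y} (hB : Perfect B) (hBc : IsCompact B)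
    (hBn : B.Nonempty) (hκ : HasClosedFibers (ℕ → Bool) κ) {ε : ℝ} (hε : 0 < ε) :
    HasPerfectSplit ε B κ := by
  obtain ⟨m, hm⟩ := exists_hasClopenSplit_fin hB hBn hε
      (hBc.finite_image_of_isLocallyConstant (isLocallyConstant_ball hε))
  -- `m + 1` rather than `m` makes the finite factor visibly nonzero.
  obtain ⟨p, hp, h⟩ := hm (m + 1) (Nat.le_succ m)
  choose r hr using fun i => exists_perfect_fibers (h i).1
    (hBc.inter_right (hp.isClosed_fiber i)) (h i).2.1 hκ
  have hfib : ∀ i j, B ∩ (fun y => (p y, r (p y) y)) ⁻¹' {(i, j)} =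
      (B ∩ p ⁻¹' {i}) ∩ r i ⁻¹' {j} := by
    intro i j
    ext y
    simp only [mem_inter_iff, mem_preimage, mem_singleton_iff, Prod.mk.injEq, and_assoc]
    exact and_congr_right fun _ => and_congr_right fun h => by rw [h]
  have hsurj : (fun y => (p y, r (p y) y)) '' B = Set.univ := by
    refine eq_univ_of_forall fun ⟨i, j⟩ => ?_
    obtain ⟨y, hy⟩ := (hr i j).2
    rw [← hfib] at hy
    exact ⟨y, hy.1, hy.2⟩
  have e : Nonempty ((fun y => (p y, r (p y) y)) '' B ≃ κ) := by
    rw [hsurj]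
    refine ⟨(Equiv.Set.univ _).trans ?_⟩
    refine Classical.choice (Cardinal.eq.1 ?_)
    rw [mk_prod, Cardinal.lift_uzero, Cardinal.lift_uzero]
    exact Cardinal.mul_eq_right (aleph0_le_mk κ) ((Cardinal.mk_lt_aleph0).le.trans
      (aleph0_le_mk κ)) (by simp)
  refine hasPerfectSplit_of_image hBn _ e.some fun y _ => ?_
  rw [hfib]
  exact ⟨(hr _ _).1, (h _).2.2.mono inter_subset_left⟩

/-- For every `ε > 0`, at most `κ` balls of radius `ε` meet `A`. -/
def BallCountLE {X : Type*} [MetricSpace X] (κ : Cardinal) (A : Set X) : Prop :=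
  ∀ ε > (0 : ℝ), #((fun x : X => ball x ε) '' A) ≤ κ

theorem BallCountLE.mono {X : Type*} [MetricSpace X] {κ : Cardinal} {A B : Set X}
    (h : BallCountLE κ B) (hAB : A ⊆ B) : BallCountLE κ A :=
  fun ε hε => (mk_le_mk_of_subset (image_mono hAB)).trans (h ε hε)

/-- If `A` meets infinitely many balls, it dictates the index set and the closed partitions of the
Cantor space let `B` follow. Otherwise both sides are split into equally many finite pieces. -/
theorem exists_common_split {X Y : Type} [MetricSpace X] [IsUltrametricDist X] [MetricSpace Y]
    [CompleteSpace Y] [IsUltrametricDist Y] {μ : Cardinal.{0}} {A : Set X} {B : Set Y}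
    (hμ : ∀ κ : Type, Infinite κ → #κ ≤ μ → HasClosedFibers (ℕ → Bool) κ)
    (hA : Perfect A) (hAn : A.Nonempty) (hAμ : BallCountLE μ A)
    (hB : Perfect B) (hBc : IsCompact B) (hBn : B.Nonempty) {ε : ℝ} (hε : 0 < ε) :
    ∃ κ : Type, HasClopenSplit ε A κ ∧ HasPerfectSplit ε B κ := by
  by_cases hfin : ((fun x : X => ball x ε) '' A).Finite
  · obtain ⟨m, hm⟩ := exists_hasClopenSplit_fin hA hAn hε hfin
    obtain ⟨n, hn⟩ := exists_hasClopenSplit_fin hB hBn hε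
      (hBc.finite_image_of_isLocallyConstant (isLocallyConstant_ball hε))
    exact ⟨Fin (max m n), hm _ (le_max_left _ _),
      (hn _ (le_max_right _ _)).hasPerfectSplit⟩
  · have : Infinite ((fun x : X => ball x ε) '' A) := infinite_coe_iff.2 hfin
    exact ⟨_, hasClopenSplit_ball hA hAn hε,
      hasPerfectSplit_of_isCompact hB hBc hBn (hμ _ this (hAμ ε hε)) hε⟩

theorem condensesOnto_of_isCompact {X Y : Type} [MetricSpace X] [CompleteSpace X]
    [IsUltrametricDist X] [MetricSpace Y]
    [CompleteSpace Y] [IsUltrametricDist Y] {μ : Cardinal.{0}} {A : Set X} {B : Set Y}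
    (hμ : ∀ κ : Type, Infinite κ → #κ ≤ μ → HasClosedFibers (ℕ → Bool) κ)
    (hA : Perfect A) (hAn : A.Nonempty) (hAμ : BallCountLE μ A)
    (hB : Perfect B) (hBc : IsCompact B) (hBn : B.Nonempty) : CondensesOnto A B := by
  refine condensesOnto_of_split (fun A B => (Perfect A ∧ A.Nonempty ∧ BallCountLE μ A) ∧
      Perfect B ∧ IsCompact B ∧ B.Nonempty) (fun A B h => ⟨⟨h.1.1.closed, h.1.2.1⟩,
      h.2.1.closed, h.2.2.2⟩) ?_ ⟨⟨hA, hAn, hAμ⟩, hB, hBc, hBn⟩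
  rintro A B ⟨⟨hA, hAn, hAμ⟩, hB, hBc, hBn⟩ ε hε
  obtain ⟨κ, ⟨p, hp, h₁⟩, q, h₂⟩ := exists_common_split hμ hA hAn hAμ hB hBc hBn hε
  exact ⟨κ, p, q, hp, fun i => ⟨⟨⟨(h₁ i).1, (h₁ i).2.1, hAμ.mono inter_subset_left⟩,
    (h₂ i).1, hBc.of_isClosed_subset (h₂ i).1.closed inter_subset_left, (h₂ i).2.1⟩,
    (h₁ i).2.2, (h₂ i).2.2⟩⟩

/-! ### Complements of closed sets and partitions of a prescribed size -/

theorem mk_iUnion_nat_le {α : Type} {κ : Cardinal.{0}} (hκ : ℵ₀ ≤ κ) (s : ℕ → Set α)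
    (hs : ∀ n, #(s n) ≤ κ) : #(⋃ n, s n) ≤ κ := by
  refine (mk_iUnion_le_sum_mk).trans ((Cardinal.sum_le_sum _ _ hs).trans ?_)
  rw [Cardinal.sum_const', mk_nat]
  exact (Cardinal.mul_eq_right hκ hκ aleph0_ne_zero).le

theorem ball_eq_ball_of_le {X : Type*} [MetricSpace X] [IsUltrametricDist X] {x y : X} {δ ε : ℝ}
    (hδ : 0 < δ) (h : δ ≤ ε) (hxy : ball x δ = ball y δ) : ball x ε = ball y ε :=
  (ball_eq_ball_iff_mem (hδ.trans_le h)).2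
    (ball_subset_ball h ((ball_eq_ball_iff_mem hδ).1 hxy))

theorem isSmall_ball {X : Type*} [MetricSpace X] [IsUltrametricDist X] {δ ε : ℝ} (h : δ ≤ ε)
    (x : X) : IsSmall ε (ball x δ) := by
  intro u hu v hv
  rw [IsUltrametricDist.ball_eq_of_mem hv] at hu
  exact (le_of_lt hu).trans h

/-- The complement of a closed set splits into small balls. -/
theorem exists_complement_split {Y : Type} [MetricSpace Y] [IsUltrametricDist Y] {K : Set Y}
    (hK : IsClosed K) {ε : ℝ} (hε : 0 < ε) :
    ∃ c : Y → ℕ × Set Y,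
      (∀ y ∉ K, ∃ δ > 0, δ ≤ ε ∧ Disjoint (ball y δ) K ∧
        ∀ z ∉ K, c z = c y ↔ z ∈ ball y δ) ∧
      ∀ (κ : Cardinal) (B : Set Y), ℵ₀ ≤ κ → BallCountLE κ B → #(c '' B) ≤ κ := by
  obtain ⟨n₀, hn₀⟩ := exists_nat_one_div_lt hε
  -- Each point off `K` receives the largest ball of radius `1 / (n + 1)`, `n ≥ n₀`, that misses
  -- `K`. Two such balls are equal or disjoint, so they partition the complement.
  let S : Y → Set ℕ := fun y => {n | n₀ ≤ n ∧ Disjoint (ball y (1 / ((n : ℝ) + 1))) K}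
  let N : Y → ℕ := fun y => sInf (S y)
  have hpos : ∀ n : ℕ, (0 : ℝ) < 1 / ((n : ℝ) + 1) := fun n => by positivity
  have hanti : ∀ {m n : ℕ}, m ≤ n → 1 / ((n : ℝ) + 1) ≤ 1 / ((m : ℝ) + 1) :=
    fun h => one_div_le_one_div_of_le (by positivity) (by exact_mod_cast Nat.succ_le_succ h)
  have hS : ∀ y ∉ K, N y ∈ S y := by
    intro y hy
    refine Nat.sInf_mem ?_
    obtain ⟨δ, hδ, hball⟩ := Metric.mem_nhds_iff.1 (hK.isOpen_compl.mem_nhds hy)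
    obtain ⟨n, hn⟩ := exists_nat_one_div_lt hδ
    refine ⟨max n₀ n, le_max_left _ _, ?_⟩
    refine disjoint_left.2 fun z hz => hball (ball_subset_ball ?_ hz)
    exact (hanti (le_max_right _ _)).trans hn.le
  refine ⟨fun y => (N y, ball y (1 / ((N y : ℝ) + 1))), fun y hy => ?_, fun κ B hκ hB => ?_⟩
  · refine ⟨_, hpos (N y), (hanti (hS y hy).1).trans hn₀.le, (hS y hy).2, fun z hz => ?_⟩
    constructor
    · intro h
      obtain ⟨h₁, h₂⟩ := Prod.ext_iff.1 h
      simp only at h₁ h₂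
      rw [h₁] at h₂
      exact (ball_eq_ball_iff_mem (hpos _)).1 h₂
    · intro h
      -- All balls around `z` and `y` of the coarser radii coincide too, so the least admissible
      -- index is the same for both points.
      have hball : ∀ m ≤ N y, ball z (1 / ((m : ℝ) + 1)) = ball y (1 / ((m : ℝ) + 1)) :=
        fun m hm => ball_eq_ball_of_le (hpos (N y)) (hanti hm)
          ((ball_eq_ball_iff_mem (hpos _)).2 h)
      have h₁ : N z ≤ N y :=
        Nat.sInf_le ⟨(hS y hy).1, by rw [hball _ le_rfl]; exact (hS y hy).2⟩
      have h₂ : N y ≤ N z :=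
        Nat.sInf_le ⟨(hS z hz).1, by rw [← hball _ h₁]; exact (hS z hz).2⟩
      have h₃ : N z = N y := le_antisymm h₁ h₂
      simp only [h₃, hball _ le_rfl]
  · refine (mk_le_mk_of_subset (?_ : _ ⊆ ⋃ n : ℕ, Prod.mk n ''
      ((fun y : Y => ball y (1 / ((n : ℝ) + 1))) '' B))).trans (mk_iUnion_nat_le hκ _ fun n =>
        mk_image_le.trans (hB _ (hpos n)))
    rintro _ ⟨y, hy, rfl⟩
    exact mem_iUnion.2 ⟨N y, _, mem_image_of_mem _ hy, rfl⟩

/-- The image of an embedded Cantor space is such a set. -/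
theorem exists_perfect_isCompact_subset {X : Type*} [MetricSpace X] [CompleteSpace X] {A : Set X}
    (hA : Perfect A) (hne : A.Nonempty) : ∃ K ⊆ A, Perfect K ∧ IsCompact K ∧ K.Nonempty := by
  obtain ⟨f, hf, hc, hi⟩ := hA.exists_nat_bool_injection hne
  have := perfectSpace_sequences Bool
  refine ⟨range f, hf, ⟨(isCompact_range hc).isClosed, ?_⟩, isCompact_range hc, range_nonempty f⟩
  rw [← image_univ]
  exact PerfectSpace.univ_preperfect.image_of_injective hc hi

/-- A Cantor set `K` inside `B` already supplies κ perfect pieces. The rest of `B` breaks into at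
most κ small relatively clopen pieces, so the total is exactly κ. -/
theorem hasPerfectSplit_of_ballCountLE {Y κ : Type} [Infinite κ] [MetricSpace Y] [CompleteSpace Y]
    [IsUltrametricDist Y] {B : Set Y} (hB : Perfect B) (hBn : B.Nonempty) (hBκ : BallCountLE #κ B)
    (hκ : HasClosedFibers (ℕ → Bool) κ) {ε : ℝ} (hε : 0 < ε) : HasPerfectSplit ε B κ := by
  classical
  obtain ⟨K, hKB, hK, hKc, hKn⟩ := exists_perfect_isCompact_subset hB hBn
  obtain ⟨q₀, hq₀⟩ := hasPerfectSplit_of_isCompact hK hKc hKn hκ hε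
  obtain ⟨c, hc, hcard⟩ := exists_complement_split hK.closed hε
  let q : Y → κ ⊕ (ℕ × Set Y) := fun y => if y ∈ K then .inl (q₀ y) else .inr (c y)
  have hqK : ∀ y ∈ K, q y = .inl (q₀ y) := fun y hy => if_pos hy
  have hqK' : ∀ y ∉ K, q y = .inr (c y) := fun y hy => if_neg hy
  have hinl : ∀ i, B ∩ q ⁻¹' {.inl i} = K ∩ q₀ ⁻¹' {i} := by
    intro i
    ext y
    by_cases hy : y ∈ K
    · simp [hy, hKB hy, hqK y hy]
    · simp [hy, hqK' y hy]
  have hinr : ∀ y ∉ K, ∃ δ > 0, δ ≤ ε ∧ B ∩ q ⁻¹' {.inr (c y)} = B ∩ ball y δ := by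
    intro y hy
    obtain ⟨δ, hδ, hδε, hdis, hδc⟩ := hc y hy
    refine ⟨δ, hδ, hδε, ?_⟩
    ext z
    by_cases hz : z ∈ K
    · have : z ∉ ball y δ := fun h => disjoint_left.1 hdis h hz
      simp only [mem_inter_iff, mem_preimage, hqK z hz, this]
      simp
    · simp only [mem_inter_iff, mem_preimage, hqK' z hz, mem_singleton_iff, Sum.inr.injEq,
        hδc z hz]
  have hcardq : #(q '' B) = #κ := by
    apply le_antisymm
    · have hsub : q '' B ⊆ Sum.inl '' (univ : Set κ) ∪ Sum.inr '' (c '' B) := by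
        rintro _ ⟨y, hy, rfl⟩
        by_cases hyK : y ∈ K
        · rw [hqK y hyK]
          exact Or.inl ⟨_, trivial, rfl⟩
        · rw [hqK' y hyK]
          exact Or.inr ⟨_, mem_image_of_mem _ hy, rfl⟩
      refine (mk_le_mk_of_subset hsub).trans ((mk_union_le _ _).trans ?_)
      refine (add_le_add (mk_image_le.trans mk_univ.le) (mk_image_le.trans
        (hcard _ B (aleph0_le_mk κ) hBκ))).trans ?_
      rw [Cardinal.add_eq_self (aleph0_le_mk κ)]
    · have hsub : range (Sum.inl : κ → κ ⊕ (ℕ × Set Y)) ⊆ q '' B := by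
        rintro _ ⟨i, rfl⟩
        obtain ⟨y, hy⟩ := (hq₀ i).2.1
        rw [← hinl] at hy
        exact ⟨y, hy⟩
      refine le_trans ?_ (mk_le_mk_of_subset hsub)
      rw [mk_range_eq _ Sum.inl_injective]
  refine hasPerfectSplit_of_image hBn q (Cardinal.eq.1 hcardq).some fun y hy => ?_
  by_cases hyK : y ∈ K
  · rw [hqK y hyK, hinl]
    exact ⟨(hq₀ _).1, (hq₀ _).2.2⟩
  · obtain ⟨δ, hδ, hδε, h⟩ := hinr y hyK
    rw [hqK' y hyK, h]
    refine ⟨hB.inter_isClopen (IsUltrametricDist.isClopen_ball _ _), ?_⟩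
    exact (isSmall_ball hδε y).mono inter_subset_right

/-! ### Spaces of sequences -/

section Sequences

attribute [local instance] PiNat.metricSpace

/-- A ball of positive radius is determined by finitely many coordinates of its centre, and `κ ^ n ≤
κ` for infinite κ. -/
theorem ballCountLE_sequences (κ : Type) [Infinite κ] [TopologicalSpace κ] [DiscreteTopology κ]
    (A : Set (ℕ → κ)) : BallCountLE #κ A := by
  have := PiNat.isUltrametricDist κ
  intro ε hε
  obtain ⟨n, hn⟩ : ∃ n, (1 / 2 : ℝ) ^ n < ε := exists_pow_lt_of_lt_one hε (by norm_num)
  let i₀ : κ := Classical.arbitrary κ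
  let F : (Fin n → κ) → Set (ℕ → κ) := fun s => ball (fun k => if h : k < n then s ⟨k, h⟩ else i₀) ε
  have hsub : (fun x : ℕ → κ => ball x ε) '' A ⊆ range F := by
    rintro _ ⟨x, -, rfl⟩
    refine ⟨fun k => x k, ?_⟩
    refine (ball_eq_ball_iff_mem hε).2 (lt_of_le_of_lt ?_ hn)
    rw [← PiNat.mem_cylinder_iff_dist_le, PiNat.mem_cylinder_iff]
    intro i hi
    simp [hi]
  refine (mk_le_mk_of_subset hsub).trans (mk_range_le.trans ?_)
  rw [← Cardinal.power_def, mk_fin]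
  exact Cardinal.power_nat_le (aleph0_le_mk κ)

theorem exists_cylinder_subset {κ : Type*} [TopologicalSpace κ] [DiscreteTopology κ]
    {A : Set (ℕ → κ)} (hA : IsOpen A) {x : ℕ → κ} (hx : x ∈ A) :
    ∃ n, PiNat.cylinder x n ⊆ A := by
  obtain ⟨_, ⟨z, n, rfl⟩, hxz, hz⟩ :=
    (PiNat.isTopologicalBasis_cylinders fun _ : ℕ => κ).mem_nhds_iff.1 (hA.mem_nhds hx)
  exact ⟨n, (PiNat.mem_cylinder_iff_eq.1 hxz).trans_subset hz⟩

/-- A nonempty open set contains a cylinder, whose next coordinate is free. At a small enough radius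
its κ values are separated by different balls. -/
theorem exists_mk_image_ball_eq (κ : Type) [Infinite κ] [TopologicalSpace κ] [DiscreteTopology κ]
    {A : Set (ℕ → κ)} (hA : IsOpen A) (hAn : A.Nonempty) {ε : ℝ} (hε : 0 < ε) :
    ∃ δ > 0, δ ≤ ε ∧ #((fun x : ℕ → κ => ball x δ) '' A) = #κ := by
  have := PiNat.isUltrametricDist κ
  obtain ⟨x, hx⟩ := hAn
  obtain ⟨n, hn⟩ := exists_cylinder_subset hA hx
  have hδ : 0 < min ε ((1 / 2 : ℝ) ^ n) := lt_min hε (by positivity)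
  refine ⟨_, hδ, min_le_left _ _, le_antisymm (ballCountLE_sequences κ A _ hδ) ?_⟩
  let f : κ → ((fun x : ℕ → κ => ball x (min ε ((1 / 2 : ℝ) ^ n))) '' A) := fun b =>
    ⟨ball (Function.update x n b) _, _, hn (PiNat.update_mem_cylinder x n b), rfl⟩
  refine mk_le_of_injective (f := f) fun b c hbc => ?_
  have h₁ := (ball_eq_ball_iff_mem hδ).1 (Subtype.mk.inj hbc)
  have h₂ : dist (Function.update x n b) (Function.update x n c) < (1 / 2) ^ n :=
    lt_of_lt_of_le h₁ (min_le_right _ _)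
  simpa using PiNat.apply_eq_of_dist_lt h₂ le_rfl

/-- If the Cantor space is a disjoint union of `κ` closed sets, then `κ ^ ω` condenses onto every
perfect set of weight at most `κ`. -/
theorem sequences_condensesOnto {Y κ : Type} [Infinite κ] [TopologicalSpace κ]
    [DiscreteTopology κ] [MetricSpace Y] [CompleteSpace Y] [IsUltrametricDist Y] {B : Set Y}
    (hB : Perfect B) (hBn : B.Nonempty) (hBκ : BallCountLE #κ B)
    (hκ : HasClosedFibers (ℕ → Bool) κ) : CondensesOnto (Set.univ : Set (ℕ → κ)) B := by
  have := PiNat.isUltrametricDist κ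
  have : CompleteSpace (ℕ → κ) := PiNat.completeSpace
  refine condensesOnto_of_split (fun (A : Set (ℕ → κ)) B => (IsClopen A ∧ A.Nonempty) ∧ Perfect B ∧
    B.Nonempty ∧ BallCountLE #κ B) (fun A B h => ⟨⟨h.1.1.1, h.1.2⟩, h.2.1.closed, h.2.2.1⟩) ?_
    ⟨⟨isClopen_univ, univ_nonempty⟩, hB, hBn, hBκ⟩
  rintro A B ⟨⟨hA, hAn⟩, hB, hBn, hBκ⟩ ε hε
  obtain ⟨δ, hδ, hδε, hcard⟩ := exists_mk_image_ball_eq κ hA.2 hAn hε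
  obtain ⟨q, hq⟩ := hasPerfectSplit_of_ballCountLE hB hBn hBκ hκ hε
  obtain ⟨F, hF⟩ := exists_reindex (fun x : ℕ → κ => ball x δ) hAn (Cardinal.eq.1 hcard).some
  have hp := (isLocallyConstant_ball (X := ℕ → κ) hδ).comp F
  refine ⟨κ, _, q, hp, fun i => ⟨⟨⟨hA.inter (hp.isClopen_fiber i), ?_⟩, (hq i).1, (hq i).2.1,
    hBκ.mono inter_subset_left⟩, ?_, (hq i).2.2⟩⟩
  all_goals obtain ⟨x, hx, hxi⟩ := hF i
  · exact hxi.symm ▸ ⟨x, hx, rfl⟩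
  · rw [hxi]
    exact ((isSmall_ball_fiber hδ _).mono inter_subset_right).of_le hδε

end Sequences

/-! ### Separable spaces that are not σ-compact -/

/-- Classify a binary sequence by the position of its first `true`. The constantly `false` sequence
forms the one additional class, labelled `none`. -/
theorem hasClosedFibers_of_countable (κ : Type) [Infinite κ] [Countable κ] :
    HasClosedFibers (ℕ → Bool) κ := by
  classical
  have key : HasClosedFibers (ℕ → Bool) (Option ℕ) := by
    let g : (ℕ → Bool) → Option ℕ := fun x =>
      if h : ∃ n, x n = true then some (Nat.find h) else none
    have hsome : ∀ x n, g x = some n ↔ x n = true ∧ ∀ m < n, ¬ x m = true := by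
      intro x n
      by_cases h : ∃ n, x n = true
      · simp only [g, dif_pos h, Option.some.injEq]
        exact Nat.find_eq_iff h
      · simp only [g, dif_neg h]
        push Not at h
        simp [h n]
    have hnone : ∀ x, g x = none ↔ ∀ n, ¬ x n = true := by
      intro x
      by_cases h : ∃ n, x n = true
      · simp only [g, dif_pos h]
        push Not
        simpa using h
      · simp only [g, dif_neg h]
        push Not at h
        simpa using h
    have hcl : ∀ n, IsClopen {x : ℕ → Bool | x n = true} := fun n =>
      (isClopen_discrete {true}).preimage (continuous_apply n)
    refine ⟨g, ?_, ?_⟩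
    · rintro (_ | n)
      · exact ⟨fun _ => false, (hnone _).2 fun n => by simp⟩
      · refine ⟨fun m => decide (m = n), (hsome _ _).2 ⟨by simp, fun m hm => ?_⟩⟩
        simpa using hm.ne
    · rintro (_ | n)
      · have : g ⁻¹' {none} = ⋂ n, {x : ℕ → Bool | x n = true}ᶜ := by
          ext x
          simp only [mem_preimage, mem_singleton_iff, hnone, mem_iInter, mem_compl_iff,
            mem_ofPred_eq]
        rw [this]
        exact isClosed_iInter fun n => (hcl n).compl.isClosed
      · have : g ⁻¹' {some n} =
            {x : ℕ → Bool | x n = true} ∩ ⋂ m, ⋂ _ : m < n, {x : ℕ → Bool | x m = true}ᶜ := by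
          ext x
          simp only [mem_preimage, mem_singleton_iff, hsome, mem_iInter, mem_compl_iff,
            mem_ofPred_eq, mem_inter_iff]
        rw [this]
        exact (hcl n).isClosed.inter
          (isClosed_iInter fun m => isClosed_iInter fun _ => (hcl m).compl.isClosed)
  obtain ⟨e⟩ := nonempty_equiv_of_countable (α := Option ℕ) (β := κ)
  exact key.congr e

theorem isCompact_of_finite_image_ball {X : Type*} [MetricSpace X] [CompleteSpace X]
    [IsUltrametricDist X] {A : Set X} (hA : IsClosed A)
    (h : ∀ ε > (0 : ℝ), ((fun x : X => ball x ε) '' A).Finite) : IsCompact A := by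
  refine TotallyBounded.isCompact_of_isClosed ?_ hA
  rw [Metric.totallyBounded_iff]
  intro ε hε
  obtain ⟨t, -, hst⟩ := Set.exists_subset_bijOn A (fun x : X => ball x ε)
  refine ⟨t, ?_, fun x hx => ?_⟩
  · exact Set.Finite.of_finite_image (hst.image_eq ▸ h ε hε) hst.injOn
  · obtain ⟨y, hy, hyx⟩ := hst.surjOn (mem_image_of_mem _ hx)
    exact mem_iUnion₂.2 ⟨y, hy, (ball_eq_ball_iff_mem hε).1 hyx.symm⟩

/-- Balls of a larger radius are unions of balls of a smaller one, so finiteness at all small radii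
would give total boundedness. -/
theorem exists_infinite_image_ball {X : Type*} [MetricSpace X] [CompleteSpace X]
    [IsUltrametricDist X] {A : Set X} (hA : IsClosed A) (hAc : ¬ IsCompact A) {ε : ℝ}
    (hε : 0 < ε) : ∃ δ > 0, δ ≤ ε ∧ ((fun x : X => ball x δ) '' A).Infinite := by
  by_contra! hcon
  refine hAc (isCompact_of_finite_image_ball hA fun δ hδ => ?_)
  have hm : 0 < min δ ε := lt_min hδ hε
  have hfin := hcon _ hm (min_le_right _ _)
  have hsub : (fun x : X => ball x δ) '' A ⊆
      (fun U => ⋃ x ∈ U, ball x δ) '' ((fun x : X => ball x (min δ ε)) '' A) := by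
    rintro _ ⟨x, hx, rfl⟩
    refine ⟨_, mem_image_of_mem _ hx, ?_⟩
    refine subset_antisymm (iUnion₂_subset fun y hy => ?_)
      (subset_biUnion_of_mem (u := fun y => ball y δ) (mem_ball_self hm))
    exact (ball_eq_ball_of_le hm (min_le_left _ _) ((ball_eq_ball_iff_mem hm).2 hy)).subset
  exact (hfin.image _).subset hsub

theorem countable_image_ball {X : Type} [MetricSpace X] {A : Set X} (hA : BallCountLE ℵ₀ A)
    {ε : ℝ} (hε : 0 < ε) : ((fun x : X => ball x ε) '' A).Countable :=
  mk_le_aleph0_iff.1 (hA ε hε)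

/-- Let `F` be the closed set of points without a σ-compact neighbourhood in `A`. Countably many
σ-compact balls cover `A \ F`, so `F` is not compact, and at some small radius infinitely many balls
meet it. -/
theorem exists_infinite_not_isSigmaCompact {X : Type} [MetricSpace X] [CompleteSpace X]
    [IsUltrametricDist X] {A : Set X} (hA : IsClosed A) (hAω : BallCountLE ℵ₀ A)
    (hAσ : ¬ IsSigmaCompact A) {ε : ℝ} (hε : 0 < ε) :
    ∃ δ > 0, δ ≤ ε ∧
      ((fun x : X => ball x δ) '' {x ∈ A | ¬ IsSigmaCompact (A ∩ ball x δ)}).Infinite := by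
  let F : Set X := {x ∈ A | ∀ n : ℕ, ¬ IsSigmaCompact (A ∩ ball x (1 / ((n : ℝ) + 1)))}
  let 𝒰 : Set (Set X) := ⋃ n : ℕ, {U ∈ (fun x : X => ball x (1 / ((n : ℝ) + 1))) '' A |
    IsSigmaCompact (A ∩ U)}
  have hpos : ∀ n : ℕ, (0 : ℝ) < 1 / ((n : ℝ) + 1) := fun n => by positivity
  have h𝒰 : 𝒰.Countable := countable_iUnion fun n =>
    (countable_image_ball hAω (hpos n)).mono (sep_subset _ _)
  have hF : F = A ∩ (⋃₀ 𝒰)ᶜ := by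
    ext x
    constructor
    · rintro ⟨hx, h⟩
      refine ⟨hx, ?_⟩
      rintro ⟨U, hU, hxU⟩
      obtain ⟨n, ⟨y, hy, rfl⟩, hσ⟩ := mem_iUnion.1 hU
      refine h n ?_
      rwa [← IsUltrametricDist.ball_eq_of_mem hxU]
    · rintro ⟨hx, h⟩
      refine ⟨hx, fun n hσ => h ?_⟩
      exact ⟨_, mem_iUnion.2 ⟨n, ⟨mem_image_of_mem _ hx, hσ⟩⟩, mem_ball_self (hpos n)⟩
  have hopen : IsOpen (⋃₀ 𝒰) := by
    refine isOpen_sUnion fun U hU => ?_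
    obtain ⟨n, ⟨y, hy, rfl⟩, hσ⟩ := mem_iUnion.1 hU
    exact isOpen_ball
  have hFc : IsClosed F := hF ▸ hA.inter hopen.isClosed_compl
  have hFnc : ¬ IsCompact F := by
    intro hc
    apply hAσ
    have : A = ⋃₀ (insert F ((fun U => A ∩ U) '' 𝒰)) := by
      rw [sUnion_insert, sUnion_image, ← inter_iUnion₂, ← sUnion_eq_biUnion, hF]
      rw [← inter_union_distrib_left, compl_union_self, inter_univ]
    rw [this]
    refine isSigmaCompact_sUnion _ ((h𝒰.image _).insert F) ?_
    rintro ⟨s, hs⟩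
    rcases hs with rfl | ⟨U, hU, rfl⟩
    · exact hc.isSigmaCompact
    · obtain ⟨n, -, hσ⟩ := mem_iUnion.1 hU
      exact hσ
  obtain ⟨δ, hδ, hδε, hinf⟩ := exists_infinite_image_ball hFc hFnc hε
  refine ⟨δ, hδ, hδε, hinf.mono (image_mono fun x hx => ⟨hx.1, fun hσ => ?_⟩)⟩
  obtain ⟨n, hn⟩ := exists_nat_one_div_lt hδ
  refine hx.2 n (hσ.of_isClosed_subset (hA.inter (IsUltrametricDist.isClosed_ball _ _)) ?_)
  exact inter_subset_inter_right _ (ball_subset_ball hn.le)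

/-- The labels in `ℕ` go to the balls whose trace on `A` is not σ-compact, those in `κ` to the
countably many others. This is the domain half of the matching used for condensing onto a nowhere
compact set. -/
theorem exists_split_not_isSigmaCompact {X : Type} [MetricSpace X] [CompleteSpace X]
    [IsUltrametricDist X] {A : Set X} (hA : Perfect A) (hAω : BallCountLE ℵ₀ A)
    (hAσ : ¬ IsSigmaCompact A) {ε : ℝ} (hε : 0 < ε) :
    ∃ (κ : Type) (_ : Countable κ) (p : X → κ ⊕ ℕ), IsLocallyConstant p ∧
      (∀ i, (A ∩ p ⁻¹' {i}).Nonempty ∧ IsSmall ε (A ∩ p ⁻¹' {i})) ∧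
      ∀ n, ¬ IsSigmaCompact (A ∩ p ⁻¹' {.inr n}) := by
  classical
  obtain ⟨δ, hδ, hδε, hinf⟩ := exists_infinite_not_isSigmaCompact hA.closed hAω hAσ hε
  set F : Set X := {x ∈ A | ¬ IsSigmaCompact (A ∩ ball x δ)} with hF
  have hcount := (countable_image_ball hAω hδ)
  have hFcount := hcount.mono (image_mono (fun x hx => hx.1 : F ⊆ A))
  have := hinf.to_subtype
  have := hFcount.to_subtype
  obtain ⟨e⟩ := nonempty_equiv_of_countable
    (α := (fun x : X => ball x δ) '' F) (β := ℕ)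
  let I₂ := (fun x : X => ball x δ) '' (A \ F)
  have hI₂ : Countable I₂ := (hcount.mono (image_mono sdiff_subset)).to_subtype
  -- The final value `.inr 0` is never used for balls centred in `A`.
  let G : Set X → I₂ ⊕ ℕ := fun U =>
    if h : U ∈ I₂ then .inl ⟨U, h⟩ else
      if h : U ∈ (fun x : X => ball x δ) '' F then .inr (e ⟨U, h⟩) else .inr 0
  have hp := (isLocallyConstant_ball (X := X) hδ).comp G
  have hmemF : ∀ x ∈ A, ∀ y ∈ F, ball x δ = ball y δ → x ∈ F := by
    intro x hx y hy hxy
    exact ⟨hx, by rw [hxy]; exact hy.2⟩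
  have hGF : ∀ x (hx : x ∈ F), G (ball x δ) = .inr (e ⟨_, mem_image_of_mem _ hx⟩) := by
    intro x hx
    have h₁ : ball x δ ∉ I₂ := by
      rintro ⟨y, hy, hyx⟩
      exact hy.2 (hmemF y hy.1 x hx hyx)
    have h₂ : ball x δ ∈ (fun x : X => ball x δ) '' F := mem_image_of_mem _ hx
    simp only [G, dif_neg h₁, dif_pos h₂]
  have hGF' : ∀ x (hx : x ∈ A \ F), G (ball x δ) = .inl ⟨_, mem_image_of_mem _ hx⟩ :=
    fun x hx => dif_pos _
  have hinj : ∀ x ∈ A, ∀ y ∈ A, G (ball x δ) = G (ball y δ) → ball x δ = ball y δ := by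
    intro x hx y hy h
    by_cases hxF : x ∈ F <;> by_cases hyF : y ∈ F
    · rw [hGF x hxF, hGF y hyF, Sum.inr.injEq, e.injective.eq_iff] at h
      exact congrArg Subtype.val h
    · rw [hGF x hxF, hGF' y ⟨hy, hyF⟩] at h
      cases h
    · rw [hGF' x ⟨hx, hxF⟩, hGF y hyF] at h
      cases h
    · rw [hGF' x ⟨hx, hxF⟩, hGF' y ⟨hy, hyF⟩, Sum.inl.injEq] at h
      exact congrArg Subtype.val h
  have hsurj : ∀ i, ∃ x ∈ A, G (ball x δ) = i := by
    rintro (⟨_, x, hx, rfl⟩ | n)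
    · exact ⟨x, hx.1, hGF' x hx⟩
    · obtain ⟨⟨_, x, hx, rfl⟩, rfl⟩ := e.surjective n
      exact ⟨x, hx.1, hGF x hx⟩
  have hfib : ∀ x ∈ A, A ∩ (G ∘ fun x => ball x δ) ⁻¹' {G (ball x δ)} = A ∩ ball x δ := by
    intro x hx
    ext y
    refine and_congr_right fun hy => ⟨fun h => ?_, fun h => ?_⟩
    · exact (ball_eq_ball_iff_mem hδ).1 (hinj y hy x hx h)
    · exact congrArg G ((ball_eq_ball_iff_mem hδ).2 h)
  refine ⟨I₂, hI₂, _, hp, fun i => ?_, fun n => ?_⟩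
  · obtain ⟨x, hx, rfl⟩ := hsurj i
    rw [hfib x hx]
    exact ⟨⟨x, hx, mem_ball_self hδ⟩, (isSmall_ball hδε x).mono inter_subset_right⟩
  · obtain ⟨⟨_, x, hx, rfl⟩, rfl⟩ := e.surjective n
    rw [← hGF x hx, hfib x hx.1]
    exact hx.2

/-- No nonempty relatively clopen subset of `B` is compact. -/
def NowhereCompact {Y : Type*} [TopologicalSpace Y] (B : Set Y) : Prop :=
  ∀ U, IsClopen U → (B ∩ U).Nonempty → ¬ IsCompact (B ∩ U)

theorem NowhereCompact.inter {Y : Type*} [TopologicalSpace Y] {B U : Set Y}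
    (hB : NowhereCompact B) (hU : IsClopen U) : NowhereCompact (B ∩ U) := by
  intro V hV
  rw [inter_assoc]
  exact hB _ (hU.inter hV)

/-- Split `B` into small clopen pieces indexed by `ℕ`, choose a Cantor set in each, and use one of
them for every label in `κ`. Their union `K` is closed because each clopen piece contains at most
one of them. The remainder is relatively open in `B` and splits into infinitely many nowhere compact
pieces, which take the labels in `ℕ`. -/
theorem exists_split_nowhereCompact {Y κ : Type} [Countable κ] [MetricSpace Y] [CompleteSpace Y]
    [IsUltrametricDist Y] {B : Set Y} (hB : Perfect B) (hBn : B.Nonempty)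
    (hBω : BallCountLE ℵ₀ B) (hBc : NowhereCompact B) {ε : ℝ} (hε : 0 < ε) :
    ∃ q : Y → κ ⊕ ℕ, (∀ i, Perfect (B ∩ q ⁻¹' {i}) ∧ (B ∩ q ⁻¹' {i}).Nonempty ∧
        IsSmall ε (B ∩ q ⁻¹' {i})) ∧
      (∀ i, IsCompact (B ∩ q ⁻¹' {.inl i})) ∧ ∀ n, NowhereCompact (B ∩ q ⁻¹' {.inr n}) := by
  classical
  have hBnc : ¬ IsCompact B := by simpa using hBc _ isClopen_univ (by simpa using hBn)
  obtain ⟨r, hr, hrB⟩ : HasClopenSplit ε B ℕ := by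
    obtain ⟨δ, hδ, hδε, hinf⟩ := exists_infinite_image_ball hB.closed hBnc hε
    have := hinf.to_subtype
    have := (countable_image_ball hBω hδ).to_subtype
    obtain ⟨e⟩ := nonempty_equiv_of_countable (α := (fun x : Y => ball x δ) '' B) (β := ℕ)
    refine hasClopenSplit_of_image hB hBn _ (isLocallyConstant_ball hδ) e fun x _ => ?_
    exact ((isSmall_ball_fiber hδ _).mono inter_subset_right).of_le hδε
  choose C hCB hC hCc hCn using fun j => exists_perfect_isCompact_subset (hrB j).1 (hrB j).2.1
  obtain ⟨φ, hφ⟩ := Countable.exists_injective_nat κ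
  let K : Set Y := {y | ∃ i, y ∈ C (φ i)}
  have hrC : ∀ j, ∀ y ∈ C j, r y = j := fun j y hy => (hCB j hy).2
  have hKcl : IsClosed K := by
    rw [← isOpen_compl_iff, isOpen_iff_mem_nhds]
    intro y hy
    by_cases h : ∃ i, φ i = r y
    · obtain ⟨i, hi⟩ := h
      filter_upwards [hr.eventually_eq y, (hCc (φ i)).isClosed.isOpen_compl.mem_nhds
        (fun h => hy ⟨i, h⟩)] with z hz hz'
      rintro ⟨i', hi'⟩
      have : φ i' = φ i := by rw [hi, ← hz, hrC _ _ hi']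
      exact hz' (hφ this ▸ hi')
    · filter_upwards [hr.eventually_eq y] with z hz
      rintro ⟨i', hi'⟩
      exact h ⟨i', by rw [← hz, hrC _ _ hi']⟩
  obtain ⟨c, hc, hcard⟩ := exists_complement_split hKcl hε
  -- A clopen piece contained in `K` would coincide with its Cantor set, contradicting nowhere
  -- compactness.
  have hout : ∀ j, ∃ y ∈ B, y ∉ K ∧ r y = j := by
    intro j
    by_contra! hcon
    have hcl : IsClopen (r ⁻¹' {j}) := hr.isClopen_fiber j
    refine hBc _ hcl (hrB j).2.1 ?_
    by_cases h : ∃ i, φ i = j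
    · obtain ⟨i, rfl⟩ := h
      have : B ∩ r ⁻¹' {φ i} = C (φ i) := by
        refine subset_antisymm (fun y hy => ?_) (hCB _)
        by_contra hyC
        refine hcon y hy.1 ?_ hy.2
        rintro ⟨i', hi'⟩
        have : φ i' = φ i := by rw [← hrC _ _ hi']; exact hy.2
        exact hyC (this ▸ hi')
      rw [this]
      exact hCc _
    · obtain ⟨y, hyB, hy⟩ := (hrB j).2.1
      refine absurd hy (hcon y hyB ?_)
      rintro ⟨i', hi'⟩
      refine h ⟨i', ?_⟩
      rw [← hrC _ _ hi']
      exact hy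
  -- Recording `r` as well as `c` guarantees infinitely many labels on `B \ K`, since `r` takes
  -- every value there.
  let P : Y → ℕ × (ℕ × Set Y) := fun y => (r y, c y)
  have hPinf : (P '' (B \ K)).Infinite := by
    refine Set.Infinite.of_image Prod.fst ?_
    have : Prod.fst '' (P '' (B \ K)) = Set.univ := by
      refine eq_univ_of_forall fun j => ?_
      obtain ⟨y, hyB, hyK, hj⟩ := hout j
      exact ⟨_, ⟨y, ⟨hyB, hyK⟩, rfl⟩, hj⟩
    rw [this]
    exact infinite_univ
  have hPc : (P '' (B \ K)).Countable := by
    have : (c '' B).Countable := mk_le_aleph0_iff.1 (hcard ℵ₀ B le_rfl hBω)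
    refine ((countable_univ (α := ℕ)).prod this).mono ?_
    rintro _ ⟨y, hy, rfl⟩
    exact ⟨trivial, y, hy.1, rfl⟩
  have := hPinf.to_subtype
  have := hPc.to_subtype
  obtain ⟨e⟩ := nonempty_equiv_of_countable (α := P '' (B \ K)) (β := ℕ)
  have hne : (B \ K).Nonempty := by
    obtain ⟨y, hyB, hyK, -⟩ := hout 0
    exact ⟨y, hyB, hyK⟩
  obtain ⟨F, hF⟩ := exists_reindex P hne e
  let q : Y → κ ⊕ ℕ := fun y => if h : y ∈ K then .inl h.choose else .inr (F (P y))
  have hqK : ∀ i, ∀ y ∈ C (φ i), q y = .inl i := by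
    intro i y hy
    have h : y ∈ K := ⟨i, hy⟩
    have h' : φ h.choose = φ i := by rw [← hrC _ _ h.choose_spec, hrC _ _ hy]
    simp only [q, dif_pos h, hφ h']
  have hqK' : ∀ y ∉ K, q y = .inr (F (P y)) := fun y hy => dif_neg hy
  have hinl : ∀ i, B ∩ q ⁻¹' {.inl i} = C (φ i) := by
    intro i
    ext y
    constructor
    · rintro ⟨hy, hi⟩
      by_cases h : y ∈ K
      · obtain ⟨i', hi'⟩ := h
        have hi : q y = .inl i := hi
        rw [hqK _ _ hi', Sum.inl.injEq] at hi
        exact hi ▸ hi'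
      · have hi : q y = .inl i := hi
        rw [hqK' y h] at hi
        cases hi
    · exact fun hy => ⟨(hCB _ hy).1, hqK i y hy⟩
  have hinr : ∀ n, ∃ y ∈ B, ∃ U, IsClopen U ∧ y ∈ U ∧ IsSmall ε U ∧
      B ∩ q ⁻¹' {.inr n} = B ∩ U := by
    intro n
    obtain ⟨y, ⟨hyB, hyK⟩, hy⟩ := hF n
    obtain ⟨δ, hδ, hδε, hdis, hδc⟩ := hc y hyK
    refine ⟨y, hyB, r ⁻¹' {r y} ∩ ball y δ, (hr.isClopen_fiber _).inter
      (IsUltrametricDist.isClopen_ball _ _), ⟨rfl, mem_ball_self hδ⟩,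
      (isSmall_ball hδε y).mono inter_subset_right, ?_⟩
    ext z
    refine and_congr_right fun hz => ?_
    by_cases hzK : z ∈ K
    · have h₁ : z ∉ ball y δ := fun h => disjoint_left.1 hdis h hzK
      obtain ⟨i, hi⟩ := hzK
      simp [hqK i z hi, h₁]
    · have h₁ := Set.ext_iff.1 hy z
      simp only [mem_inter_iff, Set.mem_sdiff, hz, hzK, not_false_eq_true, and_self, true_and, P,
        mem_preimage, mem_singleton_iff, Function.comp_apply, Prod.mk.injEq, hδc z hzK] at h₁
      simp only [mem_preimage, mem_singleton_iff, hqK' z hzK, Sum.inr.injEq, mem_inter_iff, P, h₁]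
  refine ⟨q, ?_, fun i => (hinl i).symm ▸ hCc _, fun n => ?_⟩
  · rintro (i | n)
    · rw [hinl]
      exact ⟨hC _, hCn _, (hrB _).2.2.mono (hCB _)⟩
    · obtain ⟨y, hy, U, hU, hyU, hUs, h⟩ := hinr n
      rw [h]
      exact ⟨hB.inter_isClopen hU, ⟨y, hy, hyU⟩, hUs.mono inter_subset_right⟩
  · obtain ⟨y, hy, U, hU, hyU, hUs, h⟩ := hinr n
    rw [h]
    exact hBc.inter hU

/-- The invariant has two cases. A non-σ-compact domain piece faces a nowhere compact target piece,
or any domain piece faces a compact target piece. The first case splits into both, and the second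
reproduces itself using countable closed partitions of the Cantor space. -/
theorem condensesOnto_of_nowhereCompact {X Y : Type} [MetricSpace X] [CompleteSpace X]
    [IsUltrametricDist X] [MetricSpace Y] [CompleteSpace Y] [IsUltrametricDist Y] {A : Set X}
    {B : Set Y} (hA : Perfect A) (hAω : BallCountLE ℵ₀ A) (hAσ : ¬ IsSigmaCompact A)
    (hB : Perfect B) (hBn : B.Nonempty) (hBω : BallCountLE ℵ₀ B) (hBc : NowhereCompact B) :
    CondensesOnto A B := by
  refine condensesOnto_of_split (fun (A : Set X) (B : Set Y) =>
    (Perfect A ∧ A.Nonempty ∧ BallCountLE ℵ₀ A) ∧ (Perfect B ∧ B.Nonempty ∧ BallCountLE ℵ₀ B) ∧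
      (¬ IsSigmaCompact A ∧ NowhereCompact B ∨ IsCompact B))
    (fun A B h => ⟨⟨h.1.1.closed, h.1.2.1⟩, h.2.1.1.closed, h.2.1.2.1⟩) ?_
    ⟨⟨hA, ?_, hAω⟩, ⟨hB, hBn, hBω⟩, Or.inl ⟨hAσ, hBc⟩⟩
  · rintro A B ⟨⟨hA, hAn, hAω⟩, ⟨hB, hBn, hBω⟩, h | h⟩ ε hε
    · obtain ⟨κ, hκ, p, hp, h₁, h₂⟩ := exists_split_not_isSigmaCompact hA hAω h.1 hε
      obtain ⟨q, h₃, h₄, h₅⟩ := exists_split_nowhereCompact (κ := κ) hB hBn hBω h.2 hε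
      refine ⟨κ ⊕ ℕ, p, q, hp, fun i => ⟨⟨⟨hA.inter_isClopen (hp.isClopen_fiber i), (h₁ i).1,
        hAω.mono inter_subset_left⟩, ⟨(h₃ i).1, (h₃ i).2.1, hBω.mono inter_subset_left⟩, ?_⟩,
        (h₁ i).2, (h₃ i).2.2⟩⟩
      rcases i with i | n
      · exact Or.inr (h₄ i)
      · exact Or.inl ⟨h₂ n, h₅ n⟩
    · obtain ⟨κ, ⟨p, hp, h₁⟩, q, h₂⟩ := exists_common_split (μ := ℵ₀)
        (fun κ _ h => have : Countable κ := mk_le_aleph0_iff.1 h; hasClosedFibers_of_countable κ)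
        hA hAn hAω hB h hBn hε
      exact ⟨κ, p, q, hp, fun i => ⟨⟨⟨(h₁ i).1, (h₁ i).2.1, hAω.mono inter_subset_left⟩,
        ⟨(h₂ i).1, (h₂ i).2.1, hBω.mono inter_subset_left⟩,
        Or.inr (h.of_isClosed_subset (h₂ i).1.closed inter_subset_left)⟩,
        (h₁ i).2.2, (h₂ i).2.2⟩⟩
  · by_contra hne
    rw [not_nonempty_iff_eq_empty] at hne
    exact hAσ (hne ▸ isSigmaCompact_empty)

/-! ### σ-compact spaces -/

theorem Preperfect.union {X : Type*} [TopologicalSpace X] {A B : Set X} (hA : Preperfect A)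
    (hB : Preperfect B) : Preperfect (A ∪ B) := by
  rintro x (hx | hx)
  · exact (hA x hx).mono (Filter.principal_mono.2 subset_union_left)
  · exact (hB x hx).mono (Filter.principal_mono.2 subset_union_right)

/-- Attach to each point of a finite `1 / (n + 1)`-net of `K`, for every `n`, a Cantor set in the
ball of that radius. Every point of `K` becomes an accumulation point, while all but finitely many
of the Cantor sets stay as close to `K` as desired, so the union is totally bounded. -/
theorem exists_perfect_isCompact_superset {X : Type*} [MetricSpace X] [CompleteSpace X]
    [IsUltrametricDist X] {A K : Set X} (hA : Perfect A) (hKA : K ⊆ A) (hK : IsCompact K) :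
    ∃ L, K ⊆ L ∧ L ⊆ A ∧ Perfect L ∧ IsCompact L := by
  have hpos : ∀ n : ℕ, (0 : ℝ) < 1 / ((n : ℝ) + 1) := fun n => by positivity
  have hnet : ∀ n : ℕ, ∃ t ⊆ K, t.Finite ∧ K ⊆ ⋃ x ∈ t, ball x (1 / ((n : ℝ) + 1)) :=
    fun n => hK.finite_cover_balls (hpos n)
  choose t htK htf ht using hnet
  have hC : ∀ (n : ℕ) (x : A), ∃ C ⊆ A ∩ ball x.1 (1 / ((n : ℝ) + 1)),
      Perfect C ∧ IsCompact C ∧ C.Nonempty := fun n x =>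
    exists_perfect_isCompact_subset
      (hA.inter_isClopen (IsUltrametricDist.isClopen_ball _ _)) ⟨x, x.2, mem_ball_self (hpos n)⟩
  choose C hCA hCp hCc hCn using hC
  let D : ℕ → Set X := fun n => ⋃ x : t n, C n ⟨x, hKA (htK n x.2)⟩
  have hDc : ∀ n, IsCompact (D n) := by
    intro n
    have := (htf n).to_subtype
    exact isCompact_iUnion fun x => hCc _ _
  let S : Set X := K ∪ ⋃ n, D n
  have hSA : S ⊆ A := union_subset hKA (iUnion_subset fun n => iUnion_subset fun x y hy =>
    (hCA _ _ hy).1)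
  have hSp : Preperfect S := by
    have hCacc : ∀ n x, ∀ y ∈ C n x, C n x ⊆ S → AccPt y (𝓟 S) := fun n x y hy h =>
      ((hCp n x).acc y hy).mono (Filter.principal_mono.2 h)
    have hCS : ∀ n (x : t n), C n ⟨x, hKA (htK n x.2)⟩ ⊆ S := fun n x y hy =>
      Or.inr (mem_iUnion.2 ⟨n, mem_iUnion.2 ⟨x, hy⟩⟩)
    rintro k (hk | hk)
    · rw [accPt_iff_nhds]
      intro U hU
      obtain ⟨ε, hε, hεU⟩ := Metric.mem_nhds_iff.1 hU
      obtain ⟨n, hn⟩ := exists_nat_one_div_lt hε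
      obtain ⟨x, hx, hkx⟩ := mem_iUnion₂.1 (ht n hk)
      obtain ⟨y, hy, hyk⟩ : ∃ y ∈ C n ⟨x, hKA (htK n hx)⟩, y ≠ k := by
        obtain ⟨y, hy⟩ := hCn n ⟨x, hKA (htK n hx)⟩
        obtain ⟨z, ⟨-, hz⟩, hzy⟩ := preperfect_iff_nhds.1 (hCp _ _).acc y hy univ univ_mem
        by_cases h : y = k
        · exact ⟨z, hz, h ▸ hzy⟩
        · exact ⟨y, hy, h⟩
      refine ⟨y, ⟨hεU (ball_subset_ball hn.le ?_), hCS n ⟨x, hx⟩ hy⟩, hyk⟩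
      rw [← IsUltrametricDist.ball_eq_of_mem hkx]
      exact (hCA _ _ hy).2
    · obtain ⟨n, hn⟩ := mem_iUnion.1 hk
      obtain ⟨x, hx⟩ := mem_iUnion.1 hn
      exact hCacc _ _ _ hx (hCS n x)
  have hStb : TotallyBounded S := by
    rw [Metric.totallyBounded_iff]
    intro ε hε
    obtain ⟨N, hN⟩ := exists_nat_one_div_lt hε
    obtain ⟨s, hs, hsD⟩ := Metric.totallyBounded_iff.1
      (((finite_Iio N).isCompact_biUnion fun n _ => hDc n).totallyBounded) ε hε
    refine ⟨s ∪ t N, hs.union (htf N), ?_⟩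
    rw [biUnion_union]
    have hKN : ∀ k ∈ K, ball k (1 / ((N : ℝ) + 1)) ⊆ ⋃ x ∈ t N, ball x ε := by
      intro k hk
      obtain ⟨x, hx, hkx⟩ := mem_iUnion₂.1 (ht N hk)
      rw [← IsUltrametricDist.ball_eq_of_mem hkx]
      exact (ball_subset_ball hN.le).trans (subset_biUnion_of_mem (u := fun x => ball x ε) hx)
    rintro y (hy | hy)
    · exact Or.inr (hKN y hy (mem_ball_self (hpos N)))
    · obtain ⟨n, hn⟩ := mem_iUnion.1 hy
      by_cases h : n < N
      · exact Or.inl (hsD (mem_biUnion (show n ∈ Iio N from h) hn))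
      · obtain ⟨x, hx⟩ := mem_iUnion.1 hn
        refine Or.inr (hKN x (htK n x.2) (ball_subset_ball ?_ (hCA _ _ hx).2))
        exact one_div_le_one_div_of_le (by positivity) (by
          have : N ≤ n := not_lt.1 h
          exact_mod_cast Nat.succ_le_succ this)
  refine ⟨closure S, subset_union_left.trans subset_closure, closure_minimal hSA hA.closed,
    hSp.perfect_closure, hStb.closure.isCompact_of_isClosed isClosed_closure⟩

theorem exists_perfect_exhaustion {X : Type*} [MetricSpace X] [CompleteSpace X]
    [IsUltrametricDist X] {A : Set X} (hA : Perfect A) (hσ : IsSigmaCompact A) :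
    ∃ M : ℕ → Set X, M 0 = ∅ ∧ Monotone M ∧ (∀ n, Perfect (M n) ∧ IsCompact (M n)) ∧
      ⋃ n, M n = A := by
  obtain ⟨K, hK, hKA⟩ := hσ
  choose L hKL hLA hLp hLc using fun n => exists_perfect_isCompact_superset hA
    (hKA ▸ subset_iUnion K n) (hK n)
  let M : ℕ → Set X := fun n => Nat.rec ∅ (fun n s => s ∪ L n) n
  refine ⟨M, rfl, monotone_nat_of_le_succ fun n => subset_union_left, fun n => ?_, ?_⟩
  · induction n with
    | zero => exact ⟨⟨isClosed_empty, fun x hx => hx.elim⟩, isCompact_empty⟩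
    | succ n ih =>
      exact ⟨⟨ih.1.closed.union (hLp n).closed, ih.1.acc.union (hLp n).acc⟩, ih.2.union (hLc n)⟩
  · refine subset_antisymm (iUnion_subset fun n => ?_) ?_
    · induction n with
      | zero => exact empty_subset _
      | succ n ih => exact union_subset ih (hLA n)
    · rw [← hKA]
      exact iUnion_subset fun n => (hKL n).trans
        (subset_union_right.trans (subset_iUnion M (n + 1)))

/-- Along an exhaustion by compact perfect sets, cut each layer `M (n + 1) \ M n` by balls missing
`M n`. Every piece is `M (n + 1)` intersected with a ball, hence compact and perfect. There are
infinitely many pieces because `A` is not compact. -/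
theorem exists_compact_perfect_fibers_nat {X : Type} [MetricSpace X] [CompleteSpace X]
    [IsUltrametricDist X] {A : Set X} (hA : Perfect A) (hσ : IsSigmaCompact A)
    (hc : ¬ IsCompact A) (hAω : BallCountLE ℵ₀ A) :
    ∃ q : X → ℕ, ∀ n, Perfect (A ∩ q ⁻¹' {n}) ∧ IsCompact (A ∩ q ⁻¹' {n}) ∧
      (A ∩ q ⁻¹' {n}).Nonempty := by
  obtain ⟨M, hM0, hMm, hM, hMA⟩ := exists_perfect_exhaustion hA hσ
  choose c hcM hccard using fun n => exists_complement_split (hM n).1.closed one_pos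
  -- The shift, together with `M 0 = ∅`, places each `x` in `A` in the layer `M (N x + 1) \ M (N
  -- x)`.
  let N : X → ℕ := fun x => sInf {n | x ∈ M (n + 1)}
  have hN : ∀ x ∈ A, x ∈ M (N x + 1) := by
    intro x hx
    refine Nat.sInf_mem (s := {n | x ∈ M (n + 1)}) ?_
    obtain ⟨n, hn⟩ := mem_iUnion.1 (hMA.symm ▸ hx)
    exact ⟨n, hMm (Nat.le_succ n) hn⟩
  have hN' : ∀ x, x ∉ M (N x) := by
    intro x hx
    rcases h : N x with _ | n
    · rw [h, hM0] at hx
      exact hx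
    · rw [h] at hx
      have : N x ≤ n := Nat.sInf_le hx
      omega
  have hNeq : ∀ x n, x ∈ M (n + 1) → x ∉ M n → N x = n := by
    intro x n h₁ h₂
    refine le_antisymm (Nat.sInf_le h₁) ?_
    by_contra! h
    exact h₂ (hMm h (hN x (hMA ▸ mem_iUnion.2 ⟨_, h₁⟩)))
  let P : X → ℕ × (ℕ × Set X) := fun x => (N x, c (N x) x)
  have hfib : ∀ x ∈ A, ∃ δ > 0, A ∩ P ⁻¹' {P x} = M (N x + 1) ∩ ball x δ := by
    intro x hx
    obtain ⟨δ, hδ, -, hdis, hδc⟩ := hcM (N x) x (hN' x)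
    refine ⟨δ, hδ, ?_⟩
    ext z
    simp only [mem_inter_iff, mem_preimage, mem_singleton_iff, P, Prod.mk.injEq]
    constructor
    · rintro ⟨hz, h₁, h₂⟩
      rw [h₁] at h₂
      exact ⟨h₁ ▸ hN z hz, (hδc z (h₁ ▸ hN' z)).1 h₂⟩
    · rintro ⟨h₁, h₂⟩
      have h₃ : z ∉ M (N x) := disjoint_left.1 hdis h₂
      have h₄ := hNeq z _ h₁ h₃
      exact ⟨hMA ▸ mem_iUnion.2 ⟨_, h₁⟩, h₄, by rw [h₄]; exact (hδc z h₃).2 h₂⟩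
  have hfib' : ∀ x ∈ A, Perfect (A ∩ P ⁻¹' {P x}) ∧ IsCompact (A ∩ P ⁻¹' {P x}) := by
    intro x hx
    obtain ⟨δ, -, h⟩ := hfib x hx
    rw [h]
    exact ⟨(hM _).1.inter_isClopen (IsUltrametricDist.isClopen_ball _ _),
      (hM _).2.inter_right (IsUltrametricDist.isClosed_ball _ _)⟩
  have hinf : (P '' A).Infinite := by
    intro hfin
    refine hc ?_
    have : A = ⋃ i ∈ P '' A, A ∩ P ⁻¹' {i} := by
      ext x
      simp only [mem_iUnion, mem_inter_iff]
      exact ⟨fun hx => ⟨P x, mem_image_of_mem P hx, hx, rfl⟩, fun ⟨_, _, hx, _⟩ => hx⟩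
    rw [this]
    refine hfin.isCompact_biUnion ?_
    rintro _ ⟨x, hx, rfl⟩
    exact (hfib' x hx).2
  have hcount : (P '' A).Countable := by
    refine (countable_iUnion fun n => Set.Countable.image (mk_le_aleph0_iff.1
      (hccard n ℵ₀ A le_rfl hAω) : (c n '' A).Countable) (Prod.mk n)).mono ?_
    rintro _ ⟨x, hx, rfl⟩
    exact mem_iUnion.2 ⟨N x, _, mem_image_of_mem _ hx, rfl⟩
  have := hinf.to_subtype
  have := hcount.to_subtype
  obtain ⟨e⟩ := nonempty_equiv_of_countable (α := P '' A) (β := ℕ)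
  have hne : A.Nonempty := by
    by_contra h
    rw [not_nonempty_iff_eq_empty] at h
    exact hc (h ▸ isCompact_empty)
  obtain ⟨F, hF⟩ := exists_reindex P hne e
  refine ⟨F ∘ P, fun n => ?_⟩
  obtain ⟨x, hx, h⟩ := hF n
  rw [h]
  exact ⟨(hfib' x hx).1, (hfib' x hx).2, x, hx, rfl⟩

/-- No regularity of `q` is needed, since the discrete factor already separates the copies of `Z` in
the domain. In the reverse direction, `condensesOnto_prod_of_fibers`, the partition lies on the
domain side and must be locally constant. -/
theorem prod_condensesOnto_of_fibers {Y Z ι : Type*} [TopologicalSpace Y] [TopologicalSpace Z]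
    [TopologicalSpace ι] [DiscreteTopology ι] {B : Set Y} (q : Y → ι)
    (h : ∀ i, CondensesOnto Z ↑(B ∩ q ⁻¹' {i})) : CondensesOnto (ι × Z) B := by
  choose f hf hb using h
  refine ⟨fun z => ⟨f z.1 z.2, (f z.1 z.2).2.1⟩, ?_, ?_, ?_⟩
  · refine Continuous.subtype_mk ?_ _
    rw [continuous_prod_of_discrete_left]
    exact fun i => continuous_subtype_val.comp (hf i)
  · rintro ⟨i, z⟩ ⟨j, w⟩ hzw
    have hzw : (f i z : Y) = f j w := congrArg Subtype.val hzw
    have hij : i = j := by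
      rw [← (f i z).2.2, ← (f j w).2.2, hzw]
    subst hij
    exact Prod.ext rfl ((hb i).1 (Subtype.ext hzw))
  · rintro ⟨y, hy⟩
    obtain ⟨z, hz⟩ := (hb (q y)).2 ⟨y, hy, rfl⟩
    refine ⟨(q y, z), Subtype.ext ?_⟩
    change (f (q y) z : Y) = y
    rw [hz]

theorem condensesOnto_prod_of_fibers {X Z ι : Type*} [TopologicalSpace X] [TopologicalSpace Z]
    [TopologicalSpace ι] [DiscreteTopology ι] {A : Set X} (p : X → ι) (hp : IsLocallyConstant p)
    (h : ∀ i, CondensesOnto ↑(A ∩ p ⁻¹' {i}) Z) : CondensesOnto A (ι × Z) := by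
  choose f hf hb using h
  refine ⟨fun x => (p x, f (p x) ⟨x, x.2, rfl⟩), ?_, ?_, ?_⟩
  · rw [continuous_iff_continuousAt]
    intro x
    let V : Set A := {y | p y = p x}
    have hV : IsOpen V := (hp.isOpen_fiber (p x)).preimage continuous_subtype_val
    have hcont : ContinuousOn (fun y : A => (p y, f (p y) ⟨y, y.2, rfl⟩)) V := by
      rw [continuousOn_iff_continuous_domRestrict]
      have hcont' : Continuous fun y : V => (p x, f (p x) ⟨y.1, y.1.2, y.2⟩) :=
        continuous_const.prodMk ((hf _).comp (Continuous.subtype_mk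
          (continuous_subtype_val.comp continuous_subtype_val) _))
      refine hcont'.congr fun y => ?_
      have : ∀ i (h : p y.1 = i), (i, f i ⟨y.1, y.1.2, h⟩) =
          ((p y.1 : ι), f (p y.1) ⟨y.1, y.1.2, rfl⟩) := by
        rintro i rfl
        rfl
      exact this _ y.2
    exact hcont.continuousAt (hV.mem_nhds rfl)
  · rintro ⟨x, hx⟩ ⟨y, hy⟩ hxy
    obtain ⟨h₁, h₂⟩ := Prod.ext_iff.1 hxy
    simp only at h₁ h₂
    have : ∀ i (h : p y = i), f (p y) ⟨y, hy, rfl⟩ = f i ⟨y, hy, h⟩ := by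
      rintro i rfl
      rfl
    rw [this _ h₁.symm] at h₂
    exact Subtype.ext (Subtype.mk.inj ((hb _).1 h₂))
  · rintro ⟨i, z⟩
    obtain ⟨⟨x, hx, hxi⟩, rfl⟩ := (hb i).2 z
    refine ⟨⟨x, hx⟩, ?_⟩
    have hxi : p x = i := hxi
    subst hxi
    rfl

/-! ### Partitions of sequence spaces into compact sets -/

/-- The space `Z` is the disjoint union of compact sets indexed by `ι`. -/
def HasCompactFibers (Z ι : Type*) [TopologicalSpace Z] : Prop :=
  ∃ g : Z → ι, ∀ i, IsCompact (g ⁻¹' {i})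

theorem HasCompactFibers.of_injective {Z ι κ : Type*} [TopologicalSpace Z]
    (h : HasCompactFibers Z ι) {f : ι → κ} (hf : Function.Injective f) : HasCompactFibers Z κ := by
  obtain ⟨g, hg⟩ := h
  refine ⟨f ∘ g, fun k => ?_⟩
  by_cases hk : ∃ i, f i = k
  · obtain ⟨i, rfl⟩ := hk
    have : f ∘ g ⁻¹' {f i} = g ⁻¹' {i} := by
      ext x
      simp [hf.eq_iff]
    rw [this]
    exact hg i
  · have : f ∘ g ⁻¹' {k} = ∅ := by
      ext x
      simp only [mem_preimage, mem_singleton_iff, mem_empty_iff_false, iff_false]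
      exact fun h => hk ⟨_, h⟩
    rw [this]
    exact isCompact_empty

theorem HasCompactFibers.of_condensesOnto {Z W ι : Type*} [TopologicalSpace Z]
    [TopologicalSpace W] (h : HasCompactFibers Z ι) (hZW : CondensesOnto Z W) :
    HasCompactFibers W ι := by
  obtain ⟨g, hg⟩ := h
  obtain ⟨f, hf, hb⟩ := hZW
  let e := Equiv.ofBijective f hb
  refine ⟨g ∘ e.symm, fun i => ?_⟩
  have : g ∘ e.symm ⁻¹' {i} = f '' (g ⁻¹' {i}) := by
    rw [preimage_comp]
    exact (e.image_eq_preimage_symm _).symm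
  rw [this]
  exact (hg i).image hf

/-- If `ι ^ ω` is a disjoint union of compact sets indexed by `J`, then so is `L ^ ω`, indexed by
`L × J`, when `L` is a well-order of cardinality greater than that of `ι` all of whose initial
segments have at most the cardinality of `ι`. -/
theorem HasCompactFibers.succ {ι J L : Type} [Infinite ι] [TopologicalSpace ι]
    [DiscreteTopology ι] [TopologicalSpace L] [DiscreteTopology L] [LinearOrder L]
    [WellFoundedLT L] (hL : ∀ a : L, #(Iio a) ≤ #ι) (hL' : #ι < #L)
    (h : HasCompactFibers (ℕ → ι) J) : HasCompactFibers (ℕ → L) (L × J) := by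
  classical
  obtain ⟨H, hH⟩ := h
  have hι := aleph0_le_mk ι
  -- An unbounded sequence would cover `L` by countably many initial segments, each of size at most
  -- `#ι < #L`.
  have hbdd : ∀ x : ℕ → L, {a | ∀ n, x n < a}.Nonempty := by
    intro x
    by_contra hcon
    have hcov : (⋃ n, Iic (x n)) = Set.univ := by
      refine eq_univ_of_forall fun a => ?_
      by_contra ha
      refine hcon ⟨a, fun n => ?_⟩
      by_contra hn
      exact ha (mem_iUnion.2 ⟨n, not_lt.1 hn⟩)
    have hIic : ∀ n, #(Iic (x n)) ≤ #ι := by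
      intro n
      rw [← Iio_insert]
      refine (mk_insert_le).trans ?_
      exact (add_le_add (hL _) (one_le_aleph0.trans hι)).trans (Cardinal.add_eq_self hι).le
    have := mk_iUnion_nat_le hι _ hIic
    rw [hcov, mk_univ] at this
    exact absurd hL' (not_lt.2 this)
  -- `α x` is the least strict upper bound of `x`. The sequences are first sorted by this ordinal,
  -- and `c a` is a fixed reference sequence with bound `a`.
  let α : (ℕ → L) → L := fun x => wellFounded_lt.min _ (hbdd x)
  have hα : ∀ x n, x n < α x := fun x => wellFounded_lt.min_mem _ (hbdd x)
  have hα' : ∀ x a, (∀ n, x n < a) → α x ≤ a := fun x a ha =>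
    not_lt.1 (wellFounded_lt.not_lt_min {a | ∀ n, x n < a} ha)
  let c : L → ℕ → L := fun a => if h : ∃ x, α x = a then h.choose else fun _ => a
  have hc : ∀ x, α (c (α x)) = α x := by
    intro x
    have h : ∃ y, α y = α x := ⟨x, rfl⟩
    simp only [c, dif_pos h]
    exact h.choose_spec
  have he : ∀ a : L, ∃ e : Iio a × ℕ → ι, Function.Injective e := by
    intro a
    refine (Cardinal.le_def _ _).1 ?_ |>.elim fun e => ⟨e, e.injective⟩
    rw [mk_prod, Cardinal.lift_id, Cardinal.lift_id, mk_nat]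
    exact (mul_le_mul' (hL a) hι).trans (Cardinal.mul_eq_self hι).le
  choose e he using he
  let i₀ : ι := Classical.arbitrary ι
  -- A sequence below `a` is coded over `ι` by storing, with each `x n`, the least index `m` at
  -- which `x` reaches `c a n`. Having these witnesses for all `n` certifies that the bound of `x`
  -- is not below `a`. The default `i₀` only occurs outside the class `α x = a`.
  let Φ : L → (ℕ → L) → ℕ → ι := fun a x n =>
    if h : x n < a then e a (⟨x n, h⟩, sInf {m | c a n ≤ x m}) else i₀
  refine ⟨fun x => (α x, H (Φ (α x) x)), ?_⟩
  rintro ⟨a, j⟩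
  by_cases hne : ∃ x, α x = a
  swap
  · convert isCompact_empty (X := ℕ → L)
    ext x
    simp only [mem_preimage, mem_singleton_iff, Prod.mk.injEq, mem_empty_iff_false, iff_false]
    exact fun h => hne ⟨x, h.1⟩
  obtain ⟨x₀, hx₀⟩ := hne
  have : Nonempty (Iio a × ℕ) := ⟨⟨x₀ 0, hx₀ ▸ hα x₀ 0⟩, 0⟩
  have hca : α (c a) = a := by rw [← hx₀, hc]
  let D : ι → Iio a × ℕ := Function.invFun (e a)
  have hD : ∀ z, D (e a z) = z := Function.leftInverse_invFun (he a)
  let Ψ : (ℕ → ι) → ℕ → L := fun z n => (D (z n)).1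
  have hΨ : Continuous Ψ := continuous_pi fun n =>
    (continuous_of_discreteTopology (f := fun i => ((D i).1 : L))).comp (continuous_apply n)
  -- The set of correct codes: every entry is a code, its stored index is a witness, and no earlier
  -- index is one. Each clause involves finitely many coordinates, so `N` is closed, although the
  -- class `α x = a` itself need not be.
  let N : Set (ℕ → ι) := {z | (∀ n, z n ∈ range (e a)) ∧
    (∀ n m, (D (z n)).2 = m → c a n ≤ (D (z m)).1) ∧
    ∀ n k, k < (D (z n)).2 → ¬ c a n ≤ (D (z k)).1}
  have hN : IsClosed N := by
    have h₁ : ∀ n, IsClosed {z : ℕ → ι | z n ∈ range (e a)} := fun n =>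
      (isClosed_discrete (range (e a))).preimage (continuous_apply n)
    have h₂ : ∀ (n m : ℕ) (Q : ι × ι → Prop), IsClosed {z : ℕ → ι | Q (z n, z m)} :=
      fun n m Q => (isClosed_discrete {w | Q w}).preimage
        ((continuous_apply n).prodMk (continuous_apply m))
    have : N = (⋂ n, {z | z n ∈ range (e a)}) ∩
        ((⋂ n, ⋂ m, {z | (D (z n)).2 = m → c a n ≤ (D (z m)).1}) ∩
          ⋂ n, ⋂ k, {z | k < (D (z n)).2 → ¬ c a n ≤ (D (z k)).1}) := by
      ext z
      simp only [N, mem_ofPred_eq, mem_inter_iff, mem_iInter]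
    rw [this]
    refine (isClosed_iInter h₁).inter ((isClosed_iInter fun n => isClosed_iInter fun m =>
      h₂ n m fun w => (D w.1).2 = m → c a n ≤ (D w.2).1).inter (isClosed_iInter fun n =>
        isClosed_iInter fun k => h₂ n k fun w => k < (D w.1).2 → ¬ c a n ≤ (D w.2).1))
  -- Decoding is continuous, so each class is a continuous image of a compact class of `ι ^ ω` cut
  -- down by the closed set `N`.
  have himg : (fun x => (α x, H (Φ (α x) x))) ⁻¹' {(a, j)} = Ψ '' (H ⁻¹' {j} ∩ N) := by
    ext x
    simp only [mem_preimage, mem_singleton_iff, Prod.mk.injEq]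
    constructor
    · rintro ⟨hxa, hj⟩
      rw [hxa] at hj
      have hlt : ∀ n, x n < a := fun n => hxa ▸ hα x n
      have hΦ : ∀ n, Φ a x n = e a (⟨x n, hlt n⟩, sInf {m | c a n ≤ x m}) :=
        fun n => dif_pos (hlt n)
      have hex : ∀ n, {m | c a n ≤ x m}.Nonempty := by
        intro n
        by_contra hcon
        have h₁ : α x ≤ c a n := hα' x _ fun m => by
          by_contra hm
          exact hcon ⟨m, not_lt.1 hm⟩
        have h₂ := hα (c a) n
        rw [hca] at h₂
        exact absurd h₂ (not_lt.2 (hxa ▸ h₁))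
      refine ⟨Φ a x, ⟨hj, fun n => ⟨_, (hΦ n).symm⟩, ?_, ?_⟩, funext fun n => ?_⟩
      · rintro n m rfl
        rw [hΦ, hD, hΦ, hD]
        exact Nat.sInf_mem (hex n)
      · intro n k hk
        rw [hΦ, hD] at hk
        rw [hΦ, hD]
        exact Nat.notMem_of_lt_sInf hk
      · change ((D (Φ a x n)).1 : L) = x n
        rw [hΦ, hD]
    · rintro ⟨z, ⟨hj, hz₁, hz₂, hz₃⟩, rfl⟩
      have hlt : ∀ n, Ψ z n < a := fun n => (D (z n)).1.2
      have hle : ∀ n, c a n ≤ Ψ z (D (z n)).2 := fun n => hz₂ n _ rfl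
      have hαz : α (Ψ z) = a := by
        refine le_antisymm (hα' _ _ hlt) ?_
        rw [← hca]
        exact hα' _ _ fun n => (hle n).trans_lt (hα _ _)
      have hΦz : Φ a (Ψ z) = z := by
        funext n
        have h₁ : sInf {m | c a n ≤ Ψ z m} = (D (z n)).2 := by
          refine le_antisymm (Nat.sInf_le (hle n)) ?_
          by_contra! hlt
          exact hz₃ n _ hlt (Nat.sInf_mem (s := {m | c a n ≤ Ψ z m}) ⟨_, hle n⟩)
        obtain ⟨w, hw⟩ := hz₁ n
        have h₂ : Φ a (Ψ z) n = e a (⟨Ψ z n, hlt n⟩, sInf {m | c a n ≤ Ψ z m}) :=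
          dif_pos (hlt n)
        rw [h₂, h₁, ← hw]
        congr 1
        refine Prod.ext (Subtype.ext ?_) ?_
        · change ((D (z n)).1 : L) = _
          rw [← hw, hD]
        · change (D (e a w)).2 = _
          rw [hD]
      refine ⟨hαz, ?_⟩
      rw [hαz, hΦz]
      exact hj
  rw [himg]
  exact ((hH j).inter_right hN).image hΨ

/-! ### Cellularity -/

/-- Every family of pairwise disjoint nonempty open subsets of `X` has at most `κ` members. -/
def CellularityLE (κ : Cardinal.{0}) (X : Type) [TopologicalSpace X] : Prop :=
  ∀ 𝒰 : Set (Set X), (∀ U ∈ 𝒰, IsOpen U ∧ U.Nonempty) → 𝒰.PairwiseDisjoint id →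
    #𝒰 ≤ κ

theorem CellularityLE.mono {κ μ : Cardinal.{0}} {X : Type} [TopologicalSpace X]
    (h : CellularityLE κ X) (hκ : κ ≤ μ) : CellularityLE μ X :=
  fun _ h₁ h₂ => (h _ h₁ h₂).trans hκ

theorem cellularityLE_of_separableSpace (X : Type) [TopologicalSpace X]
    [TopologicalSpace.SeparableSpace X] :
    CellularityLE ℵ₀ X := fun _ h₁ h₂ =>
  mk_le_aleph0_iff.2 (h₂.countable_of_isOpen (fun U hU => (h₁ U hU).1) fun U hU => (h₁ U hU).2)

theorem cellularityLE_mk (X : Type) [TopologicalSpace X] : CellularityLE #X X := by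
  intro 𝒰 h₁ h₂
  choose f hf using fun U : 𝒰 => (h₁ U U.2).2
  refine mk_le_of_injective (f := f) fun U V hUV => Subtype.ext ?_
  exact h₂.elim U.2 V.2 (not_disjoint_iff.2 ⟨f U, hf U, hUV ▸ hf V⟩)

theorem CellularityLE.of_condensesOnto {κ : Cardinal.{0}} {X Y : Type} [TopologicalSpace X]
    [TopologicalSpace Y] (h : CellularityLE κ X) (hXY : CondensesOnto X Y) :
    CellularityLE κ Y := by
  obtain ⟨f, hf, hb⟩ := hXY
  intro 𝒰 h₁ h₂
  have hinj : Function.Injective (fun U : Set Y => f ⁻¹' U) := preimage_injective.2 hb.2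
  rw [← mk_image_eq hinj]
  refine h _ ?_ ?_
  · rintro _ ⟨U, hU, rfl⟩
    exact ⟨(h₁ U hU).1.preimage hf, (h₁ U hU).2.preimage hb.2⟩
  · rintro _ ⟨U, hU, rfl⟩ _ ⟨V, hV, rfl⟩ hUV
    exact (h₂ hU hV fun h => hUV (by rw [h])).preimage f

theorem CellularityLE.ballCountLE {κ : Cardinal.{0}} {X : Type} [MetricSpace X]
    [IsUltrametricDist X] (h : CellularityLE κ X) (A : Set X) : BallCountLE κ A := by
  intro ε hε
  refine h _ ?_ ?_
  · rintro _ ⟨x, -, rfl⟩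
    exact ⟨isOpen_ball, ⟨x, mem_ball_self hε⟩⟩
  · rintro _ ⟨x, -, rfl⟩ _ ⟨y, -, rfl⟩ hxy
    refine (IsUltrametricDist.ball_eq_or_disjoint x y ε).resolve_left hxy

/-! ### The Baire space -/

/-- A cylinder projects onto the whole infinite discrete space in its first free coordinate. -/
theorem nowhereCompact_sequences (ι : Type) [Infinite ι] [TopologicalSpace ι]
    [DiscreteTopology ι] : NowhereCompact (Set.univ : Set (ℕ → ι)) := by
  rintro U hU ⟨x, -, hx⟩ hc
  rw [univ_inter] at hc
  obtain ⟨n, hn⟩ := exists_cylinder_subset hU.isOpen hx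
  have hfin := isCompact_iff_finite.1 (hc.image (continuous_apply n))
  refine hfin.not_infinite ?_
  have : (fun y : ℕ → ι => y n) '' U = Set.univ := by
    refine eq_univ_of_forall fun b => ?_
    exact ⟨Function.update x n b, hn (PiNat.update_mem_cylinder x n b), by simp⟩
  rw [this]
  exact infinite_univ

theorem condensesOnto_baire_of_not_sigmaCompactSpace {X : Type} [TopologicalSpace X]
    (hX : IsCompletelyUltrametrizable X) [PerfectSpace X] (hω : CellularityLE ℵ₀ X)
    (hσ : ¬ SigmaCompactSpace X) : CondensesOnto X (ℕ → ℕ) := by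
  -- The target is kept abstract so that its topology can be replaced by the one coming from its
  -- complete ultrametric.
  have key : ∀ {Y : Type} [TopologicalSpace Y], IsCompletelyUltrametrizable Y → PerfectSpace Y →
      CellularityLE ℵ₀ Y → Nonempty Y → NowhereCompact (Set.univ : Set Y) →
      CondensesOnto X Y := by
    intro Y _ hY hYp hYω hYn hYc
    obtain ⟨m, rfl, hc, hu⟩ := hX
    obtain ⟨m', rfl, hc', hu'⟩ := hY
    obtain ⟨f, hf, hb⟩ := condensesOnto_of_nowhereCompact (PerfectSpace.univ_perfect X)
      (hω.ballCountLE _) (fun h => hσ (isSigmaCompact_univ_iff.1 h)) (PerfectSpace.univ_perfect Y)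
      univ_nonempty (hYω.ballCountLE _) hYc
    exact ⟨fun x => f ⟨x, trivial⟩,
      continuous_subtype_val.comp (hf.comp (Continuous.subtype_mk continuous_id _)),
      (Equiv.Set.univ Y).bijective.comp (hb.comp (Equiv.Set.univ X).symm.bijective)⟩
  exact key (isCompletelyUltrametrizable_sequences ℕ) (perfectSpace_sequences ℕ)
    (cellularityLE_of_separableSpace _) inferInstance (nowhereCompact_sequences ℕ)

/-! ### From closed partitions of the Cantor space to compact partitions of the Baire space -/

theorem isLocallyConstant_firstDiff {S : Set (ℕ → Bool)} (d : ℕ → Bool) (hd : d ∉ S) :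
    IsLocallyConstant fun x : S => PiNat.firstDiff x.1 d := by
  rw [IsLocallyConstant.iff_eventually_eq]
  intro x
  have hx : x.1 ≠ d := fun h => hd (h ▸ x.2)
  have hopen : IsOpen {y : S | y.1 ∈ PiNat.cylinder x.1 (PiNat.firstDiff x.1 d + 1)} :=
    (PiNat.isOpen_cylinder _ x.1 _).preimage continuous_subtype_val
  filter_upwards [hopen.mem_nhds (PiNat.self_mem_cylinder _ _)] with y hy
  have hyd : y.1 ≠ d := fun h => hd (h ▸ y.2)
  have hy' : ∀ i < PiNat.firstDiff x.1 d + 1, y.1 i = x.1 i := hy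
  apply le_antisymm
  · by_contra! h
    have h₁ := PiNat.apply_eq_of_lt_firstDiff h
    rw [hy' _ (Nat.lt_succ_self _)] at h₁
    exact PiNat.apply_firstDiff_ne hx h₁
  · by_contra! h
    have h₁ := PiNat.apply_eq_of_lt_firstDiff h
    rw [← hy' _ (by omega)] at h₁
    exact PiNat.apply_firstDiff_ne hyd h₁

/-- Adjoin to `x` the positions at which it first differs from each `d n`. The resulting graph is
closed in `2 ^ ω × ω ^ ω`, since a stated position can be checked on finitely many coordinates of
`x`. -/
theorem isCompletelyUltrametrizable_diff_range {K : Set (ℕ → Bool)} (hK : IsClosed K)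
    (d : ℕ → ℕ → Bool) : IsCompletelyUltrametrizable ↑(K \ range d) := by
  let e : ↑(K \ range d) → (ℕ → Bool) × (ℕ → ℕ) :=
    fun x => (x.1, fun n => PiNat.firstDiff x.1 (d n))
  have hd : ∀ n, d n ∉ K \ range d := fun n h => h.2 ⟨n, rfl⟩
  have he : Continuous e := continuous_subtype_val.prodMk (continuous_pi fun n =>
    (isLocallyConstant_firstDiff (d n) (hd n)).continuous)
  have hemb : IsEmbedding e := .of_comp he continuous_fst IsEmbedding.subtypeVal
  have hrange : range e = {z | z.1 ∈ K} ∩ ⋂ n, ⋂ m, {z : (ℕ → Bool) × (ℕ → ℕ) | z.2 n = m →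
      (∀ i < m, z.1 i = d n i) ∧ z.1 m ≠ d n m} := by
    ext ⟨x, h⟩
    simp only [mem_range, mem_inter_iff, mem_iInter, mem_ofPred_eq]
    constructor
    · rintro ⟨y, hy⟩
      obtain ⟨rfl, rfl⟩ := Prod.ext_iff.1 hy
      refine ⟨y.2.1, ?_⟩
      rintro n _ rfl
      exact ⟨fun i hi => PiNat.apply_eq_of_lt_firstDiff hi,
        PiNat.apply_firstDiff_ne fun h => hd n (h ▸ y.2)⟩
    · rintro ⟨hx, h'⟩
      have hne : ∀ n, x ≠ d n := fun n hn => (h' n _ rfl).2 (by rw [hn])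
      refine ⟨⟨x, hx, ?_⟩, Prod.ext rfl (funext fun n => ?_)⟩
      · rintro ⟨n, rfl⟩
        exact hne n rfl
      · change PiNat.firstDiff x (d n) = h n
        apply le_antisymm
        · by_contra! hlt
          exact (h' n _ rfl).2 (PiNat.apply_eq_of_lt_firstDiff hlt)
        · by_contra! hlt
          exact PiNat.apply_firstDiff_ne (hne n) ((h' n _ rfl).1 _ hlt)
  have hclosed : IsClosed (range e) := by
    rw [hrange]
    refine (hK.preimage continuous_fst).inter (isClosed_iInter fun n => isClosed_iInter fun m => ?_)
    have h₁ : IsOpen {z : (ℕ → Bool) × (ℕ → ℕ) | z.2 n = m} :=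
      (isOpen_discrete {m}).preimage
      (show Continuous fun z : (ℕ → Bool) × (ℕ → ℕ) => z.2 n by fun_prop)
    have h₂ : ∀ (i : ℕ) (S : Set Bool), IsClosed {z : (ℕ → Bool) × (ℕ → ℕ) | z.1 i ∈ S} :=
      fun i S => (isClosed_discrete S).preimage ((continuous_apply i).comp continuous_fst)
    have : {z : (ℕ → Bool) × (ℕ → ℕ) | z.2 n = m → (∀ i < m, z.1 i = d n i) ∧ z.1 m ≠ d n m} =
        {z | z.2 n = m}ᶜ ∪ ((⋂ i, ⋂ _ : i < m, {z | z.1 i ∈ ({d n i} : Set Bool)}) ∩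
          {z | z.1 m ∈ ({d n m} : Set Bool)ᶜ}) := by
      ext z
      simp only [mem_ofPred_eq, mem_union, mem_compl_iff, mem_inter_iff, mem_iInter,
        mem_singleton_iff, imp_iff_not_or (a := z.2 n = m)]
    rw [this]
    exact h₁.isClosed_compl.union ((isClosed_iInter fun i => isClosed_iInter fun _ =>
      h₂ i _).inter (h₂ m _))
  exact (((isCompletelyUltrametrizable_sequences Bool).prod
    (isCompletelyUltrametrizable_sequences ℕ)).of_isClosed hclosed).of_homeomorph
      hemb.toHomeomorph

/-- A Cantor–Bendixson argument for the classes of `g`: remove every basic open set meeting only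
countably many classes. Altogether only countably many classes are met by the removed set. -/
theorem exists_condensed_kernel {κ : Type} [Uncountable κ] {g : (ℕ → Bool) → κ}
    (hg : Function.Surjective g) :
    ∃ K : Set (ℕ → Bool), IsClosed K ∧ K.Nonempty ∧
      ∀ V, IsOpen V → (V ∩ K).Nonempty → ¬ (g '' (V ∩ K)).Countable := by
  let b := TopologicalSpace.countableBasis (ℕ → Bool)
  have hb := TopologicalSpace.isBasis_countableBasis (ℕ → Bool)
  let O : Set (ℕ → Bool) := ⋃₀ {U ∈ b | (g '' U).Countable}
  have hO : IsOpen O := isOpen_sUnion fun U hU => hb.isOpen hU.1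
  have hgO : (g '' O).Countable := by
    rw [image_sUnion]
    refine Set.Countable.sUnion (((TopologicalSpace.countable_countableBasis _).mono
      (sep_subset _ _)).image _) ?_
    rintro _ ⟨U, hU, rfl⟩
    exact hU.2
  refine ⟨Oᶜ, hO.isClosed_compl, ?_, ?_⟩
  · rw [nonempty_compl]
    intro h
    rw [h, image_univ, hg.range_eq, countable_univ_iff] at hgO
    exact not_countable hgO
  · rintro V hV ⟨x, hxV, hxO⟩ hcount
    obtain ⟨U, hU, hxU, hUV⟩ := hb.exists_subset_of_mem_open hxV hV
    refine hxO ⟨U, ⟨hU, (hcount.union hgO).mono ?_⟩, hxU⟩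
    rw [← image_union]
    refine image_mono fun y hy => ?_
    by_cases h : y ∈ O
    · exact Or.inr h
    · exact Or.inl ⟨hUV hy, h⟩

/-- Run through the countably many basic open sets meeting `K`, each time choosing a point in a new
class. Only finitely many classes have been used, while uncountably many are available. -/
theorem exists_dense_sequence_injective {κ : Type} {g : (ℕ → Bool) → κ} {K : Set (ℕ → Bool)}
    (hKn : K.Nonempty)
    (hK : ∀ V, IsOpen V → (V ∩ K).Nonempty → ¬ (g '' (V ∩ K)).Countable) :
    ∃ d : ℕ → ℕ → Bool, (∀ n, d n ∈ K) ∧ (∀ m n, g (d m) = g (d n) → m = n) ∧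
      ∀ V, IsOpen V → (V ∩ K).Nonempty → ∃ n, d n ∈ V := by
  have hb := TopologicalSpace.isBasis_countableBasis (ℕ → Bool)
  have hcount : {U ∈ TopologicalSpace.countableBasis (ℕ → Bool) | (U ∩ K).Nonempty}.Countable :=
    (TopologicalSpace.countable_countableBasis _).mono (sep_subset _ _)
  have hmeet : ∀ V, IsOpen V → (V ∩ K).Nonempty →
      ∃ U ∈ {U ∈ TopologicalSpace.countableBasis (ℕ → Bool) | (U ∩ K).Nonempty}, U ⊆ V := by
    rintro V hV ⟨x, hxV, hxK⟩
    obtain ⟨U, hU, hxU, hUV⟩ := hb.exists_subset_of_mem_open hxV hV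
    exact ⟨U, ⟨hU, x, hxU, hxK⟩, hUV⟩
  obtain ⟨U, hU⟩ := hcount.exists_eq_range (by
    obtain ⟨U, hU, -⟩ := hmeet univ isOpen_univ (by simpa using hKn)
    exact ⟨U, hU⟩)
  have hUn : ∀ n, IsOpen (U n) ∧ (U n ∩ K).Nonempty := by
    intro n
    have : U n ∈ {U ∈ TopologicalSpace.countableBasis (ℕ → Bool) | (U ∩ K).Nonempty} :=
      hU ▸ mem_range_self n
    exact ⟨hb.isOpen this.1, this.2⟩
  have hpick : ∀ (n : ℕ) (s : {s : Set κ // s.Countable}), ∃ y ∈ U n ∩ K, g y ∉ s.1 := by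
    intro n s
    by_contra! hcon
    exact hK _ (hUn n).1 (hUn n).2 (s.2.mono (image_subset_iff.2 hcon))
  choose pick hpickU hpick using hpick
  let s : ℕ → {s : Set κ // s.Countable} := fun n => Nat.rec ⟨∅, countable_empty⟩
    (fun n s => ⟨insert (g (pick n s)) s.1, s.2.insert _⟩) n
  have hs : ∀ n, (s (n + 1)).1 = insert (g (pick n (s n))) (s n).1 := fun _ => rfl
  have hmono : Monotone fun n => (s n).1 := monotone_nat_of_le_succ fun n => by
    rw [hs]
    exact subset_insert _ _
  have hlt : ∀ m n, m < n → g (pick m (s m)) ≠ g (pick n (s n)) := by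
    intro m n hmn h
    refine hpick n (s n) (h ▸ hmono (Nat.succ_le_of_lt hmn) ?_)
    simp only [Nat.succ_eq_add_one, hs]
    exact mem_insert _ _
  refine ⟨fun n => pick n (s n), fun n => (hpickU _ _).2, fun m n h => ?_, fun V hV hVK => ?_⟩
  · rcases lt_trichotomy m n with h' | h' | h'
    · exact absurd h (hlt _ _ h')
    · exact h'
    · exact absurd h.symm (hlt _ _ h')
  · obtain ⟨W, hW, hWV⟩ := hmeet V hV hVK
    rw [hU] at hW
    obtain ⟨n, rfl⟩ := hW
    exact ⟨n, hWV (hpickU _ _).1⟩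

/-- Remove from the kernel `K` a countable dense set with at most one point in each class. What
remains is perfect, separable and not σ-compact, so it condenses onto `ω ^ ω`. A class that lost the
point `d n` splits into countably many compact pieces according to the first difference from `d n`;
the other classes meet `K` in compact sets. In total there are `κ · ℵ₀ = κ` pieces. -/
theorem hasCompactFibers_baire {κ : Type} [Uncountable κ] (h : HasClosedFibers (ℕ → Bool) κ) :
    HasCompactFibers (ℕ → ℕ) κ := by
  classical
  obtain ⟨g, hg, hgc⟩ := h
  obtain ⟨K, hK, hKn, hKV⟩ := exists_condensed_kernel hg
  obtain ⟨d, hdK, hdi, hdV⟩ := exists_dense_sequence_injective hKn hKV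
  have hd : ∀ n, d n ∉ K \ range d := fun n h => h.2 ⟨n, rfl⟩
  have hperf : PerfectSpace ↑(K \ range d) := by
    refine ⟨preperfect_iff_nhds.2 fun x _ U hU => ?_⟩
    obtain ⟨V, hVU, hV, hxV⟩ := mem_nhds_iff.1 hU
    obtain ⟨W, hW, rfl⟩ := isOpen_induced_iff.1 hV
    by_contra! hcon
    refine hKV W hW ⟨x, hxV, x.2.1⟩ (((countable_range d).insert x.1).image g |>.mono
      (image_mono fun y hy => ?_))
    by_cases hyd : y ∈ range d
    · exact Or.inr hyd
    · left
      have := hcon ⟨y, hy.2, hyd⟩ ⟨hVU hy.1, trivial⟩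
      exact congrArg Subtype.val this
  have hσ : ¬ SigmaCompactSpace ↑(K \ range d) := by
    intro hσ
    have := isCompact_iff_compactSpace.1 hK.isCompact
    have := hKn.to_subtype
    let C : ℕ → Set (ℕ → Bool) := fun n =>
      Subtype.val '' compactCovering ↑(K \ range d) n
    have hC : ∀ n, IsCompact (C n) := fun n =>
      (isCompact_compactCovering _ n).image continuous_subtype_val
    let f : ℕ ⊕ ℕ → Set K := fun i =>
      Subtype.val ⁻¹' (Sum.elim C (fun n => {d n}) i)
    have hf : ∀ i, IsClosed (f i) := by
      rintro (n | n)
      · exact (hC n).isClosed.preimage continuous_subtype_val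
      · exact isClosed_singleton.preimage continuous_subtype_val
    have hU : ⋃ i, f i = Set.univ := by
      refine eq_univ_of_forall fun x => mem_iUnion.2 ?_
      by_cases hx : x.1 ∈ range d
      · obtain ⟨n, hn⟩ := hx
        exact ⟨.inr n, hn.symm⟩
      · obtain ⟨n, hn⟩ := exists_mem_compactCovering (⟨x.1, x.2, hx⟩ : ↑(K \ range d))
        exact ⟨.inl n, _, hn, rfl⟩
    -- By Baire category one of the covering sets has interior in `K`. A compact piece avoids the
    -- dense removed points, and a singleton meets only one class, so neither is possible.
    obtain ⟨i, x, hx⟩ := nonempty_interior_of_iUnion_of_closed hf hU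
    obtain ⟨V, hVf, hV, hxV⟩ := mem_interior.1 hx
    obtain ⟨W, hW, rfl⟩ := isOpen_induced_iff.1 hV
    have hWK : (W ∩ K).Nonempty := ⟨x, hxV, x.2⟩
    rcases i with n | n
    · obtain ⟨m, hm⟩ := hdV W hW hWK
      obtain ⟨y, -, hy⟩ : d m ∈ C n := hVf (show (⟨d m, hdK m⟩ : K) ∈ _ from hm)
      exact hd m (hy ▸ y.2)
    · refine hKV W hW hWK ((countable_singleton (g (d n))).mono ?_)
      rintro _ ⟨y, ⟨hyW, hyK⟩, rfl⟩
      have : y = d n := hVf (show (⟨y, hyK⟩ : K) ∈ _ from hyW)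
      rw [this]
      rfl
  have hcond : CondensesOnto ↑(K \ range d) (ℕ → ℕ) :=
    condensesOnto_baire_of_not_sigmaCompactSpace (isCompletelyUltrametrizable_diff_range hK d)
      (cellularityLE_of_separableSpace _) hσ
  let G : ↑(K \ range d) → κ × ℕ := fun x =>
    (g x, if h : ∃ n, g (d n) = g x then PiNat.firstDiff x.1 (d h.choose) else 0)
  have hG : HasCompactFibers ↑(K \ range d) (κ × ℕ) := by
    refine ⟨G, ?_⟩
    rintro ⟨k, m⟩
    rw [Subtype.isCompact_iff]
    refine IsClosed.isCompact ?_
    by_cases hk : ∃ n, g (d n) = k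
    · obtain ⟨n, hn⟩ := hk
      have hGx : ∀ x : ↑(K \ range d), g x = k → (G x).2 = PiNat.firstDiff x.1 (d n) := by
        intro x hx
        have h : ∃ n, g (d n) = g x := ⟨n, hn.trans hx.symm⟩
        have : h.choose = n := hdi _ _ (h.choose_spec.trans (hx.trans hn.symm))
        simp only [G, dif_pos h, this]
      have himg : Subtype.val '' (G ⁻¹' {(k, m)}) = (K ∩ g ⁻¹' {k}) ∩
          ((⋂ i, ⋂ _ : i < m, {x | x i ∈ ({d n i} : Set Bool)}) ∩
            {x | x m ∈ ({d n m} : Set Bool)ᶜ}) := by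
        ext x
        simp only [mem_image, mem_preimage, mem_singleton_iff, mem_inter_iff, mem_iInter,
          mem_ofPred_eq, mem_compl_iff]
        constructor
        · rintro ⟨y, hy, rfl⟩
          obtain ⟨h₁, h₂⟩ := Prod.ext_iff.1 hy
          have h₁ : g y = k := h₁
          rw [hGx y h₁] at h₂
          have h₂ : PiNat.firstDiff y.1 (d n) = m := h₂
          subst h₂
          exact ⟨⟨y.2.1, h₁⟩, fun i hi => PiNat.apply_eq_of_lt_firstDiff hi,
            PiNat.apply_firstDiff_ne fun h => hd n (h ▸ y.2)⟩
        · rintro ⟨⟨hxK, hxk⟩, h₁, h₂⟩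
          have hxn : x ≠ d n := fun h => h₂ (by rw [h])
          have hxd : x ∉ range d := by
            rintro ⟨n', rfl⟩
            exact hxn (by rw [hdi _ _ (hxk.trans hn.symm)])
          refine ⟨⟨x, hxK, hxd⟩, Prod.ext hxk ?_, rfl⟩
          rw [hGx _ hxk]
          change PiNat.firstDiff x (d n) = m
          apply le_antisymm
          · by_contra! hlt
            exact h₂ (PiNat.apply_eq_of_lt_firstDiff hlt)
          · by_contra! hlt
            exact PiNat.apply_firstDiff_ne hxn (h₁ _ hlt)
      have h₃ : ∀ (i : ℕ) (S : Set Bool), IsClosed {x : ℕ → Bool | x i ∈ S} :=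
        fun i S => (isClosed_discrete S).preimage (continuous_apply i)
      rw [himg]
      exact (hK.inter (hgc k)).inter ((isClosed_iInter fun i => isClosed_iInter fun _ =>
        h₃ i _).inter (h₃ m _))
    · have himg : Subtype.val '' (G ⁻¹' {(k, m)}) = if m = 0 then K ∩ g ⁻¹' {k} else ∅ := by
        have hGx : ∀ x : ↑(K \ range d), g x = k → (G x).2 = 0 := by
          intro x hx
          have h : ¬ ∃ n, g (d n) = g x := hx ▸ hk
          simp only [G, dif_neg h]
        ext x
        constructor
        · rintro ⟨y, hy, rfl⟩
          obtain ⟨h₁, h₂⟩ := Prod.ext_iff.1 hy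
          have h₁ : g y = k := h₁
          have h₂ : m = 0 := by rw [hGx y h₁] at h₂; exact h₂.symm
          rw [if_pos h₂]
          exact ⟨y.2.1, h₁⟩
        · intro hx
          split_ifs at hx with hm
          · have hxd : x ∉ range d := by
              rintro ⟨n, rfl⟩
              exact hk ⟨n, hx.2⟩
            refine ⟨⟨x, hx.1, hxd⟩, Prod.ext hx.2 ?_, rfl⟩
            exact (hGx _ (show g (⟨x, hx.1, hxd⟩ : ↑(K \ range d)).1 = k from hx.2)).trans hm.symm
          · exact hx.elim
      rw [himg]
      split_ifs
      · exact hK.inter (hgc k)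
      · exact isClosed_empty
  have e : Nonempty (κ × ℕ ≃ κ) := Cardinal.eq.1 (by
    rw [mk_prod, Cardinal.lift_id, Cardinal.lift_id, mk_nat]
    exact Cardinal.mul_eq_left (aleph0_le_mk κ) (aleph0_le_mk κ) aleph0_ne_zero)
  exact (hG.of_condensesOnto hcond).of_injective e.some.injective

/-! ### Condensations and cellularity of the model spaces -/

theorem CondensesOnto.trans {X Y Z : Type*} [TopologicalSpace X] [TopologicalSpace Y]
    [TopologicalSpace Z] (h : CondensesOnto X Y) (h' : CondensesOnto Y Z) : CondensesOnto X Z :=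
  let ⟨f, hf, hb⟩ := h
  let ⟨g, hg, hb'⟩ := h'
  ⟨g ∘ f, hg.comp hf, hb'.comp hb⟩

theorem Homeomorph.condensesOnto {X Y : Type*} [TopologicalSpace X] [TopologicalSpace Y]
    (e : X ≃ₜ Y) : CondensesOnto X Y :=
  ⟨e, e.continuous, e.bijective⟩

theorem Homeomorph.condensesOnto_symm {X Y : Type*} [TopologicalSpace X] [TopologicalSpace Y]
    (e : X ≃ₜ Y) : CondensesOnto Y X :=
  e.symm.condensesOnto

theorem cellularityLE_of_dense {X : Type} [TopologicalSpace X] {κ : Cardinal.{0}} {s : Set X}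
    (hs : Dense s) (hκ : #s ≤ κ) : CellularityLE κ X := by
  intro 𝒰 h₁ h₂
  choose f hf using fun U : 𝒰 => hs.inter_open_nonempty U (h₁ U U.2).1 (h₁ U U.2).2
  refine le_trans (mk_le_of_injective (f := fun U => (⟨f U, (hf U).2⟩ : s)) fun U V hUV =>
    Subtype.ext ?_) hκ
  have hUV : f U = f V := congrArg Subtype.val hUV
  exact h₂.elim U.2 V.2 (not_disjoint_iff.2 ⟨f U, (hf U).1, hUV ▸ (hf V).1⟩)

theorem cellularityLE_prod (κ : Type) [Infinite κ] [TopologicalSpace κ] [DiscreteTopology κ] :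
    CellularityLE #κ (κ × (ℕ → Bool)) := by
  obtain ⟨s, hs, h⟩ := TopologicalSpace.exists_countable_dense (ℕ → Bool)
  refine cellularityLE_of_dense (dense_univ (X := κ) |>.prod h) ?_
  have hsub : #s ≤ ℵ₀ := mk_le_aleph0_iff.2 hs
  rw [mk_congr (Equiv.Set.prod _ _), mk_prod, Cardinal.lift_id, Cardinal.lift_id, mk_univ]
  exact (mul_le_mul' le_rfl (hsub.trans (aleph0_le_mk κ))).trans
    (Cardinal.mul_eq_self (aleph0_le_mk κ)).le

theorem CellularityLE.mk_le {X κ : Type} [TopologicalSpace X] {μ : Cardinal.{0}}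
    (h : CellularityLE μ X) {p : X → κ} (hp : IsLocallyConstant p) (hs : Function.Surjective p) :
    #κ ≤ μ := by
  have hinj : Function.Injective fun i : κ => p ⁻¹' {i} := by
    intro i j hij
    obtain ⟨x, rfl⟩ := hs i
    have : x ∈ p ⁻¹' {j} := by
      rw [← show p ⁻¹' {p x} = p ⁻¹' {j} from hij]
      rfl
    exact this
  rw [← mk_range_eq _ hinj]
  refine h _ ?_ ?_
  · rintro _ ⟨i, rfl⟩
    exact ⟨hp.isOpen_fiber i, hs i⟩
  · rintro _ ⟨i, rfl⟩ _ ⟨j, rfl⟩ hij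
    refine disjoint_left.2 fun x hx hx' => hij ?_
    have h₁ : p x = i := hx
    have h₂ : p x = j := hx'
    rw [← h₁, ← h₂]

/-- Finite lists continued by a constant form a dense set of size κ. -/
theorem cellularityLE_sequences (κ : Type) [Infinite κ] [TopologicalSpace κ]
    [DiscreteTopology κ] : CellularityLE #κ (ℕ → κ) := by
  have i₀ : κ := Classical.arbitrary κ
  let f : List κ → ℕ → κ := fun l n => l.getD n i₀
  have hd : Dense (range f) := by
    rw [dense_iff_inter_open]
    rintro U hU ⟨x, hx⟩
    obtain ⟨n, hn⟩ := exists_cylinder_subset hU hx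
    refine ⟨f (List.ofFn fun i : Fin n => x i), hn fun i hi => ?_, mem_range_self _⟩
    simp [f, hi]
  exact cellularityLE_of_dense hd (mk_range_le.trans (by rw [mk_list_eq_mk]))

theorem CellularityLE.mk_le_of_sequences {κ : Type} [TopologicalSpace κ] [DiscreteTopology κ]
    {μ : Cardinal.{0}} (h : CellularityLE μ (ℕ → κ)) : #κ ≤ μ :=
  h.mk_le (p := fun x : ℕ → κ => x 0)
    ((IsLocallyConstant.of_discrete id).comp_continuous (continuous_apply 0))
    fun i => ⟨fun _ => i, rfl⟩

theorem CellularityLE.mk_le_of_prod {κ : Type} [TopologicalSpace κ] [DiscreteTopology κ]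
    {μ : Cardinal.{0}} (h : CellularityLE μ (κ × (ℕ → Bool))) : #κ ≤ μ :=
  h.mk_le (p := fun x => x.1)
    ((IsLocallyConstant.of_discrete id).comp_continuous continuous_fst)
    fun i => ⟨(i, fun _ => true), rfl⟩

theorem not_compactSpace_condensesOnto_prod {X : Type*} [TopologicalSpace X] [CompactSpace X] :
    ¬ CondensesOnto X (ℕ × (ℕ → Bool)) := by
  rintro ⟨f, hf, hb⟩
  have h := isCompact_range (continuous_fst.comp hf)
  rw [range_comp, hb.2.range_eq, image_univ, Prod.range_fst] at h
  exact infinite_univ (isCompact_iff_finite.1 h)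

/-- By Baire category a compact set of a countable cover would contain a cylinder, but no cylinder
is compact. -/
theorem not_sigmaCompactSpace_baire : ¬ SigmaCompactSpace (ℕ → ℕ) := by
  intro h
  obtain ⟨n, x, hx⟩ := nonempty_interior_of_iUnion_of_closed
    (fun n => (isCompact_compactCovering (ℕ → ℕ) n).isClosed) (iUnion_compactCovering (ℕ → ℕ))
  obtain ⟨m, hm⟩ := exists_cylinder_subset isOpen_interior hx
  have hcl : IsClosed (PiNat.cylinder x m) := by
    have : PiNat.cylinder x m = ⋂ i, ⋂ _ : i < m, {y : ℕ → ℕ | y i = x i} := by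
      ext y
      simp [PiNat.cylinder]
    rw [this]
    exact isClosed_iInter fun i => isClosed_iInter fun _ =>
      isClosed_eq (continuous_apply i) continuous_const
  refine nowhereCompact_sequences ℕ _ ⟨hcl, PiNat.isOpen_cylinder _ x m⟩
    ⟨x, trivial, PiNat.self_mem_cylinder x m⟩ ?_
  rw [univ_inter]
  exact (isCompact_compactCovering (ℕ → ℕ) n).of_isClosed_subset hcl
    (hm.trans interior_subset)

theorem SigmaCompactSpace.of_condensesOnto {X Y : Type*} [TopologicalSpace X]
    [TopologicalSpace Y] [SigmaCompactSpace X] (h : CondensesOnto X Y) : SigmaCompactSpace Y := by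
  obtain ⟨f, hf, hb⟩ := h
  rw [← isSigmaCompact_univ_iff, ← hb.2.range_eq]
  exact isSigmaCompact_range hf

theorem CompactSpace.nonempty_homeomorph_of_condensesOnto {X Y : Type*} [TopologicalSpace X]
    [TopologicalSpace Y] [CompactSpace X] [T2Space Y] (h : CondensesOnto X Y) :
    Nonempty (X ≃ₜ Y) := by
  obtain ⟨f, hf, hb⟩ := h
  exact ⟨Continuous.homeoOfEquivCompactToT2 (f := Equiv.ofBijective f hb) hf⟩

theorem IsCompletelyUltrametrizable.t2Space {X : Type*} [TopologicalSpace X]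
    (h : IsCompletelyUltrametrizable X) : T2Space X := by
  obtain ⟨m, rfl, -, -⟩ := h
  infer_instance

/-! ### Condensations between model spaces and arbitrary spaces -/

theorem condensesOnto_cantor {X : Type} [TopologicalSpace X] (hX : IsCompletelyUltrametrizable X)
    [PerfectSpace X] [Nonempty X] {μ : Cardinal.{0}} (hμX : CellularityLE μ X)
    (hμ : ∀ κ : Type, Infinite κ → #κ ≤ μ → HasClosedFibers (ℕ → Bool) κ) :
    CondensesOnto X (ℕ → Bool) := by
  have key : ∀ {Y : Type} [TopologicalSpace Y], IsCompletelyUltrametrizable Y → PerfectSpace Y →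
      CompactSpace Y → Nonempty Y → CondensesOnto X Y := by
    intro Y _ hY _ _ _
    obtain ⟨m, rfl, hc, hu⟩ := hX
    obtain ⟨m', rfl, hc', hu'⟩ := hY
    exact ((Homeomorph.Set.univ X).condensesOnto_symm.trans (condensesOnto_of_isCompact hμ
      (PerfectSpace.univ_perfect X) univ_nonempty (hμX.ballCountLE _)
      (PerfectSpace.univ_perfect Y) isCompact_univ univ_nonempty)).trans
      (Homeomorph.Set.univ Y).condensesOnto
  exact key (isCompletelyUltrametrizable_sequences Bool) (perfectSpace_sequences Bool)
    inferInstance inferInstance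

theorem sequences_condensesOnto_of_cellularityLE {X κ : Type} [Infinite κ] [TopologicalSpace κ]
    [DiscreteTopology κ] [TopologicalSpace X] (hX : IsCompletelyUltrametrizable X)
    [PerfectSpace X] [Nonempty X] (hκX : CellularityLE #κ X)
    (hκ : HasClosedFibers (ℕ → Bool) κ) : CondensesOnto (ℕ → κ) X := by
  obtain ⟨m, rfl, hc, hu⟩ := hX
  exact ((Homeomorph.Set.univ (ℕ → κ)).condensesOnto_symm.trans (sequences_condensesOnto
    (PerfectSpace.univ_perfect X) univ_nonempty (hκX.ballCountLE _) hκ)).trans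
    (Homeomorph.Set.univ X).condensesOnto

/-- A perfect space that splits into `κ` clopen sets condenses onto `κ × 2 ^ ω`. -/
theorem condensesOnto_prod_of_locallyConstant {X κ : Type} [TopologicalSpace κ]
    [DiscreteTopology κ] [TopologicalSpace X] (hX : IsCompletelyUltrametrizable X)
    [PerfectSpace X] {μ : Cardinal.{0}} (hμX : CellularityLE μ X)
    (hμ : ∀ κ : Type, Infinite κ → #κ ≤ μ → HasClosedFibers (ℕ → Bool) κ)
    {p : X → κ} (hp : IsLocallyConstant p) (hs : Function.Surjective p) :
    CondensesOnto X (κ × (ℕ → Bool)) := by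
  have key : ∀ {Y : Type} [TopologicalSpace Y], IsCompletelyUltrametrizable Y → PerfectSpace Y →
      CompactSpace Y → Nonempty Y → CondensesOnto X (κ × Y) := by
    intro Y _ hY _ _ _
    obtain ⟨m, rfl, hc, hu⟩ := hX
    obtain ⟨m', rfl, hc', hu'⟩ := hY
    refine (Homeomorph.Set.univ X).condensesOnto_symm.trans
      (condensesOnto_prod_of_fibers p hp fun i => ?_)
    exact (condensesOnto_of_isCompact hμ
      ((PerfectSpace.univ_perfect X).inter_isClopen (hp.isClopen_fiber i))
      (by obtain ⟨x, hx⟩ := hs i; exact ⟨x, trivial, hx⟩) (hμX.ballCountLE _)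
      (PerfectSpace.univ_perfect Y) isCompact_univ univ_nonempty).trans
      (Homeomorph.Set.univ Y).condensesOnto
  exact key (isCompletelyUltrametrizable_sequences Bool) (perfectSpace_sequences Bool)
    inferInstance inferInstance

theorem exists_locallyConstant_of_image_ball {X κ : Type} [MetricSpace X] [IsUltrametricDist X]
    [Nonempty X] {ε : ℝ} (hε : 0 < ε)
    (e : (fun x : X => ball x ε) '' Set.univ ≃ κ) :
    ∃ p : X → κ, IsLocallyConstant p ∧ Function.Surjective p := by
  obtain ⟨F, hF⟩ := exists_reindex (fun x : X => ball x ε) (univ_nonempty (α := X)) e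
  refine ⟨_, (isLocallyConstant_ball hε).comp F, fun j => ?_⟩
  obtain ⟨x, hx, h⟩ := hF j
  have : x ∈ Set.univ ∩ (F ∘ fun x => ball x ε) ⁻¹' {j} := h.symm ▸ ⟨trivial, rfl⟩
  exact ⟨x, this.2⟩

theorem exists_locallyConstant_nat {X : Type} [TopologicalSpace X]
    (hX : IsCompletelyUltrametrizable X) (hω : CellularityLE ℵ₀ X) (hc : ¬ CompactSpace X) :
    ∃ p : X → ℕ, IsLocallyConstant p ∧ Function.Surjective p := by
  obtain ⟨m, rfl, hcs, hu⟩ := hX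
  have hne : Nonempty X := by
    by_contra h
    rw [not_nonempty_iff] at h
    exact hc inferInstance
  obtain ⟨δ, hδ, -, hinf⟩ := exists_infinite_image_ball (X := X) isClosed_univ
    (fun h => hc (isCompact_univ_iff.1 h)) one_pos
  have := hinf.to_subtype
  have := (countable_image_ball (hω.ballCountLE (Set.univ : Set X)) hδ).to_subtype
  obtain ⟨e⟩ := nonempty_equiv_of_countable
    (α := (fun x : X => ball x δ) '' Set.univ) (β := ℕ)
  exact exists_locallyConstant_of_image_ball hδ e

/-- If every radius `1 / (n + 1)` had at most μ balls, any disjoint open family would inject into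
`ℵ₀ · μ = μ` balls. So some radius has more than μ balls, and since κ is the successor of μ, exactly
κ. -/
theorem exists_locallyConstant_of_cellularity {X κ : Type} [TopologicalSpace X]
    (hX : IsCompletelyUltrametrizable X) {μ : Cardinal.{0}} (hμ : ℵ₀ ≤ μ) (hκ : #κ = Order.succ μ)
    (h₁ : CellularityLE #κ X) (h₂ : ¬ CellularityLE μ X) :
    ∃ p : X → κ, IsLocallyConstant p ∧ Function.Surjective p := by
  obtain ⟨m, rfl, hcs, hu⟩ := hX
  have hne : Nonempty X := by
    by_contra h
    rw [not_nonempty_iff] at h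
    refine h₂ fun 𝒰 h₃ _ => ?_
    have : 𝒰 = ∅ := eq_empty_of_forall_notMem fun U hU => h.false (h₃ U hU).2.some
    simp [this]
  have hpos : ∀ n : ℕ, (0 : ℝ) < 1 / ((n : ℝ) + 1) := fun n => by positivity
  obtain ⟨n, hn⟩ : ∃ n : ℕ,
      μ < #((fun x : X => ball x (1 / ((n : ℝ) + 1))) '' Set.univ) := by
    by_contra! hcon
    refine h₂ fun 𝒰 h₃ h₄ => ?_
    have hsub : ∀ U : 𝒰, ∃ x : X, ∃ n : ℕ, ball x (1 / ((n : ℝ) + 1)) ⊆ U := by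
      intro U
      obtain ⟨x, hx⟩ := (h₃ U U.2).2
      obtain ⟨ε, hε, hεU⟩ := Metric.isOpen_iff.1 (h₃ U U.2).1 x hx
      obtain ⟨n, hn⟩ := exists_nat_one_div_lt hε
      exact ⟨x, n, (ball_subset_ball hn.le).trans hεU⟩
    choose x N hN using hsub
    have hcard := mk_iUnion_nat_le hμ _ hcon
    refine le_trans (mk_le_of_injective (f := fun U => (⟨ball (x U) (1 / ((N U : ℝ) + 1)),
      mem_iUnion.2 ⟨N U, mem_image_of_mem _ trivial⟩⟩ :
      ⋃ n : ℕ, (fun x : X => ball x (1 / ((n : ℝ) + 1))) '' Set.univ)) fun U V hUV =>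
      Subtype.ext ?_) hcard
    have hUV := congrArg Subtype.val hUV
    simp only at hUV
    refine h₄.elim U.2 V.2 (not_disjoint_iff.2 ⟨x U, hN U (mem_ball_self (hpos _)), hN V ?_⟩)
    rw [← hUV]
    exact mem_ball_self (hpos _)
  have hcard : #((fun x : X => ball x (1 / ((n : ℝ) + 1))) '' Set.univ) = #κ :=
    le_antisymm (h₁.ballCountLE _ _ (hpos n)) (hκ ▸ Order.succ_le_of_lt hn)
  exact exists_locallyConstant_of_image_ball (hpos n) (Cardinal.eq.1 hcard).some

theorem prod_condensesOnto_of_sigmaCompactSpace {X : Type} [TopologicalSpace X]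
    (hX : IsCompletelyUltrametrizable X) [PerfectSpace X] (hω : CellularityLE ℵ₀ X)
    (hσ : SigmaCompactSpace X) (hc : ¬ CompactSpace X) :
    CondensesOnto (ℕ × (ℕ → Bool)) X := by
  obtain ⟨m, rfl, hcs, hu⟩ := hX
  obtain ⟨q, hq⟩ := exists_compact_perfect_fibers_nat (PerfectSpace.univ_perfect X)
    isSigmaCompact_univ (fun h => hc (isCompact_univ_iff.1 h)) (hω.ballCountLE _)
  refine (prod_condensesOnto_of_fibers q fun i => ?_).trans (Homeomorph.Set.univ X).condensesOnto
  obtain ⟨e⟩ := nonempty_homeomorph_cantor_of_isCompact (hq i).1 (hq i).2.1 (hq i).2.2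
  exact e.condensesOnto_symm

/-- The given pieces may be empty or fewer than κ. Refining by coordinate `0`, which takes κ values,
yields exactly κ nonempty pieces. -/
theorem exists_isCompact_nonempty_fibers {κ : Type} [Infinite κ] [TopologicalSpace κ]
    [DiscreteTopology κ] (h : HasCompactFibers (ℕ → κ) κ) :
    ∃ q : (ℕ → κ) → κ, ∀ i, IsCompact (q ⁻¹' {i}) ∧ (q ⁻¹' {i}).Nonempty := by
  obtain ⟨g, hg⟩ := h
  let P : (ℕ → κ) → κ × κ := fun x => (x 0, g x)
  have hcard : #(P '' Set.univ) = #κ := by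
    apply le_antisymm
    · refine (mk_set_le _).trans ?_
      rw [mk_prod, Cardinal.lift_id, Cardinal.mul_eq_self (aleph0_le_mk κ)]
    · refine mk_le_of_surjective (f := fun z : P '' Set.univ => z.1.1) fun i => ?_
      exact ⟨⟨_, mem_image_of_mem P (mem_univ fun _ => i)⟩, rfl⟩
  obtain ⟨F, hF⟩ := exists_reindex P univ_nonempty (Cardinal.eq.1 hcard).some
  refine ⟨F ∘ P, fun j => ?_⟩
  obtain ⟨x, -, h⟩ := hF j
  rw [univ_inter, univ_inter] at h
  rw [h]
  refine ⟨(hg (g x)).of_isClosed_subset ?_ fun y hy => (Prod.ext_iff.1 hy).2, x, rfl⟩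
  have : P ⁻¹' {P x} = {y | y 0 = x 0} ∩ g ⁻¹' {g x} := by
    ext y
    exact Prod.ext_iff
  rw [this]
  exact (isClosed_eq (continuous_apply 0) continuous_const).inter (hg _).isClosed

theorem nonempty_homeomorph_sequences_prod (κ : Type) [Infinite κ] [TopologicalSpace κ]
    [DiscreteTopology κ] : Nonempty ((ℕ → κ) × (ℕ → Bool) ≃ₜ (ℕ → κ)) := by
  have e : Nonempty (κ × Bool ≃ κ) := Cardinal.eq.1 (by
    rw [mk_prod, Cardinal.lift_id, Cardinal.lift_id]
    refine Cardinal.mul_eq_left (aleph0_le_mk κ) ?_ (by simp)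
    exact mk_le_aleph0.trans (aleph0_le_mk κ))
  obtain ⟨e⟩ := e
  refine ⟨{ toFun := fun z n => e (z.1 n, z.2 n)
            invFun := fun x => (fun n => (e.symm (x n)).1, fun n => (e.symm (x n)).2)
            left_inv := fun z => by simp
            right_inv := fun x => by simp
            continuous_toFun := ?_
            continuous_invFun := ?_ }⟩
  · refine continuous_pi fun n => (continuous_of_discreteTopology (f := e)).comp ?_
    fun_prop
  · refine Continuous.prodMk (continuous_pi fun n => ?_) (continuous_pi fun n => ?_)
    · exact (continuous_of_discreteTopology (f := fun i => (e.symm i).1)).comp (continuous_apply n)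
    · exact (continuous_of_discreteTopology (f := fun i => (e.symm i).2)).comp (continuous_apply n)

/-- The compact pieces of `κ ^ ω` may have isolated points. Multiplied by `2 ^ ω` they become Cantor
sets, and `κ ^ ω × 2 ^ ω` is again `κ ^ ω`. -/
theorem prod_condensesOnto_sequences {κ : Type} [Infinite κ] [TopologicalSpace κ]
    [DiscreteTopology κ] (h : HasCompactFibers (ℕ → κ) κ) :
    CondensesOnto (κ × (ℕ → Bool)) (ℕ → κ) := by
  obtain ⟨q, hq⟩ := exists_isCompact_nonempty_fibers h
  obtain ⟨e⟩ := nonempty_homeomorph_sequences_prod κ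
  refine ((prod_condensesOnto_of_fibers (B := Set.univ)
    (fun z : (ℕ → κ) × (ℕ → Bool) => q z.1) fun i => ?_).trans
    (Homeomorph.Set.univ _).condensesOnto).trans e.condensesOnto
  have hset : Set.univ ∩ (fun z : (ℕ → κ) × (ℕ → Bool) => q z.1) ⁻¹' {i} =
      (q ⁻¹' {i}) ×ˢ Set.univ := by
    ext z
    simp
  rw [hset]
  have := perfectSpace_sequences Bool
  have hc : IsCompact ((q ⁻¹' {i}) ×ˢ (Set.univ : Set (ℕ → Bool))) := (hq i).1.prod isCompact_univ
  have := perfectSpace_coe_of_perfect (A := (q ⁻¹' {i}) ×ˢ (Set.univ : Set (ℕ → Bool)))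
    ⟨hc.isClosed, preperfect_prod_univ _⟩
  have := isCompact_iff_compactSpace.1 hc
  have := ((hq i).2.prod (univ_nonempty (α := ℕ → Bool))).to_subtype
  obtain ⟨e⟩ := nonempty_homeomorph_cantor ↑((q ⁻¹' {i}) ×ˢ (Set.univ : Set (ℕ → Bool)))
    (((isCompletelyUltrametrizable_sequences κ).prod
      (isCompletelyUltrametrizable_sequences Bool)).of_isClosed hc.isClosed)
  exact e.condensesOnto_symm

/-! ### Closed partitions of the Cantor space obtained from condensations -/

theorem hasClosedFibers_of_mk_range {Z J κ : Type} [TopologicalSpace Z] (g : Z → J)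
    (hg : ∀ j, IsClosed (g ⁻¹' {j})) (h : #(range g) = #κ) : HasClosedFibers Z κ := by
  obtain ⟨e⟩ := Cardinal.eq.1 h
  refine HasClosedFibers.congr ⟨rangeFactorization g, rangeFactorization_surjective, ?_⟩ e
  rintro ⟨_, z, rfl⟩
  have : rangeFactorization g ⁻¹' {⟨g z, z, rfl⟩} = g ⁻¹' {g z} := by
    ext y
    exact Subtype.ext_iff
  rw [this]
  exact hg _

theorem HasCompactFibers.of_isClosedEmbedding {Z W κ : Type*} [TopologicalSpace Z]
    [TopologicalSpace W] (h : HasCompactFibers W κ) {f : Z → W} (hf : IsClosedEmbedding f) :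
    HasCompactFibers Z κ := by
  obtain ⟨g, hg⟩ := h
  exact ⟨g ∘ f, fun i => hf.isCompact_preimage (hg i)⟩

theorem isClosedEmbedding_comp_left {ι κ : Type*} [Nonempty ι] [TopologicalSpace ι]
    [DiscreteTopology ι] [TopologicalSpace κ] [DiscreteTopology κ] {φ : ι → κ}
    (hφ : Function.Injective φ) : IsClosedEmbedding fun (x : ℕ → ι) n => φ (x n) := by
  have h₁ : Continuous fun (x : ℕ → ι) n => φ (x n) :=
    continuous_pi fun n => continuous_of_discreteTopology.comp (continuous_apply n)
  have h₂ : Continuous fun (y : ℕ → κ) n => Function.invFun φ (y n) :=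
    continuous_pi fun n => (continuous_of_discreteTopology (f := Function.invFun φ)).comp
      (continuous_apply n)
  have h₃ : Function.LeftInverse (fun (y : ℕ → κ) n => Function.invFun φ (y n))
      fun (x : ℕ → ι) n => φ (x n) :=
    fun x => funext fun n => Function.leftInverse_invFun hφ (x n)
  exact h₃.isClosedEmbedding h₂ h₁

/-- A condensation of `ω ^ ω` onto `2 ^ ω` carries the compact pieces to closed ones. Countably many
would make `ω ^ ω` σ-compact, so `#κ = ℵ₁` forces exactly κ nonempty pieces. -/
theorem hasClosedFibers_of_hasCompactFibers_baire {κ : Type} (hκ : #κ = Order.succ ℵ₀)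
    (h : HasCompactFibers (ℕ → ℕ) κ) : HasClosedFibers (ℕ → Bool) κ := by
  have := perfectSpace_sequences ℕ
  have hcond : CondensesOnto (ℕ → ℕ) (ℕ → Bool) :=
    condensesOnto_cantor (isCompletelyUltrametrizable_sequences ℕ)
      (cellularityLE_of_separableSpace _) fun κ _ hκ =>
        have : Countable κ := mk_le_aleph0_iff.1 hκ
        hasClosedFibers_of_countable κ
  obtain ⟨g, hg⟩ := h
  obtain ⟨f, hf, hb⟩ := hcond
  let e := Equiv.ofBijective f hb
  refine hasClosedFibers_of_mk_range (g ∘ e.symm) (fun j => ?_) (le_antisymm (mk_set_le _) ?_)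
  · have : g ∘ e.symm ⁻¹' {j} = f '' (g ⁻¹' {j}) := by
      rw [preimage_comp]
      exact (e.image_eq_preimage_symm _).symm
    rw [this]
    exact ((hg j).image hf).isClosed
  · rw [e.symm.surjective.range_comp, hκ, Order.succ_le_iff]
    by_contra! hle
    have hcount : (range g).Countable := mk_le_aleph0_iff.1 hle
    refine not_sigmaCompactSpace_baire (isSigmaCompact_univ_iff.1 ?_)
    have : (Set.univ : Set (ℕ → ℕ)) = ⋃ j ∈ range g, g ⁻¹' {j} := by
      refine (eq_univ_of_forall fun x => ?_).symm
      exact mem_biUnion (mem_range_self x) rfl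
    rw [this]
    exact isSigmaCompact_biUnion hcount fun j _ => (hg j).isSigmaCompact

/-- The preimage `U` of one slice `{i₀} × 2 ^ ω` is clopen, hence contains a cylinder, and some
coordinate `m` takes κ values on it. Refining the compact partition of `U` by coordinate `m` and
pushing it to the slice gives κ closed sets. -/
theorem hasClosedFibers_of_sequences_condensesOnto {κ : Type} [Infinite κ] [TopologicalSpace κ]
    [DiscreteTopology κ] (h : HasCompactFibers (ℕ → κ) κ)
    (hc : CondensesOnto (ℕ → κ) (κ × (ℕ → Bool))) : HasClosedFibers (ℕ → Bool) κ := by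
  obtain ⟨g, hg⟩ := h
  obtain ⟨f, hf, hb⟩ := hc
  let i₀ : κ := Classical.arbitrary κ
  let e := Equiv.ofBijective f hb
  let U : Set (ℕ → κ) := {y | (f y).1 = i₀}
  have hU : IsClopen U := (isClopen_discrete {i₀}).preimage (continuous_fst.comp hf)
  have hef : ∀ y, e.symm (f y) = y := e.symm_apply_apply
  obtain ⟨m, hm⟩ := exists_cylinder_subset (x := e.symm (i₀, fun _ => true)) hU.isOpen (by
    change (e (e.symm (i₀, fun _ => true))).1 = i₀
    rw [e.apply_symm_apply])
  let y : (ℕ → Bool) → ℕ → κ := fun z => e.symm (i₀, z)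
  have hfy : ∀ z, f (y z) = (i₀, z) := fun z => e.apply_symm_apply _
  have hyU : ∀ x ∈ U, y (f x).2 = x := by
    intro x hx
    have : (i₀, (f x).2) = f x := Prod.ext (show i₀ = (f x).1 from Eq.symm hx) rfl
    simp only [y, this, hef]
  refine hasClosedFibers_of_mk_range (fun z => (y z m, g (y z))) ?_ (le_antisymm ?_ ?_)
  · rintro ⟨a, b⟩
    have himg : (fun z => (y z m, g (y z))) ⁻¹' {(a, b)} =
        (fun x => (f x).2) '' (g ⁻¹' {b} ∩ (U ∩ {x | x m = a})) := by
      ext z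
      simp only [mem_preimage, mem_singleton_iff, Prod.mk.injEq, mem_image, mem_inter_iff,
        mem_ofPred_eq]
      constructor
      · rintro ⟨h₁, h₂⟩
        exact ⟨y z, ⟨h₂, congrArg Prod.fst (hfy z), h₁⟩, congrArg Prod.snd (hfy z)⟩
      · rintro ⟨x, ⟨h₁, h₂, h₃⟩, rfl⟩
        rw [hyU x h₂]
        exact ⟨h₃, h₁⟩
    rw [himg]
    refine IsCompact.isClosed (IsCompact.image ?_ (continuous_snd.comp hf))
    exact (hg b).inter_right (hU.isClosed.inter (isClosed_eq (continuous_apply m)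
      continuous_const))
  · refine (mk_set_le _).trans ?_
    rw [mk_prod, Cardinal.lift_id, Cardinal.mul_eq_self (aleph0_le_mk κ)]
  · refine mk_le_of_surjective (f := fun w : range fun z => (y z m, g (y z)) => w.1.1) fun a => ?_
    have hx := hm (PiNat.update_mem_cylinder _ m a)
    refine ⟨⟨_, mem_range_self (f (Function.update (e.symm (i₀, fun _ => true)) m a)).2⟩, ?_⟩
    simp only [hyU _ hx, Function.update_self]

theorem hasCompactFibers_prod (κ : Type) [TopologicalSpace κ] [DiscreteTopology κ] :
    HasCompactFibers (κ × (ℕ → Bool)) κ := by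
  refine ⟨Prod.fst, fun i => ?_⟩
  have : Prod.fst ⁻¹' {i} = ({i} : Set κ) ×ˢ (Set.univ : Set (ℕ → Bool)) := by
    ext z
    simp
  rw [this]
  exact isCompact_singleton.prod isCompact_univ

theorem hasClosedFibers_of_prod_condensesOnto {κ : Type} [TopologicalSpace κ]
    [DiscreteTopology κ] (h : CondensesOnto (κ × (ℕ → Bool)) (ℕ → Bool)) :
    HasClosedFibers (ℕ → Bool) κ := by
  obtain ⟨f, hf, hb⟩ := h
  let e := Equiv.ofBijective f hb
  refine ⟨fun z => (e.symm z).1, fun i => ⟨f (i, fun _ => true), ?_⟩, fun i => ?_⟩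
  · change (e.symm (e _)).1 = i
    rw [e.symm_apply_apply]
  · have : (fun z => (e.symm z).1) ⁻¹' {i} = f '' (({i} : Set κ) ×ˢ Set.univ) := by
      rw [show f '' _ = e '' _ from rfl, e.image_eq_preimage_symm]
      ext z
      simp
    rw [this]
    exact ((isCompact_singleton.prod isCompact_univ).image hf).isClosed

theorem hasClosedFibers_fin (m : ℕ) : HasClosedFibers (ℕ → Bool) (Fin (m + 1)) := by
  -- Since `m + 1 ≤ 2 ^ m`, the first `m` coordinates suffice to distinguish the classes.
  have hcard : Fintype.card (Fin (m + 1)) ≤ Fintype.card (Fin m → Bool) := by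
    simpa using Nat.lt_two_pow_self
  obtain ⟨φ⟩ := Function.Embedding.nonempty_of_card_le hcard
  have hs := Function.invFun_surjective φ.injective
  refine ⟨fun x => Function.invFun φ fun i : Fin m => x i, fun i => ?_, fun i => ?_⟩
  · obtain ⟨s, hs⟩ := hs i
    refine ⟨fun n => if h : n < m then s ⟨n, h⟩ else true, ?_⟩
    rw [← hs]
    refine congrArg (Function.invFun φ) (funext fun k => ?_)
    simp
  · exact (isClosed_discrete {s | Function.invFun φ s = i}).preimage
      (f := fun (x : ℕ → Bool) (k : Fin m) => x k) (by fun_prop)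

theorem hasClosedPartition_iff (Z : Type) [TopologicalSpace Z] (κ : Type) :
    HasClosedPartition Z #κ ↔ HasClosedFibers Z κ := by
  constructor
  · rintro ⟨P, ⟨h₀, hP⟩, hc, hcard⟩
    choose b hb hb' using hP
    simp only at hb hb'
    obtain ⟨e⟩ := Cardinal.eq.1 hcard
    refine HasClosedFibers.congr (κ := P) ⟨fun z => ⟨b z, (hb z).1⟩, ?_, ?_⟩ e
    · rintro ⟨C, hC⟩
      obtain ⟨z, hz⟩ := nonempty_iff_ne_empty.2 fun h => h₀ (h ▸ hC)
      exact ⟨z, Subtype.ext (hb' z C ⟨hC, hz⟩).symm⟩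
    · rintro ⟨C, hC⟩
      convert hc C hC
      ext z
      simp only [mem_preimage, mem_singleton_iff, Subtype.mk.injEq]
      exact ⟨fun h => h ▸ (hb z).2, fun h => (hb' z C ⟨hC, h⟩).symm⟩
  · rintro ⟨g, hg, hc⟩
    have hinj : Function.Injective fun i => g ⁻¹' {i} := by
      intro i j hij
      obtain ⟨z, rfl⟩ := hg i
      have : z ∈ g ⁻¹' {j} := by
        rw [← show g ⁻¹' {g z} = g ⁻¹' {j} from hij]
        rfl
      exact this
    refine ⟨range fun i => g ⁻¹' {i}, ⟨?_, fun z => ⟨g ⁻¹' {g z}, ⟨⟨_, rfl⟩, rfl⟩, ?_⟩⟩, ?_,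
      mk_range_eq _ hinj⟩
    · rintro ⟨i, hi⟩
      obtain ⟨z, hz⟩ := hg i
      have : z ∈ g ⁻¹' {i} := hz
      rw [show g ⁻¹' {i} = ∅ from hi] at this
      exact this
    · rintro _ ⟨⟨i, rfl⟩, hz⟩
      have hz : g z = i := hz
      rw [← hz]
    · rintro _ ⟨i, rfl⟩
      exact hc i

/-! ### Discrete well-orders of cardinality `ℵ_k` -/

/-- A discrete well-ordered space of cardinality `ℵ_k`. -/
def AlephType (k : ℕ) : Type := (aleph (k : Ordinal.{0})).ord.ToType

noncomputable instance (k : ℕ) : LinearOrder (AlephType k) :=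
  inferInstanceAs (LinearOrder (aleph (k : Ordinal.{0})).ord.ToType)

instance (k : ℕ) : WellFoundedLT (AlephType k) :=
  inferInstanceAs (WellFoundedLT (aleph (k : Ordinal.{0})).ord.ToType)

instance (k : ℕ) : TopologicalSpace (AlephType k) := ⊥

instance (k : ℕ) : DiscreteTopology (AlephType k) := ⟨rfl⟩

theorem mk_alephType (k : ℕ) : #(AlephType k) = aleph (k : Ordinal.{0}) :=
  mk_ord_toType _

theorem aleph_natCast_succ (k : ℕ) :
    aleph ((k + 1 : ℕ) : Ordinal.{0}) = Order.succ (aleph (k : Ordinal.{0})) := by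
  rw [succ_aleph, Nat.cast_succ]

theorem aleph_natCast_le_iff {k m : ℕ} :
    aleph (k : Ordinal.{0}) ≤ aleph (m : Ordinal.{0}) ↔ k ≤ m := by
  rw [aleph_le_aleph, Nat.cast_le]

instance (k : ℕ) : Infinite (AlephType k) := by
  rw [← aleph0_le_mk_iff, mk_alephType]
  exact aleph0_le_aleph _

theorem mk_Iio_alephType_succ (k : ℕ) (a : AlephType (k + 1)) :
    #(Iio a) ≤ aleph (k : Ordinal.{0}) := by
  have h : #(Iio a) < #(AlephType (k + 1)) :=
    mk_Iio_lt a (by rw [mk_alephType]; exact (Ordinal.type_toType _).symm)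
  rw [mk_alephType, aleph_natCast_succ] at h
  exact Order.lt_succ_iff.1 h

/-- The base case lifts the partition of `ω ^ ω` into `ℵ₁` compact sets to `ω₁ ^ ω`. Each further
step absorbs the product index set, because the square of an infinite cardinal is itself. -/
theorem hasCompactFibers_alephType (h : HasClosedFibers (ℕ → Bool) (AlephType 1)) (k : ℕ) :
    HasCompactFibers (ℕ → AlephType (k + 1)) (AlephType (k + 1)) := by
  have hsq : ∀ m l : ℕ, l ≤ m → ∃ f : AlephType m × AlephType l → AlephType m,
      Function.Injective f := by
    intro m l hlm
    obtain ⟨f⟩ : #(AlephType m × AlephType l) ≤ #(AlephType m) := by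
      rw [mk_prod, Cardinal.lift_id, Cardinal.lift_id]
      refine (Cardinal.mul_eq_left (aleph0_le_mk _) ?_ (mk_ne_zero _)).le
      rw [mk_alephType, mk_alephType]
      exact aleph_natCast_le_iff.2 hlm
    exact ⟨f, f.injective⟩
  induction k with
  | zero =>
    have h1 : #(AlephType 1) = Order.succ ℵ₀ := by
      rw [mk_alephType, aleph_natCast_succ, Nat.cast_zero, aleph_zero]
    have : Uncountable (AlephType 1) := by
      rw [← aleph0_lt_mk_iff, h1]
      exact Order.lt_succ _
    obtain ⟨f, hf⟩ := hsq 1 1 le_rfl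
    refine HasCompactFibers.of_injective
      ((hasCompactFibers_baire h).succ (L := AlephType 1) (fun a => ?_) ?_) hf
    · rw [mk_nat, ← aleph_zero]
      simpa using mk_Iio_alephType_succ 0 a
    · rw [mk_nat, h1]
      exact Order.lt_succ _
  | succ k ih =>
    obtain ⟨f, hf⟩ := hsq (k + 2) (k + 1) (Nat.le_succ _)
    refine HasCompactFibers.of_injective (ih.succ (L := AlephType (k + 2)) (fun a => ?_) ?_) hf
    · rw [mk_alephType]
      exact mk_Iio_alephType_succ (k + 1) a
    · rw [mk_alephType, mk_alephType, aleph_natCast_succ (k + 1)]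
      exact Order.lt_succ _

/-! ### Similarity -/

/-- Each of the two spaces is a condensation of the other. -/
def SimilarSpaces (X Y : Type*) [TopologicalSpace X] [TopologicalSpace Y] : Prop :=
  CondensesOnto X Y ∧ CondensesOnto Y X

theorem prod_condensesOnto_of_cellularityLE {X : Type} [TopologicalSpace X]
    (hX : IsCompletelyUltrametrizable X) [PerfectSpace X] [Nonempty X] {k : ℕ}
    (h1 : HasClosedFibers (ℕ → Bool) (AlephType 1))
    (hk : HasClosedFibers (ℕ → Bool) (AlephType (k + 1)))
    (hkX : CellularityLE #(AlephType (k + 1)) X) :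
    CondensesOnto (AlephType (k + 1) × (ℕ → Bool)) X :=
  (prod_condensesOnto_sequences (hasCompactFibers_alephType h1 k)).trans
    (sequences_condensesOnto_of_cellularityLE hX hkX hk)

/-- The least `k` for which `ℵ_k` bounds the cellularity selects the model. For `k = 0`, compactness
and σ-compactness decide among three. -/
theorem similar_of_hasClosedFibers {X : Type} [TopologicalSpace X]
    (hX : IsCompletelyUltrametrizable X) [PerfectSpace X] [Nonempty X] {n : ℕ}
    (hμ : ∀ κ : Type, Infinite κ → #κ ≤ aleph (n : Ordinal.{0}) → HasClosedFibers (ℕ → Bool) κ)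
    (hn : CellularityLE (aleph (n : Ordinal.{0})) X) :
    SimilarSpaces X (ℕ → Bool) ∨ SimilarSpaces X (ℕ × (ℕ → Bool)) ∨ SimilarSpaces X (ℕ → ℕ) ∨
      ∃ k < n, SimilarSpaces X (AlephType (k + 1) × (ℕ → Bool)) := by
  classical
  have hex : ∃ k : ℕ, CellularityLE (aleph (k : Ordinal.{0})) X := ⟨n, hn⟩
  have hmin : Nat.find hex ≤ n := Nat.find_le hn
  rcases hfind : Nat.find hex with _ | k
  · have hω : CellularityLE ℵ₀ X := by
      have := Nat.find_spec hex
      rw [hfind, Nat.cast_zero, aleph_zero] at this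
      exact this
    by_cases hc : CompactSpace X
    · obtain ⟨e⟩ := nonempty_homeomorph_cantor X hX
      exact Or.inl ⟨e.condensesOnto, e.condensesOnto_symm⟩
    · by_cases hσ : SigmaCompactSpace X
      · obtain ⟨p, hp, hs⟩ := exists_locallyConstant_nat hX hω hc
        exact Or.inr (Or.inl ⟨condensesOnto_prod_of_locallyConstant hX hn hμ hp hs,
          prod_condensesOnto_of_sigmaCompactSpace hX hω hσ hc⟩)
      · refine Or.inr (Or.inr (Or.inl ⟨condensesOnto_baire_of_not_sigmaCompactSpace hX hω hσ,
          sequences_condensesOnto_of_cellularityLE hX (by rwa [mk_nat])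
            (hasClosedFibers_of_countable ℕ)⟩))
  · have hkn : k < n := by omega
    have h₁ : CellularityLE #(AlephType (k + 1)) X := by
      have := Nat.find_spec hex
      rw [hfind] at this
      rwa [mk_alephType]
    have h₂ : ¬ CellularityLE (aleph (k : Ordinal.{0})) X := Nat.find_min hex (by omega)
    obtain ⟨p, hp, hs⟩ := exists_locallyConstant_of_cellularity hX (aleph0_le_aleph _)
      ((mk_alephType _).trans (aleph_natCast_succ k)) h₁ h₂
    have hcf : ∀ m < n, HasClosedFibers (ℕ → Bool) (AlephType (m + 1)) := fun m hm =>
      hμ _ inferInstance (by rw [mk_alephType]; exact aleph_natCast_le_iff.2 hm)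
    exact Or.inr (Or.inr (Or.inr ⟨k, hkn, condensesOnto_prod_of_locallyConstant hX hn hμ hp hs,
      prod_condensesOnto_of_cellularityLE hX (hcf 0 (by omega)) (hcf k hkn) h₁⟩))

/-- If the Cantor space is not a disjoint union of `ℵ_{k + 1}` closed sets for some `k < n`, then
for some such `k` the spaces `ω_{k + 1} ^ ω` and `ω_{k + 1} × 2 ^ ω` are not similar. -/
theorem exists_not_similar {n : ℕ}
    (h : ∃ k < n, ¬ HasClosedFibers (ℕ → Bool) (AlephType (k + 1))) :
    ∃ k < n, ¬ SimilarSpaces (ℕ → AlephType (k + 1)) (AlephType (k + 1) × (ℕ → Bool)) := by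
  obtain ⟨k, hk, hnk⟩ := h
  -- A partition into `ℵ₁` closed sets is what provides compact partitions of all the spaces
  -- `ω_{k+1} ^ ω`. If it is missing, the index `0` fails instead: similarity would give a compact
  -- partition of `ω₁ ^ ω`, which restricts to the closed copy of `ω ^ ω`.
  by_cases h1 : HasClosedFibers (ℕ → Bool) (AlephType 1)
  · exact ⟨k, hk, fun hs => hnk (hasClosedFibers_of_sequences_condensesOnto
      (hasCompactFibers_alephType h1 k) hs.1)⟩
  · refine ⟨0, by omega, fun hs => h1 ?_⟩
    obtain ⟨φ⟩ : #ℕ ≤ #(AlephType 1) := by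
      rw [mk_nat]
      exact aleph0_le_mk _
    refine hasClosedFibers_of_hasCompactFibers_baire ?_
      (((hasCompactFibers_prod (AlephType 1)).of_condensesOnto hs.2).of_isClosedEmbedding
        (isClosedEmbedding_comp_left φ.injective))
    rw [mk_alephType, aleph_natCast_succ, Nat.cast_zero, aleph_zero]

/-! ### PCU spaces -/

theorem exists_pcuSpace_homeomorph {Z : Type} [TopologicalSpace Z] (hp : PerfectSpace Z)
    (hZ : IsCompletelyUltrametrizable Z) (hc : #Z = 𝔠) :
    ∃ P : PCUSpace.{u}, Nonempty (P.carrier ≃ₜ Z) :=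
  ⟨{ carrier := ULift.{u} Z
     perfect := perfectSpace_of_homeomorph hp Homeomorph.ulift.symm
     completelyUltrametrizable := hZ.of_homeomorph Homeomorph.ulift
     card_eq := by rw [mk_uLift, hc, lift_continuum] }, ⟨Homeomorph.ulift⟩⟩

/-- A carrier of size `𝔠` can be transported to the underlying set of `2 ^ ω`, which brings spaces
of any universe within reach of the results stated in `Type`. -/
theorem PCUSpace.exists_homeomorph (P : PCUSpace.{u}) :
    ∃ (Z : Type) (_ : TopologicalSpace Z), PerfectSpace Z ∧ IsCompletelyUltrametrizable Z ∧
      #Z = 𝔠 ∧ Nonempty (P.carrier ≃ₜ Z) := by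
  have h : Nonempty (P.carrier ≃ (ℕ → Bool)) := by
    rw [← Cardinal.lift_mk_eq', P.card_eq]
    simp
  obtain ⟨e⟩ := h
  let t : TopologicalSpace (ℕ → Bool) := TopologicalSpace.induced e.symm P.top
  let e' : @Homeomorph P.carrier (ℕ → Bool) P.top t :=
    (@Equiv.toHomeomorphOfIsInducing _ _ t P.top e.symm ⟨rfl⟩).symm
  refine ⟨ℕ → Bool, t, ?_, ?_, by simp, ⟨e'⟩⟩
  · exact @perfectSpace_of_homeomorph _ _ _ t P.perfect e'
  · exact @IsCompletelyUltrametrizable.of_homeomorph _ _ _ t P.completelyUltrametrizable e'.symm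

/-! ### The model spaces -/

/-- The model spaces `2 ^ ω`, `ω × 2 ^ ω`, `ω ^ ω`, `ω₁ × 2 ^ ω`, `ω₂ × 2 ^ ω`, … -/
def ModelSpace : ℕ → Type
  | 0 => ℕ → Bool
  | 1 => ℕ × (ℕ → Bool)
  | 2 => ℕ → ℕ
  | k + 3 => AlephType (k + 1) × (ℕ → Bool)

instance : ∀ k, TopologicalSpace (ModelSpace k)
  | 0 => inferInstanceAs (TopologicalSpace (ℕ → Bool))
  | 1 => inferInstanceAs (TopologicalSpace (ℕ × (ℕ → Bool)))
  | 2 => inferInstanceAs (TopologicalSpace (ℕ → ℕ))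
  | k + 3 => inferInstanceAs (TopologicalSpace (AlephType (k + 1) × (ℕ → Bool)))

theorem isCompletelyUltrametrizable_discrete_prod (κ : Type) [TopologicalSpace κ]
    [DiscreteTopology κ] : IsCompletelyUltrametrizable (κ × (ℕ → Bool)) :=
  (isCompletelyUltrametrizable_of_discrete κ).prod (isCompletelyUltrametrizable_sequences Bool)

theorem perfectSpace_discrete_prod (κ : Type) [TopologicalSpace κ] :
    PerfectSpace (κ × (ℕ → Bool)) :=
  have := perfectSpace_sequences Bool
  perfectSpace_prod κ (ℕ → Bool)

theorem mk_prod_cantor {κ : Type} [Nonempty κ] (h : #κ ≤ 𝔠) : #(κ × (ℕ → Bool)) = 𝔠 := by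
  rw [mk_prod, Cardinal.lift_id, Cardinal.lift_id, show #(ℕ → Bool) = 𝔠 by simp]
  exact Cardinal.mul_eq_right aleph0_le_continuum h (mk_ne_zero κ)

theorem mk_sequences {κ : Type} [Nontrivial κ] (h : #κ ≤ 𝔠) : #(ℕ → κ) = 𝔠 := by
  rw [← Cardinal.power_def, mk_nat]
  refine le_antisymm ((Cardinal.power_le_power_right h).trans continuum_power_aleph0.le) ?_
  rw [← two_power_aleph0]
  exact Cardinal.power_le_power_right (two_le_iff.2 (exists_pair_ne κ))

theorem isCompletelyUltrametrizable_modelSpace :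
    ∀ k, IsCompletelyUltrametrizable (ModelSpace k)
  | 0 => isCompletelyUltrametrizable_sequences Bool
  | 1 => isCompletelyUltrametrizable_discrete_prod ℕ
  | 2 => isCompletelyUltrametrizable_sequences ℕ
  | k + 3 => isCompletelyUltrametrizable_discrete_prod (AlephType (k + 1))

instance perfectSpace_modelSpace : ∀ k, PerfectSpace (ModelSpace k)
  | 0 => perfectSpace_sequences Bool
  | 1 => perfectSpace_discrete_prod ℕ
  | 2 => perfectSpace_sequences ℕ
  | k + 3 => perfectSpace_discrete_prod (AlephType (k + 1))

instance nonempty_modelSpace : ∀ k, Nonempty (ModelSpace k)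
  | 0 => inferInstanceAs (Nonempty (ℕ → Bool))
  | 1 => inferInstanceAs (Nonempty (ℕ × (ℕ → Bool)))
  | 2 => inferInstanceAs (Nonempty (ℕ → ℕ))
  | k + 3 => inferInstanceAs (Nonempty (AlephType (k + 1) × (ℕ → Bool)))

theorem mk_alephType_le_continuum {n k : ℕ} (hc : 𝔠 = aleph (n : Ordinal.{0})) (hk : k < n) :
    #(AlephType (k + 1)) ≤ 𝔠 := by
  rw [mk_alephType, hc]
  exact aleph_natCast_le_iff.2 hk

theorem mk_modelSpace {n : ℕ} (hc : 𝔠 = aleph (n : Ordinal.{0})) :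
    ∀ k < n + 3, #(ModelSpace k) = 𝔠
  | 0, _ => by simp [ModelSpace]
  | 1, _ => mk_prod_cantor (mk_nat.trans_le aleph0_le_continuum)
  | 2, _ => mk_sequences (mk_nat.trans_le aleph0_le_continuum)
  | _ + 3, hk => mk_prod_cantor (mk_alephType_le_continuum hc (by omega))

/-- Truncated subtraction gives the three separable models the bound `ℵ₀`, and the model `k + 3` the
bound `ℵ_{k+1}`. -/
theorem cellularityLE_modelSpace :
    ∀ k, CellularityLE (aleph ((k - 2 : ℕ) : Ordinal.{0})) (ModelSpace k)
  | 0 => (cellularityLE_of_separableSpace (ℕ → Bool)).mono (aleph0_le_aleph _)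
  | 1 => (cellularityLE_of_separableSpace (ℕ × (ℕ → Bool))).mono (aleph0_le_aleph _)
  | 2 => (cellularityLE_of_separableSpace (ℕ → ℕ)).mono (aleph0_le_aleph _)
  | k + 3 => (cellularityLE_prod (AlephType (k + 1))).mono (mk_alephType _).le

theorem le_of_cellularityLE_modelSpace {k m : ℕ}
    (h : CellularityLE (aleph (m : Ordinal.{0})) (ModelSpace (k + 3))) : k + 1 ≤ m := by
  have := CellularityLE.mk_le_of_prod (κ := AlephType (k + 1)) h
  rw [mk_alephType] at this
  exact aleph_natCast_le_iff.1 this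

/-- Compactness, σ-compactness and cellularity bounds all pass to condensations, and each later
model violates one that the earlier models satisfy. -/
theorem not_modelSpace_condensesOnto :
    ∀ {i j : ℕ}, i < j → ¬ CondensesOnto (ModelSpace i) (ModelSpace j)
  | _, 0, hij => absurd hij (by omega)
  | i + 1, 1, hij => absurd hij (by omega)
  | i + 2, 2, hij => absurd hij (by omega)
  | 0, 1, _ => not_compactSpace_condensesOnto_prod (X := ℕ → Bool)
  | 0, 2, _ => fun h => not_sigmaCompactSpace_baire
    (SigmaCompactSpace.of_condensesOnto (X := ℕ → Bool) h)
  | 1, 2, _ => fun h => not_sigmaCompactSpace_baire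
    (SigmaCompactSpace.of_condensesOnto (X := ℕ × (ℕ → Bool)) h)
  | i, k + 3, hij => fun h => by
    have := le_of_cellularityLE_modelSpace ((cellularityLE_modelSpace i).of_condensesOnto h)
    omega

theorem modelSpace_condensesOnto {n : ℕ}
    (hμ : ∀ κ : Type, Infinite κ → #κ ≤ aleph (n : Ordinal.{0}) → HasClosedFibers (ℕ → Bool) κ) :
    ∀ {i j : ℕ}, i ≤ j → j < n + 3 → CondensesOnto (ModelSpace j) (ModelSpace i) := by
  have hcell : ∀ j < n + 3, CellularityLE (aleph (n : Ordinal.{0})) (ModelSpace j) := fun j hj =>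
    (cellularityLE_modelSpace j).mono (aleph_natCast_le_iff.2 (by omega))
  have hcf : ∀ m < n, HasClosedFibers (ℕ → Bool) (AlephType (m + 1)) := fun m hm =>
    hμ _ inferInstance (by rw [mk_alephType]; exact aleph_natCast_le_iff.2 hm)
  intro i j hij hj
  rcases hij.eq_or_lt with rfl | hlt
  · exact ⟨id, continuous_id, Function.bijective_id⟩
  match i, j with
  | i + 1, 0 | i + 1, 1 | i + 2, 2 => omega
  | 0, j => exact condensesOnto_cantor (isCompletelyUltrametrizable_modelSpace j) (hcell j hj) hμ
  | 1, 2 =>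
    have := perfectSpace_sequences ℕ
    obtain ⟨p, hp, hs⟩ := exists_locallyConstant_nat (isCompletelyUltrametrizable_sequences ℕ)
      (cellularityLE_of_separableSpace _)
      (fun h => not_sigmaCompactSpace_baire inferInstance)
    exact condensesOnto_prod_of_locallyConstant (isCompletelyUltrametrizable_sequences ℕ)
      (hcell 2 hj) hμ hp hs
  | i, k + 3 =>
    refine prod_condensesOnto_of_cellularityLE (isCompletelyUltrametrizable_modelSpace i)
      (hcf 0 (by omega)) (hcf k (by omega)) ((cellularityLE_modelSpace i).mono ?_)
    rw [mk_alephType]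
    exact aleph_natCast_le_iff.2 (by omega)

theorem exists_similar_modelSpace {X : Type} [TopologicalSpace X]
    (hX : IsCompletelyUltrametrizable X) [PerfectSpace X] [Nonempty X] {n : ℕ}
    (hμ : ∀ κ : Type, Infinite κ → #κ ≤ aleph (n : Ordinal.{0}) → HasClosedFibers (ℕ → Bool) κ)
    (hn : CellularityLE (aleph (n : Ordinal.{0})) X) :
    ∃ k < n + 3, SimilarSpaces X (ModelSpace k) := by
  rcases similar_of_hasClosedFibers hX hμ hn with h | h | h | ⟨k, hk, h⟩
  · exact ⟨0, by omega, h⟩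
  · exact ⟨1, by omega, h⟩
  · exact ⟨2, by omega, h⟩
  · exact ⟨k + 3, by omega, h⟩

/-- If `ω_{k + 1} ^ ω` is not similar to `ω_{k + 1} × 2 ^ ω`, then it is not similar to any model
space. -/
theorem not_similar_modelSpace {k : ℕ}
    (h : ¬ SimilarSpaces (ℕ → AlephType (k + 1)) (AlephType (k + 1) × (ℕ → Bool))) (i : ℕ) :
    ¬ SimilarSpaces (ℕ → AlephType (k + 1)) (ModelSpace i) := by
  intro hs
  -- Comparing cellularities in both directions leaves only the model with the same aleph, which is
  -- excluded by hypothesis.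
  have h₁ := ((cellularityLE_modelSpace i).of_condensesOnto hs.2).mk_le_of_sequences
  rw [mk_alephType, aleph_natCast_le_iff] at h₁
  obtain ⟨i, rfl⟩ : ∃ m, i = m + 3 := ⟨i - 3, by omega⟩
  have h₂ := (cellularityLE_sequences (AlephType (k + 1))).of_condensesOnto hs.1
  rw [mk_alephType] at h₂
  have := le_of_cellularityLE_modelSpace h₂
  obtain rfl : i = k := by omega
  exact h hs

/-! ### The main theorem -/

theorem PCUSpace.le_iff_of_homeomorph {P Q : PCUSpace.{u}} {X Y : Type*} [TopologicalSpace X]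
    [TopologicalSpace Y] (e : P.carrier ≃ₜ X) (e' : Q.carrier ≃ₜ Y) :
    P ≤ Q ↔ CondensesOnto Y X :=
  ⟨fun h => (e'.condensesOnto_symm.trans h).trans e.condensesOnto,
    fun h => (e'.condensesOnto.trans h).trans e.condensesOnto_symm⟩

theorem hasClosedPartition_of_le {n : ℕ}
    (h : ∀ k < n, HasClosedFibers (ℕ → Bool) (AlephType (k + 1))) {κ : Cardinal.{0}} (h₀ : κ ≠ 0)
    (hκ : κ ≤ aleph (n : Ordinal.{0})) : HasClosedPartition (ℕ → Bool) κ := by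
  rcases lt_or_ge κ ℵ₀ with hfin | hinf
  · obtain ⟨m, rfl⟩ := lt_aleph0.1 hfin
    obtain ⟨m, rfl⟩ := Nat.exists_eq_succ_of_ne_zero (by simpa using h₀ : m ≠ 0)
    rw [← mk_fin]
    exact (hasClosedPartition_iff _ _).2 (hasClosedFibers_fin m)
  · obtain ⟨o, rfl⟩ := mem_range_aleph_iff.2 hinf
    rw [aleph_le_aleph] at hκ
    obtain ⟨k, rfl⟩ := Ordinal.lt_omega0.1 (hκ.trans_lt (Ordinal.natCast_lt_omega0 n))
    rw [Nat.cast_le] at hκ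
    rcases k with _ | k
    · rw [Nat.cast_zero, aleph_zero, ← mk_nat]
      exact (hasClosedPartition_iff _ _).2 (hasClosedFibers_of_countable ℕ)
    · rw [← mk_alephType]
      exact (hasClosedPartition_iff _ _).2 (h k hκ)

theorem exists_modelPCUSpace {n : ℕ} (hc : 𝔠 = aleph (n : Ordinal.{0})) (i : Fin (n + 3)) :
    ∃ P : PCUSpace.{u}, Nonempty (P.carrier ≃ₜ ModelSpace i) :=
  exists_pcuSpace_homeomorph inferInstance (isCompletelyUltrametrizable_modelSpace i)
    (mk_modelSpace hc i i.2)

theorem exists_injective_similarityType {n : ℕ} (hc : 𝔠 = aleph (n : Ordinal.{0})) :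
    ∃ Φ : Fin (n + 3) → PCUSimilarityType.{u}, Function.Injective Φ ∧
      ∀ i : Fin (n + 3), ∃ P : PCUSpace.{u}, Nonempty (P.carrier ≃ₜ ModelSpace i) ∧
        toAntisymmetrization (· ≤ ·) P = Φ i := by
  choose R hR using exists_modelPCUSpace.{u} hc
  refine ⟨fun i => toAntisymmetrization (· ≤ ·) (R i), ?_, fun i => ⟨R i, hR i, rfl⟩⟩
  have key : ∀ i j : Fin (n + 3), i < j →
      toAntisymmetrization (· ≤ ·) (R i) ≠ toAntisymmetrization (· ≤ ·) (R j) := by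
    intro i j hij h
    obtain ⟨e⟩ := hR i
    obtain ⟨e'⟩ := hR j
    have h' : R j ≤ R i := toAntisymmetrization_le_toAntisymmetrization_iff.1 h.ge
    exact not_modelSpace_condensesOnto hij ((PCUSpace.le_iff_of_homeomorph e' e).1 h')
  intro i j h
  rcases lt_trichotomy i j with h' | h' | h'
  · exact absurd h (key _ _ h')
  · exact h'
  · exact absurd h.symm (key _ _ h')

theorem PCUSpace.nonempty_carrier (P : PCUSpace.{u}) : Nonempty P.carrier := by
  rw [← mk_ne_zero_iff, P.card_eq]
  exact continuum_ne_zero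

theorem similarityType_le_iff_of_homeomorph {P Q : PCUSpace.{u}} {X Y : Type*}
    [TopologicalSpace X] [TopologicalSpace Y] (e : P.carrier ≃ₜ X) (e' : Q.carrier ≃ₜ Y) :
    toAntisymmetrization (· ≤ ·) P ≤ toAntisymmetrization (· ≤ ·) Q ↔ CondensesOnto Y X :=
  toAntisymmetrization_le_toAntisymmetrization_iff.trans (PCUSpace.le_iff_of_homeomorph e e')

theorem mk_similarityType_and_total {n : ℕ} (hc : 𝔠 = aleph (n : Ordinal.{0}))
    (hμ : ∀ κ : Type, Infinite κ → #κ ≤ aleph (n : Ordinal.{0}) → HasClosedFibers (ℕ → Bool) κ) :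
    #PCUSimilarityType.{u} = (n : Cardinal.{u + 1}) + 3 ∧
      ∀ s t : PCUSimilarityType.{u}, s ≤ t ∨ t ≤ s := by
  obtain ⟨Φ, hΦ, hR⟩ := exists_injective_similarityType.{u} hc
  choose R e hRΦ using hR
  have hsurj : Function.Surjective Φ := by
    intro s
    obtain ⟨P, rfl⟩ : ∃ P, toAntisymmetrization (· ≤ ·) P = s := Quotient.exists_rep s
    obtain ⟨Z, _, hp, hZ, hcard, ⟨eZ⟩⟩ := P.exists_homeomorph
    have : Nonempty Z := P.nonempty_carrier.map eZ
    obtain ⟨k, hk, hs⟩ := exists_similar_modelSpace hZ hμ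
      ((cellularityLE_mk Z).mono (hcard.trans hc).le)
    refine ⟨⟨k, hk⟩, ?_⟩
    obtain ⟨e⟩ := e ⟨k, hk⟩
    rw [← hRΦ]
    exact le_antisymm ((similarityType_le_iff_of_homeomorph e eZ).2 hs.1)
      ((similarityType_le_iff_of_homeomorph eZ e).2 hs.2)
  refine ⟨?_, fun s t => ?_⟩
  · rw [← mk_congr (Equiv.ulift.{u + 1}.trans (Equiv.ofBijective Φ ⟨hΦ, hsurj⟩))]
    simp
  · have hle : ∀ i j : Fin (n + 3), i ≤ j → Φ i ≤ Φ j := by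
      intro i j hij
      obtain ⟨e₁⟩ := e i
      obtain ⟨e₂⟩ := e j
      rw [← hRΦ, ← hRΦ]
      exact (similarityType_le_iff_of_homeomorph e₁ e₂).2 (modelSpace_condensesOnto hμ hij j.2)
    obtain ⟨i, rfl⟩ := hsurj s
    obtain ⟨j, rfl⟩ := hsurj t
    exact (le_total i j).imp (hle i j) (hle j i)

/-- The `n + 3` models already represent distinct types, so a count of exactly `n + 3` leaves no
room for a space `ω_{k+1} ^ ω` that is similar to none of them. -/
theorem hasClosedFibers_of_mk_similarityType {n : ℕ} (hc : 𝔠 = aleph (n : Ordinal.{0}))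
    (h : #PCUSimilarityType.{u} = (n : Cardinal.{u + 1}) + 3) :
    ∀ k < n, HasClosedFibers (ℕ → Bool) (AlephType (k + 1)) := by
  by_contra! hcon
  obtain ⟨k, hk, hns⟩ := exists_not_similar hcon
  obtain ⟨Φ, hΦ, hR⟩ := exists_injective_similarityType.{u} hc
  have h' : #PCUSimilarityType.{u} = ((n + 3 : ℕ) : Cardinal.{u + 1}) := by
    rw [h]
    simp
  have hfin : Finite PCUSimilarityType.{u} := by
    rw [← lt_aleph0_iff_finite, h']
    exact natCast_lt_aleph0
  have hbij : Function.Bijective Φ := hΦ.bijective_of_nat_card_le (by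
    rw [Nat.card_fin, Nat.card, h', toNat_natCast])
  obtain ⟨E, ⟨eE⟩⟩ := exists_pcuSpace_homeomorph.{u} (perfectSpace_sequences (AlephType (k + 1)))
    (isCompletelyUltrametrizable_sequences _) (mk_sequences (mk_alephType_le_continuum hc hk))
  obtain ⟨i, hi⟩ := hbij.2 (toAntisymmetrization (· ≤ ·) E)
  obtain ⟨P, ⟨eP⟩, hP⟩ := hR i
  rw [← hP] at hi
  exact not_similar_modelSpace hns i
    ⟨(similarityType_le_iff_of_homeomorph eP eE).1 hi.le,
      (similarityType_le_iff_of_homeomorph eE eP).1 hi.ge⟩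

/-- If comparability goes the other way and `2 ^ ω` condenses onto `X`, compactness makes that
condensation a homeomorphism, so `X` condenses onto `2 ^ ω` as well. -/
theorem condensesOnto_cantor_of_total (h : ∀ s t : PCUSimilarityType.{u}, s ≤ t ∨ t ≤ s)
    (X : PCUSpace.{u}) : CondensesOnto X.carrier (ℕ → Bool) := by
  obtain ⟨C, ⟨e⟩⟩ := exists_pcuSpace_homeomorph.{u} (perfectSpace_sequences Bool)
    (isCompletelyUltrametrizable_sequences Bool) (by simp)
  rcases h (toAntisymmetrization (· ≤ ·) C) (toAntisymmetrization (· ≤ ·) X) with h | h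
  · exact (similarityType_le_iff_of_homeomorph e (Homeomorph.refl X.carrier)).1 h
  · have := X.completelyUltrametrizable.t2Space
    obtain ⟨e'⟩ := CompactSpace.nonempty_homeomorph_of_condensesOnto
      ((similarityType_le_iff_of_homeomorph (Homeomorph.refl X.carrier) e).1 h)
    exact e'.condensesOnto_symm

/-- Apply the hypothesis to `κ × 2 ^ ω` with κ discrete, which has cardinality `𝔠` since `κ ≤ 𝔠`. -/
theorem hasClosedPartition_of_condensesOnto_cantor
    (h : ∀ X : PCUSpace.{u}, CondensesOnto X.carrier (ℕ → Bool)) (κ : Cardinal.{0}) (h₀ : κ ≠ 0)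
    (hκ : κ ≤ 𝔠) : HasClosedPartition (ℕ → Bool) κ := by
  let _ : TopologicalSpace κ.out := ⊥
  have : DiscreteTopology κ.out := ⟨rfl⟩
  have : Nonempty κ.out := by rwa [← mk_ne_zero_iff, mk_out]
  obtain ⟨P, ⟨e⟩⟩ := exists_pcuSpace_homeomorph.{u} (perfectSpace_discrete_prod κ.out)
    (isCompletelyUltrametrizable_discrete_prod κ.out) (mk_prod_cantor (by rwa [mk_out]))
  rw [← mk_out κ]
  exact (hasClosedPartition_iff _ _).2
    (hasClosedFibers_of_prod_condensesOnto (e.condensesOnto_symm.trans (h P)))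

end

theorem mainTheorem4 (n : ℕ) (hc : Cardinal.continuum.{0} = Cardinal.aleph (n : Ordinal.{0})) :
    List.TFAE [
      #PCUSimilarityType.{u} = (n : Cardinal.{u + 1}) + 3 ∧
        (∀ s t : PCUSimilarityType.{u}, s ≤ t ∨ t ≤ s),
      #PCUSimilarityType.{u} = (n : Cardinal.{u + 1}) + 3,
      ∀ s t : PCUSimilarityType.{u}, s ≤ t ∨ t ≤ s,
      ∀ X : PCUSpace.{u}, CondensesOnto X.carrier (ℕ → Bool),
      ∀ κ : Cardinal.{0}, κ ≠ 0 → κ ≤ Cardinal.continuum.{0} →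
        HasClosedPartition (ℕ → Bool) κ] := by
  tfae_have 1 → 2 := fun h => h.1
  tfae_have 1 → 3 := fun h => h.2
  tfae_have 3 → 4 := condensesOnto_cantor_of_total
  tfae_have 4 → 5 := hasClosedPartition_of_condensesOnto_cantor
  tfae_have 2 → 5 := fun h κ h₀ hκ =>
    hasClosedPartition_of_le (hasClosedFibers_of_mk_similarityType hc h) h₀ (hκ.trans hc.le)
  tfae_have 5 → 1 := fun h => mk_similarityType_and_total hc fun κ _ hκ =>
    (hasClosedPartition_iff _ _).1 (h _ (mk_ne_zero κ) (hκ.trans hc.ge))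
  tfae_finish
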